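/- **Theorem 1 (Existence Theorem).** Let $k\ge 1$, $h\ge 1$, and let $\mathbb B_k$ be a symmetric block-structure, that is, a symmetric $k\times k$ matrix whose entries are letters from an alphabet $\{1,\dots,h\}$. For elements $a_1,\dots,a_h$ let $\mathbb B_k(a_1,\dots,a_h)$ be the $k\times k$ matrix obtained by substituting $a_l$ for the letter $l$; if the $a_l$ are $n\times n$ matrices, this is read as an $nk\times nk$ block matrix. Let $\sigma_1^2,\dots,\sigma_h^2\ge 0$. Then there is a non-random, compactly supported, symmetric probability measure $\mu_{\mathbb B_k}$ on $\mathbb R$, depending only on $\mathbb B_k$ and on $\sigma_1^2,\dots,\sigma_h^2$ (so only on $\mathbb B_k$ if the variances are normalized to $\sigma_l^2=1$), with the following properties. 1. (Convergence.) For each $l=1,\dots,h$ let $(X_{ij}(l))_{i,j\ge 1}$ be an infinite Hermitian array of random variables on a common probability space such that $\{X_{ij}(l)\}_{i<j}$ are i.i.d. complex with $E X_{12}(l)=0$, $E|X_{12}(l)|^2=\sigma_l^2$ and $E|X_{12}(l)|^4<\infty$, and $\{X_{ii}(l)\}_{i\ge 1}$ are i.i.d. real with $E X_{11}(l)^2<\infty$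 and independent of $\{X_{ij}(l)\}_{i<j}$; suppose that the $h$ arrays are independent of each other. Put $\mathbf A_n(l)=n^{-1/2}(X_{ij}(l))_{i,j=1}^n$ and $\mathbf X_{n,k}=\mathbb B_k(\mathbf A_n(1),\dots,\mathbf A_n(h))$. Then, almost surely, the spectral measure $\frac1{nk}\sum_{j=1}^{nk}\delta_{\lambda_j}$ of $\mathbf X_{n,k}$, where $\lambda_1,\dots,\lambda_{nk}$ are its eigenvalues with multiplicity, converges weakly to $\mu_{\mathbb B_k}$ as $n\to\infty$. 2. (Moments.) There is a noncommutative $*$-probability space $(\mathcal A,\tau)$ containing a free family of selfadjoint elements $\mathbf a_1,\dots,\mathbf a_h$ such that $\mathbf a_l$ has the moments of the semicircle law with mean $0$ and variance $\sigma_l^2$ (the point mass at $0$ if $\sigma_l^2=0$); and for every such $(\mathcal A,\tau)$ and $\mathbf a_1,\dots,\mathbf a_h$, $$\int_{\mathbb R}x^s\,\mu_{\mathbb B_k}(dx)=(\tau\otimes\mathrm{tr}_k)\big(\mathbb B_k(\mathbf a_1,\dots,\mathbf a_h)^s\big)\qquad(s\ge 0),$$ where $(\tau\otimes\mathrm{tr}_k)(M)=\frac1k\sum_{i=1}^k\tau(M_{ii})$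 for a $k\times k$ matrix $M$ over $\mathcal A$. -/

import Mathlib

open MeasureTheory ProbabilityTheory Filter Topology
open scoped NNReal ENNReal ComplexOrder

universe u w

noncomputable section

/-! ### Spectral measures and block matrices -/

/-- The spectral measure `(1 / |ι|) ∑ δ_{λ_j}` of a Hermitian matrix, where the `λ_j` are its
eigenvalues counted with multiplicity. -/
def spectralMeasure {ι : Type*} [Fintype ι] [DecidableEq ι] [Nonempty ι]
    (M : Matrix ι ι ℂ) (hM : M.IsHermitian) : ProbabilityMeasure ℝ :=
  ⟨(Fintype.card ι : ℝ≥0∞)⁻¹ • ∑ j, Measure.dirac (hM.eigenvalues j), ⟨by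
    simp only [Measure.smul_apply, Measure.coe_finsetSum, Finset.sum_apply, measure_univ,
      Finset.sum_const, Finset.card_univ, nsmul_eq_mul, mul_one, smul_eq_mul]
    exact ENNReal.inv_mul_cancel (by simp) (ENNReal.natCast_ne_top _)⟩⟩

/-- Substitution of elements `a l` for the letters `l` of a block-structure `B`:
the matrix with entries `a (B p q)`. -/
def substitute {k h : ℕ} (B : Matrix (Fin k) (Fin k) (Fin h)) {α : Type*} (a : Fin h → α) :
    Matrix (Fin k) (Fin k) α :=
  B.map a

/-- The block matrix `B(A 1, …, A h)` of size `nk × nk`: its block in position `(p, q)` is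
the `n × n` matrix `A (B p q)`. -/
def blockMatrix {k h n : ℕ} (B : Matrix (Fin k) (Fin k) (Fin h))
    (A : Fin h → Matrix (Fin n) (Fin n) ℂ) : Matrix (Fin k × Fin n) (Fin k × Fin n) ℂ :=
  Matrix.comp (Fin k) (Fin k) (Fin n) (Fin n) ℂ (substitute B A)

lemma blockMatrix_isHermitian {k h n : ℕ} {B : Matrix (Fin k) (Fin k) (Fin h)} (hB : B.IsSymm)
    {A : Fin h → Matrix (Fin n) (Fin n) ℂ} (hA : ∀ l, (A l).IsHermitian) :
    (blockMatrix B A).IsHermitian := by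
  ext ⟨p, i⟩ ⟨q, j⟩
  have h1 : B q p = B p q := hB.apply p q
  simpa [blockMatrix, substitute, h1] using (hA (B p q)).apply i j

/-! ### Wigner matrices -/

variable {Ω : Type*} [MeasurableSpace Ω]

/-- An infinite Hermitian array of random variables whose entries above the diagonal are
i.i.d. complex, centred and of variance `v`, and whose diagonal entries are i.i.d. (real, because
the array is Hermitian) and independent of the entries above the diagonal.
Rows and columns are numbered from `0`. -/
structure IsWignerArray (X : ℕ → ℕ → Ω → ℂ) (v : ℝ≥0) (P : Measure Ω) : Prop where
  measurable : ∀ i j, Measurable (X i j)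
  hermitian : ∀ i j ω, X j i ω = star (X i j ω)
  indep_upper : iIndepFun (fun (p : {p : ℕ × ℕ // p.1 < p.2}) ω => X p.1.1 p.1.2 ω) P
  identDistrib_upper : ∀ i j, i < j → IdentDistrib (X i j) (X 0 1) P P
  memLp_upper : MemLp (X 0 1) 2 P
  mean_upper : ∫ ω, X 0 1 ω ∂P = 0
  variance_upper : ∫ ω, ‖X 0 1 ω‖ ^ 2 ∂P = v
  indep_diag : iIndepFun (fun i ω => X i i ω) P
  identDistrib_diag : ∀ i, IdentDistrib (X i i) (X 0 0) P P
  indep_diag_upper : IndepFun (fun ω i => X i i ω)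
    (fun ω (p : {p : ℕ × ℕ // p.1 < p.2}) => X p.1.1 p.1.2 ω) P

/-- The `n × n` Wigner matrix `n^{-1/2} (X i j)_{i, j < n}`. -/
def wignerMatrix (X : ℕ → ℕ → Ω → ℂ) (n : ℕ) (ω : Ω) : Matrix (Fin n) (Fin n) ℂ :=
  Matrix.of fun i j => ((√(n : ℝ))⁻¹ : ℝ) * X i j ω

lemma IsWignerArray.isHermitian {X : ℕ → ℕ → Ω → ℂ} {v : ℝ≥0} {P : Measure Ω}
    (hX : IsWignerArray X v P) (n : ℕ) (ω : Ω) : (wignerMatrix X n ω).IsHermitian := by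
  ext i j
  simp [wignerMatrix, hX.hermitian i j ω]

/-! ### Noncommutative probability -/

/-- The semicircle law centred at `0` and of variance `v`, with density
`(2πv)⁻¹ √(4v - x²)` on `[-2√v, 2√v]`; the point mass at `0` if `v = 0`.
(`√` vanishes on negative numbers.) -/
def semicircleLaw (v : ℝ≥0) : Measure ℝ :=
  if v = 0 then Measure.dirac 0
  else volume.withDensity fun x => ENNReal.ofReal ((2 * Real.pi * v)⁻¹ * √(4 * v - x ^ 2))

section Free

variable {𝒜 : Type*} [Ring 𝒜] [StarRing 𝒜] [Algebra ℂ 𝒜] [StarModule ℂ 𝒜]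

/-- `(𝒜, τ)` is a (`*`-)noncommutative probability space. -/
structure IsState (τ : 𝒜 →ₗ[ℂ] ℂ) : Prop where
  map_one : τ 1 = 1
  map_star : ∀ a, τ (star a) = star (τ a)
  nonneg : ∀ a, 0 ≤ τ (star a * a)

/-- Freeness of a family of unital subalgebras: `τ (x₀ ⋯ x_m) = 0` whenever `τ (x_i) = 0` for
all `i`, `x_i` lies in the subalgebra of index `j_i`, and consecutive indices are distinct. -/
def AreFree {J : Type*} (τ : 𝒜 →ₗ[ℂ] ℂ) (S : J → Subalgebra ℂ 𝒜) : Prop :=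
  ∀ (m : ℕ) (j : Fin (m + 1) → J) (x : Fin (m + 1) → 𝒜),
    (∀ i : Fin m, j i.castSucc ≠ j i.succ) → (∀ i, x i ∈ S (j i)) → (∀ i, τ (x i) = 0) →
      τ (List.ofFn x).prod = 0

/-- `a` is a free family of selfadjoint elements, `a l` having the semicircle law of
variance `v l`. -/
structure IsFreeSemicircular {J : Type*} (τ : 𝒜 →ₗ[ℂ] ℂ) (v : J → ℝ≥0) (a : J → 𝒜) : Prop where
  selfAdjoint : ∀ l, IsSelfAdjoint (a l)
  law : ∀ l (s : ℕ), τ (a l ^ s) = ((∫ x, x ^ s ∂semicircleLaw (v l) : ℝ) : ℂ)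
  free : AreFree τ fun l => Algebra.adjoin ℂ {a l}

/-- The state `τ ⊗ tr_k` on the `k × k` matrices over `𝒜`. -/
def tensorTrace (τ : 𝒜 →ₗ[ℂ] ℂ) {k : ℕ} (M : Matrix (Fin k) (Fin k) 𝒜) : ℂ :=
  (k : ℂ)⁻¹ * ∑ i, τ (M i i)

end Free

end

noncomputable section

/-! ### Weak convergence from Stieltjes transforms on the imaginary axis -/

open BoundedContinuousFunction

/-! Everything is read off a `k × k` matrix-valued Cauchy transform at points `z = iy`. Let `b_l` be
the 0/1 matrix marking the positions of the letter `l`, and let `η(D) = ∑ v_l b_l D b_l`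
(`covarianceMap`). The free model satisfies the Dyson equation `z G = 1 + G η(G)` exactly, and the
random block matrices satisfy it asymptotically. For large `|z|` its bounded solution is unique and
stable (`norm_sub_le_of_dyson`), so the two must agree in the limit.

Random side. The resolvent identity expands `E[X_ij R_ji]` in the single entry `X_ij`; independence
turns it into `v_l n^{-1/2} E[R_jj b_l R_ii]` up to summable errors
(`norm_integral_hermEntry_smul_sub_le`). Summing over all entries gives the expected equation with
error of order `n^{-1/2}` (`norm_integral_dyson_le`). Replacing one row of the upper triangles is a
perturbation of bounded rank, so the partial trace of the resolvent has differences of order `1/n`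
as a function of `n` independent rows; McDiarmid's inequality and Borel-Cantelli then give almost
sure concentration about the mean. Concentration also permits replacing `E[g η(g)]` by `E[g]
η(E[g])`, and stability yields `ae_tendsto_meanResolvent`.

Free side. Semicircular elements are realized as `√v (ℓ + ℓ^*)` on a full Fock space. Their
commutators with right creation operators are multiples of the vacuum projection, whence the exact
equation (`fock_dyson`). The Riesz-Markov theorem applied to the block operator in the C⋆-algebra of
matrices supplies the compactly supported measure `μ`, whose Cauchy transform is the normalized
trace of `G` (`exists_blockDistribution`).

Conclusion. Convergence of Cauchy transforms at the countably many points `iq`, `q` rational and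
large, already forces weak convergence (`tendsto_of_tendsto_stieltjes`); countability is what makes
the exceptional null sets harmless. Symmetry of `μ` follows from uniqueness, since `-G(-y)` solves
the same equation as `G(y)`. The moment formula holds for every free semicircular family because
freeness and the individual laws determine all joint moments (`IsFreeSemicircular.map_wordProd_eq`).
-/

lemma abs_le_norm_mul_I_sub (y x : ℝ) : |y| ≤ ‖(y : ℂ) * Complex.I - x‖ := by
  simpa using Complex.abs_im_le_norm ((y : ℂ) * Complex.I - x)

lemma mul_I_sub_ne_zero {y : ℝ} (hy : y ≠ 0) (x : ℝ) : (y : ℂ) * Complex.I - x ≠ 0 := by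
  intro h
  have := abs_le_norm_mul_I_sub y x
  rw [h, norm_zero] at this
  exact hy (abs_nonpos_iff.1 this)

lemma norm_inv_mul_I_sub_le {y : ℝ} (hy : y ≠ 0) (x : ℝ) :
    ‖((y : ℂ) * Complex.I - x)⁻¹‖ ≤ |y|⁻¹ := by
  rw [norm_inv]
  exact inv_anti₀ (abs_pos.2 hy) (abs_le_norm_mul_I_sub y x)

/-- The bounded continuous function `x ↦ (i y - x)⁻¹`, for `y ≠ 0`. -/
def cauchyKernel (y : {y : ℝ // y ≠ 0}) : ℝ →ᵇ ℂ :=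
  BoundedContinuousFunction.ofNormedAddCommGroup (fun x : ℝ => ((y : ℂ) * Complex.I - x)⁻¹)
    (Continuous.inv₀ (by fun_prop) (mul_I_sub_ne_zero y.2)) |(y : ℝ)|⁻¹
    (norm_inv_mul_I_sub_le y.2)

lemma cauchyKernel_apply (y : {y : ℝ // y ≠ 0}) (x : ℝ) :
    cauchyKernel y x = ((y : ℂ) * Complex.I - x)⁻¹ := rfl

lemma norm_cauchyKernel_le (y : {y : ℝ // y ≠ 0}) : ‖cauchyKernel y‖ ≤ |(y : ℝ)|⁻¹ :=
  BoundedContinuousFunction.norm_ofNormedAddCommGroup_le _ (by positivity) _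

lemma star_cauchyKernel (y : {y : ℝ // y ≠ 0}) :
    star (cauchyKernel y) = cauchyKernel ⟨-y, neg_ne_zero.2 y.2⟩ := by
  ext x
  simp [cauchyKernel_apply]

/-- The scalar resolvent identity: it turns products of kernels into linear combinations, so that
the span of the kernels is almost an algebra. -/
lemma cauchyKernel_sub (y w : {y : ℝ // y ≠ 0}) :
    cauchyKernel y - cauchyKernel w
      = ((((w : ℝ) - (y : ℝ) : ℝ) : ℂ) * Complex.I) • (cauchyKernel y * cauchyKernel w) := by
  ext x
  have h1 := mul_I_sub_ne_zero y.2 x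
  have h2 := mul_I_sub_ne_zero w.2 x
  simp only [coe_sub, Pi.sub_apply, cauchyKernel_apply, coe_smul, coe_mul, Pi.mul_apply,
    smul_eq_mul]
  rw [inv_sub_inv h1 h2, ← mul_inv, div_eq_mul_inv]
  push_cast
  ring

/-- The set of all kernels `cauchyKernel y` for rational `y` with `|y| > y₀`, and `1`. -/
def cauchyKernels (y₀ : ℝ) : Set (ℝ →ᵇ ℂ) :=
  insert 1 {f | ∃ y : {y : ℝ // y ≠ 0}, (∃ q : ℚ, (q : ℝ) = y) ∧ y₀ < |(y : ℝ)| ∧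
    f = cauchyKernel y}

/-- For distinct parameters the resolvent identity can be divided by their difference. A square is a
uniform limit of products with distinct parameters, which is why the closure of the span is needed.
-/
lemma cauchyKernel_mul_mem (y₀ : ℝ) (y w : {y : ℝ // y ≠ 0})
    (hy : ∃ q : ℚ, (q : ℝ) = y) (hw : ∃ q : ℚ, (q : ℝ) = w) (hy₀ : y₀ < |(y : ℝ)|)
    (hw₀ : y₀ < |(w : ℝ)|) :
    cauchyKernel y * cauchyKernel w ∈
      (Submodule.span ℂ (cauchyKernels y₀)).topologicalClosure := by
  have hne : ∀ w : {y : ℝ // y ≠ 0}, (∃ q : ℚ, (q : ℝ) = w) → y₀ < |(w : ℝ)| → y ≠ w →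
      cauchyKernel y * cauchyKernel w ∈ Submodule.span ℂ (cauchyKernels y₀) := by
    intro w hw hw₀ hyw
    have h0 : ((((w : ℝ) - (y : ℝ) : ℝ) : ℂ) * Complex.I) ≠ 0 := by
      refine mul_ne_zero ?_ Complex.I_ne_zero
      exact_mod_cast sub_ne_zero.2 fun h => hyw (Subtype.ext h.symm)
    have := cauchyKernel_sub y w
    rw [← inv_smul_eq_iff₀ h0] at this
    rw [← this]
    refine Submodule.smul_mem _ _ (Submodule.sub_mem _ ?_ ?_)
    · exact Submodule.subset_span (Or.inr ⟨y, hy, hy₀, rfl⟩)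
    · exact Submodule.subset_span (Or.inr ⟨w, hw, hw₀, rfl⟩)
  rcases ne_or_eq y w with hyw | rfl
  · exact Submodule.le_topologicalClosure _ (hne w hw hw₀ hyw)
  · have ha : ∀ m : ℕ, (1 : ℝ) < 1 + 1 / ((m : ℝ) + 1) := fun m => by
      have : (0 : ℝ) < 1 / ((m : ℝ) + 1) := by positivity
      linarith
    -- Scaling by a rational factor larger than `1` keeps the parameter rational and nonzero,
    -- increases its absolute value beyond `y₀`, and makes it differ from `y`.
    let s : ℕ → {y : ℝ // y ≠ 0} := fun m =>
      ⟨y * (1 + 1 / ((m : ℝ) + 1)), mul_ne_zero y.2 (by linarith [ha m])⟩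
    have hs : ∀ m, cauchyKernel y * cauchyKernel (s m) ∈
        Submodule.span ℂ (cauchyKernels y₀) := by
      intro m
      refine hne _ ?_ ?_ ?_
      · obtain ⟨q, hq⟩ := hy
        exact ⟨q * (1 + 1 / ((m : ℚ) + 1)), by simp [s, hq]⟩
      · change y₀ < |(y : ℝ) * _|
        rw [abs_mul, abs_of_pos (by linarith [ha m] : (0 : ℝ) < 1 + 1 / ((m : ℝ) + 1))]
        have := abs_nonneg (y : ℝ)
        nlinarith [ha m]
      · intro h
        have h1 : (y : ℝ) = y * (1 + 1 / ((m : ℝ) + 1)) := congrArg Subtype.val h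
        have h2 : (1 : ℝ) = 1 + 1 / ((m : ℝ) + 1) := by
          apply mul_left_cancel₀ y.2
          linarith
        linarith [ha m]
    refine mem_closure_of_tendsto (f := fun m => cauchyKernel y * cauchyKernel (s m)) (b := atTop)
      ?_ (Eventually.of_forall hs)
    refine Tendsto.const_mul _ ?_
    rw [tendsto_iff_norm_sub_tendsto_zero]
    have hlim : Tendsto (fun m : ℕ => 1 / ((m : ℝ) + 1) * |(y : ℝ)|⁻¹) atTop (𝓝 (0 * |(y : ℝ)|⁻¹)) :=
      tendsto_one_div_add_atTop_nhds_zero_nat.mul_const _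
    rw [zero_mul] at hlim
    refine squeeze_zero (fun _ => norm_nonneg _) (fun m => ?_) hlim
    have hpos := abs_pos.2 y.2
    have hsm : |(y : ℝ)| ≤ |((s m : {y : ℝ // y ≠ 0}) : ℝ)| := by
      change _ ≤ |(y : ℝ) * _|
      rw [abs_mul, abs_of_pos (by linarith [ha m] : (0 : ℝ) < 1 + 1 / ((m : ℝ) + 1))]
      nlinarith [ha m]
    rw [cauchyKernel_sub, norm_smul]
    have h3 : ‖((((y : ℝ) - ((s m : {y : ℝ // y ≠ 0}) : ℝ) : ℝ) : ℂ) * Complex.I)‖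
        = |(y : ℝ)| * (1 / ((m : ℝ) + 1)) := by
      rw [norm_mul, Complex.norm_I, mul_one, Complex.norm_real, Real.norm_eq_abs]
      change |(y : ℝ) - y * (1 + 1 / ((m : ℝ) + 1))| = _
      rw [show (y : ℝ) - y * (1 + 1 / ((m : ℝ) + 1)) = -(y * (1 / ((m : ℝ) + 1))) by ring, abs_neg,
        abs_mul, abs_of_nonneg (by positivity : (0 : ℝ) ≤ 1 / ((m : ℝ) + 1))]
    rw [h3]
    calc |(y : ℝ)| * (1 / ((m : ℝ) + 1)) * ‖cauchyKernel (s m) * cauchyKernel y‖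
        ≤ |(y : ℝ)| * (1 / ((m : ℝ) + 1)) * (|(y : ℝ)|⁻¹ * |(y : ℝ)|⁻¹) := by
          gcongr
          refine (norm_mul_le _ _).trans ?_
          gcongr
          · exact (norm_cauchyKernel_le _).trans (inv_anti₀ hpos hsm)
          · exact norm_cauchyKernel_le _
      _ = 1 / ((m : ℝ) + 1) * |(y : ℝ)|⁻¹ := by field_simp

lemma mul_mem_topologicalClosure_span {s : Set (ℝ →ᵇ ℂ)}
    (hs : ∀ f ∈ s, ∀ g ∈ s, f * g ∈ (Submodule.span ℂ s).topologicalClosure) {f g : ℝ →ᵇ ℂ}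
    (hf : f ∈ (Submodule.span ℂ s).topologicalClosure)
    (hg : g ∈ (Submodule.span ℂ s).topologicalClosure) :
    f * g ∈ (Submodule.span ℂ s).topologicalClosure := by
  set V := (Submodule.span ℂ s).topologicalClosure with hV
  have hcl : IsClosed (V : Set (ℝ →ᵇ ℂ)) := Submodule.isClosed_topologicalClosure _
  have h1 : ∀ f ∈ Submodule.span ℂ s, ∀ g ∈ Submodule.span ℂ s, f * g ∈ V := by
    intro f hf g hg
    induction hf, hg using Submodule.span_induction₂ with
    | mem_mem x y hx hy => exact hs x hx y hy
    | zero_left y hy => simp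
    | zero_right x hx => simp
    | add_left x y z _ _ _ h1 h2 => rw [add_mul]; exact V.add_mem h1 h2
    | add_right x y z _ _ _ h1 h2 => rw [mul_add]; exact V.add_mem h1 h2
    | smul_left r x y _ _ h => rw [smul_mul_assoc]; exact V.smul_mem _ h
    | smul_right r x y _ _ h => rw [mul_smul_comm]; exact V.smul_mem _ h
  have := map_mem_closure₂ (f := fun f g : ℝ →ᵇ ℂ => f * g) continuous_mul
    (s := (Submodule.span ℂ s : Set (ℝ →ᵇ ℂ)))
    (t := (Submodule.span ℂ s : Set (ℝ →ᵇ ℂ))) (u := V) hf hg h1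
  rwa [hcl.closure_eq] at this

/-- The closed star subalgebra spanned by `1` and the kernels `cauchyKernel y`, `y` rational,
`|y| > y₀`. -/
def cauchyAlgebra (y₀ : ℝ) : StarSubalgebra ℂ (ℝ →ᵇ ℂ) where
  carrier := (Submodule.span ℂ (cauchyKernels y₀)).topologicalClosure
  mul_mem' := by
    refine mul_mem_topologicalClosure_span ?_
    have hle := Submodule.le_topologicalClosure (Submodule.span ℂ (cauchyKernels y₀))
    rintro f (rfl | hf) g (rfl | hg)
    · rw [one_mul]; exact hle (Submodule.subset_span (Or.inl rfl))
    · rw [one_mul]; exact hle (Submodule.subset_span (Or.inr hg))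
    · rw [mul_one]; exact hle (Submodule.subset_span (Or.inr hf))
    · obtain ⟨y, hy, hy', rfl⟩ := hf
      obtain ⟨w, hw, hw', rfl⟩ := hg
      exact cauchyKernel_mul_mem y₀ y w hy hw hy' hw'
  add_mem' := Submodule.add_mem _
  algebraMap_mem' r := by
    rw [Algebra.algebraMap_eq_smul_one]
    exact Submodule.smul_mem _ _ (Submodule.le_topologicalClosure _
      (Submodule.subset_span (Or.inl rfl)))
  star_mem' := by
    intro f hf
    refine map_mem_closure (f := fun f : ℝ →ᵇ ℂ => star f) continuous_star hf ?_
    intro g hg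
    change star g ∈ Submodule.span ℂ (cauchyKernels y₀)
    induction hg using Submodule.span_induction with
    | mem x hx =>
      rcases hx with rfl | ⟨y, ⟨q, hq⟩, hy', rfl⟩
      · rw [star_one]; exact Submodule.subset_span (Or.inl rfl)
      · rw [star_cauchyKernel]
        exact Submodule.subset_span (Or.inr ⟨_, ⟨-q, by simp [hq]⟩, by simpa using hy', rfl⟩)
    | zero => rw [star_zero]; exact Submodule.zero_mem _
    | add x y _ _ h1 h2 => rw [star_add]; exact Submodule.add_mem _ h1 h2
    | smul a x _ h => rw [star_smul]; exact Submodule.smul_mem _ _ h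

lemma integral_cauchyKernel_neg (y : {y : ℝ // y ≠ 0}) (μ : Measure ℝ) :
    ∫ x, cauchyKernel ⟨-y, neg_ne_zero.2 y.2⟩ x ∂μ = star (∫ x, cauchyKernel y x ∂μ) := by
  rw [← star_cauchyKernel]
  exact integral_conj

/-- Integration against a probability measure is `1`-Lipschitz in the sup norm, uniformly in the
measure. The functionals are therefore equicontinuous and the set of `f` whose integrals converge is
closed; by linearity only the kernels need checking, and negative parameters follow by conjugation.
-/
lemma integral_tendsto_of_mem_cauchyAlgebra {y₀ : ℝ} {μs : ℕ → ProbabilityMeasure ℝ}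
    {μ : ProbabilityMeasure ℝ}
    (h : ∀ q : ℚ, y₀ < q → Tendsto (fun n => ∫ x : ℝ, (((q : ℝ) : ℂ) * Complex.I - x)⁻¹ ∂(μs n))
      atTop (𝓝 (∫ x : ℝ, (((q : ℝ) : ℂ) * Complex.I - x)⁻¹ ∂μ))) {g : ℝ →ᵇ ℂ}
    (hg : g ∈ cauchyAlgebra y₀) :
    Tendsto (fun n => ∫ x, g x ∂(μs n)) atTop (𝓝 (∫ x, g x ∂μ)) := by
  have hdist : ∀ (ν : ProbabilityMeasure ℝ) (f g : ℝ →ᵇ ℂ),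
      dist (∫ x, f x ∂ν) (∫ x, g x ∂ν) ≤ dist f g := by
    intro ν f g
    rw [dist_eq_norm, dist_eq_norm, ← integral_sub (f.integrable _) (g.integrable _)]
    simpa using BoundedContinuousFunction.norm_integral_le_norm (ν : Measure ℝ) (f - g)
  have hlip : ∀ ν : ProbabilityMeasure ℝ, LipschitzWith 1 fun f : ℝ →ᵇ ℂ => ∫ x, f x ∂ν :=
    fun ν => LipschitzWith.of_dist_le_mul fun f g => by simpa using hdist ν f g
  have hequi : Equicontinuous fun (n : ℕ) (f : ℝ →ᵇ ℂ) => ∫ x, f x ∂(μs n) :=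
    (LipschitzWith.uniformEquicontinuous _ 1 fun n => hlip (μs n)).equicontinuous
  have hclosed := hequi.isClosed_setOfPred_tendsto (l := atTop) (hlip μ).continuous
  refine closure_minimal ?_ hclosed hg
  intro f hf
  change Tendsto _ _ _
  induction hf using Submodule.span_induction with
  | mem x hx =>
    rcases hx with rfl | ⟨y, ⟨q, hq⟩, hy', rfl⟩
    · simp
    · have hpos : ∀ y : {y : ℝ // y ≠ 0}, (∃ q : ℚ, (q : ℝ) = y) → y₀ < y →
          Tendsto (fun n => ∫ x, cauchyKernel y x ∂(μs n)) atTop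
            (𝓝 (∫ x, cauchyKernel y x ∂μ)) := by
        rintro y ⟨q, hq⟩ hy
        have := h q (hq ▸ hy)
        rw [hq] at this
        exact this
      rcases lt_or_ge (0 : ℝ) y with hy | hy
      · rw [abs_of_pos hy] at hy'
        exact hpos y ⟨q, hq⟩ hy'
      · rw [abs_of_nonpos hy] at hy'
        have h1 := hpos ⟨-y, neg_ne_zero.2 y.2⟩ ⟨-q, by simp [hq]⟩ hy'
        have h2 := h1.star
        simp_rw [integral_cauchyKernel_neg, star_star] at h2
        exact h2
  | zero => simp
  | add x y _ _ h1 h2 =>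
    have := h1.add h2
    simp_rw [← integral_add (x.integrable _) (y.integrable _)] at this
    exact this
  | smul a x _ h =>
    have := h.const_mul a
    simp_rw [← integral_const_mul] at this
    exact this

/-- A single kernel is already injective on the real line. -/
lemma separatesPoints_cauchyAlgebra (y₀ : ℝ) :
    ((cauchyAlgebra y₀).map (toContinuousMapStarₐ ℂ)).SeparatesPoints := by
  intro a b hab
  obtain ⟨q, hq⟩ := exists_rat_gt (max y₀ 0)
  have hq0 : (q : ℝ) ≠ 0 := ((le_max_right _ _).trans_lt hq).ne'
  have hmem : cauchyKernel ⟨q, hq0⟩ ∈ cauchyAlgebra y₀ :=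
    Submodule.le_topologicalClosure _ (Submodule.subset_span
      (Or.inr ⟨_, ⟨q, rfl⟩, ((le_max_left _ _).trans_lt hq).trans_le (le_abs_self _), rfl⟩))
  refine ⟨_, ⟨toContinuousMapStarₐ ℂ (cauchyKernel ⟨q, hq0⟩), ⟨_, hmem, rfl⟩, rfl⟩, ?_⟩
  intro h
  have h' : cauchyKernel ⟨q, hq0⟩ a = cauchyKernel ⟨q, hq0⟩ b := h
  rw [cauchyKernel_apply, cauchyKernel_apply, inv_inj, sub_right_inj] at h'
  exact hab (by exact_mod_cast h')

/-- The integrand on the right is at least `1` where `|x| > y`, so for `y > 0` the Cauchy transform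
at one point controls the tails; this is the source of tightness. -/
lemma one_add_mul_im_integral_cauchyKernel (ν : ProbabilityMeasure ℝ) (y : {y : ℝ // y ≠ 0}) :
    2 * (1 + y * (∫ x, cauchyKernel y x ∂ν).im)
      = ∫ x, 2 * x ^ 2 / ((y : ℝ) ^ 2 + x ^ 2) ∂(ν : Measure ℝ) := by
  have hint : Integrable (fun x => cauchyKernel y x) (ν : Measure ℝ) :=
    (cauchyKernel y).integrable _
  have hint' : Integrable (fun x => (cauchyKernel y x).im) (ν : Measure ℝ) := hint.im
  have h1 : (∫ x, cauchyKernel y x ∂(ν : Measure ℝ)).im = ∫ x, (cauchyKernel y x).im ∂ν :=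
    (integral_im hint).symm
  have h2 : ∀ x : ℝ, 2 * x ^ 2 / ((y : ℝ) ^ 2 + x ^ 2)
      = 2 * (1 + y * (cauchyKernel y x).im) := by
    intro x
    have h0 : (y : ℝ) ≠ 0 := y.2
    have hp : (0 : ℝ) < (y : ℝ) ^ 2 + x ^ 2 := by positivity
    have him : (cauchyKernel y x).im = -(y : ℝ) / (y ^ 2 + x ^ 2) := by
      rw [cauchyKernel_apply, Complex.inv_im]
      simp [Complex.normSq_apply]
      ring
    rw [him]
    field_simp
    ring
  simp_rw [h2]
  rw [h1, integral_const_mul, integral_add (integrable_const _) (hint'.const_mul _),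
    integral_const_mul]
  simp

lemma measure_norm_gt_le (ν : ProbabilityMeasure ℝ) (y : {y : ℝ // y ≠ 0}) (hy : 0 < (y : ℝ)) :
    (ν : Measure ℝ) {x | (y : ℝ) < ‖x‖}
      ≤ ENNReal.ofReal (2 * (1 + y * (∫ x, cauchyKernel y x ∂ν).im)) := by
  rw [one_add_mul_im_integral_cauchyKernel]
  have hmeas : MeasurableSet {x : ℝ | (y : ℝ) < ‖x‖} := measurableSet_lt measurable_const
    measurable_norm
  have hp : ∀ x : ℝ, (0 : ℝ) < (y : ℝ) ^ 2 + x ^ 2 := fun x => by positivity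
  have h3 : ((ν : Measure ℝ).real {x | (y : ℝ) < ‖x‖})
      ≤ ∫ x, 2 * x ^ 2 / ((y : ℝ) ^ 2 + x ^ 2) ∂(ν : Measure ℝ) := by
    rw [← integral_indicator_one hmeas]
    refine integral_mono ?_ ?_ ?_
    · exact (integrable_const (1 : ℝ)).indicator hmeas
    · refine Integrable.of_bound (C := 2) (Measurable.aestronglyMeasurable (by fun_prop)) ?_
      refine Eventually.of_forall fun x => ?_
      rw [Real.norm_of_nonneg (by have := hp x; positivity), div_le_iff₀ (hp x)]
      nlinarith [sq_nonneg (y : ℝ)]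
    · intro x
      change _ ≤ 2 * x ^ 2 / ((y : ℝ) ^ 2 + x ^ 2)
      by_cases hx : x ∈ {x : ℝ | (y : ℝ) < ‖x‖}
      · rw [Set.indicator_of_mem hx, Pi.one_apply, le_div_iff₀ (hp x)]
        have hx' : (y : ℝ) < |x| := hx
        have : (y : ℝ) ^ 2 < |x| ^ 2 := by gcongr
        rw [sq_abs] at this
        linarith
      · rw [Set.indicator_of_notMem hx]
        have := hp x
        positivity
  rw [← ENNReal.ofReal_toReal (measure_ne_top (ν : Measure ℝ) _)]
  exact ENNReal.ofReal_le_ofReal h3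

lemma tendsto_integral_sq_div (ν : ProbabilityMeasure ℝ) :
    Tendsto (fun m : ℕ => ∫ x, 2 * x ^ 2 / (((m : ℝ) + 1) ^ 2 + x ^ 2) ∂(ν : Measure ℝ))
      atTop (𝓝 0) := by
  rw [← integral_zero ℝ ℝ (μ := (ν : Measure ℝ))]
  refine tendsto_integral_of_dominated_convergence (fun _ => (2 : ℝ))
    (fun m => Measurable.aestronglyMeasurable (by fun_prop)) (integrable_const _) ?_ ?_
  · intro m
    refine Eventually.of_forall fun x => ?_
    have hp : (0 : ℝ) < ((m : ℝ) + 1) ^ 2 + x ^ 2 := by positivity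
    rw [Real.norm_of_nonneg (by positivity), div_le_iff₀ hp]
    nlinarith [sq_nonneg ((m : ℝ) + 1)]
  · refine Eventually.of_forall fun x => ?_
    refine Tendsto.div_atTop tendsto_const_nhds ?_
    refine tendsto_atTop_add_const_right _ _ ?_
    refine (tendsto_pow_atTop two_ne_zero).comp ?_
    exact tendsto_atTop_add_const_right _ _ tendsto_natCast_atTop_atTop

/-- Pointwise convergence of the Stieltjes transforms at the points `i q`, `q > y₀` rational,
implies weak convergence. -/
theorem tendsto_of_tendsto_stieltjes {y₀ : ℝ} {μs : ℕ → ProbabilityMeasure ℝ}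
    {μ : ProbabilityMeasure ℝ}
    (h : ∀ q : ℚ, y₀ < q → Tendsto (fun n => ∫ x : ℝ, (((q : ℝ) : ℂ) * Complex.I - x)⁻¹ ∂(μs n))
      atTop (𝓝 (∫ x : ℝ, (((q : ℝ) : ℂ) * Complex.I - x)⁻¹ ∂μ))) :
    Tendsto μs atTop (𝓝 μ) := by
  refine ProbabilityMeasure.tendsto_of_tight_of_separatesPoints ℂ ?_
    (separatesPoints_cauchyAlgebra y₀) fun g hg => integral_tendsto_of_mem_cauchyAlgebra h hg
  refine isTightMeasureSet_range_of_tendsto_limsup_measure_norm_gt ?_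
  rw [ENNReal.tendsto_nhds_zero]
  intro ε hε
  obtain ⟨δ, hδ0, hδ⟩ : ∃ δ : ℝ, 0 < δ ∧ ENNReal.ofReal δ ≤ ε := by
    rcases eq_or_ne ε ⊤ with rfl | hε'
    · exact ⟨1, one_pos, le_top⟩
    · exact ⟨ε.toReal, ENNReal.toReal_pos hε.ne' hε', ENNReal.ofReal_toReal_le⟩
  -- Tightness: choose an integer level at which the tail bound for the limit `μ` is below `δ`.
  -- Convergence of the transform at that single point carries the bound over to all large `n`.
  have h1 := (tendsto_integral_sq_div μ).eventually (gt_mem_nhds hδ0)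
  have h2 : ∀ᶠ m : ℕ in atTop, y₀ < (m : ℝ) + 1 :=
    (tendsto_atTop_add_const_right _ _ tendsto_natCast_atTop_atTop).eventually_gt_atTop _
  obtain ⟨m, hm1, hm2⟩ := (h1.and h2).exists
  let y : {y : ℝ // y ≠ 0} := ⟨(m : ℝ) + 1, by positivity⟩
  have hy : (0 : ℝ) < y := by change (0 : ℝ) < m + 1; positivity
  have h3 := h (m + 1) (by push_cast; exact hm2)
  have h4 : Tendsto (fun n => 2 * (1 + (y : ℝ) * (∫ x, cauchyKernel y x ∂(μs n)).im)) atTop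
      (𝓝 (2 * (1 + (y : ℝ) * (∫ x, cauchyKernel y x ∂μ).im))) := by
    refine Tendsto.const_mul _ (Tendsto.const_add _ (Tendsto.const_mul _ ?_))
    refine (Complex.continuous_im.tendsto _).comp ?_
    push_cast at h3
    simpa [cauchyKernel_apply, y] using h3
  rw [one_add_mul_im_integral_cauchyKernel μ y] at h4
  filter_upwards [eventually_ge_atTop (y : ℝ)] with r hr
  refine limsup_le_of_le (by isBoundedDefault) ?_
  filter_upwards [h4.eventually (gt_mem_nhds hm1)] with n hn
  calc (μs n : Measure ℝ) {x | r < ‖x‖} ≤ (μs n : Measure ℝ) {x | (y : ℝ) < ‖x‖} :=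
        measure_mono fun x hx => lt_of_le_of_lt hr hx
    _ ≤ ENNReal.ofReal (2 * (1 + y * (∫ x, cauchyKernel y x ∂(μs n)).im)) :=
        measure_norm_gt_le _ _ hy
    _ ≤ ENNReal.ofReal δ := ENNReal.ofReal_le_ofReal hn.le
    _ ≤ ε := hδ

end

noncomputable section

/-! ### The bounded differences inequality -/

section BoundedDifferences

variable {E : Type*} [MeasurableSpace E]

/-- McDiarmid's inequality, in exponential form. -/
theorem integral_exp_le_of_bounded_differences {c b : ℝ} (hc : 0 ≤ c) (t : ℝ) :
    ∀ (n : ℕ) (μ : Fin n → Measure E) [∀ i, IsProbabilityMeasure (μ i)]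
      (f : (Fin n → E) → ℝ), Measurable f → (∀ x, |f x| ≤ b) →
      (∀ x i y, |f x - f (Function.update x i y)| ≤ c) →
      ∫ x, Real.exp (t * (f x - ∫ y, f y ∂(Measure.pi μ))) ∂(Measure.pi μ)
        ≤ Real.exp (n * c ^ 2 * t ^ 2 / 2) := by
  intro n
  induction n with
  | zero =>
    intro μ _ f hf hb hd
    have h0 : ∀ x, f x = f default := fun x => congrArg f (Subsingleton.elim _ _)
    simp [h0]
  | succ n ih =>
    intro μ _ f hf hb hd
    -- Split off coordinate `0`. Averaging over it leaves a function `g` of the other coordinates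
    -- with the same difference bound, to which induction applies; the deviation from `g` is handled
    -- by Hoeffding's lemma for fixed other coordinates.
    set ν : Measure (Fin n → E) := Measure.pi fun j => μ (Fin.succ j) with hν
    have hmp := measurePreserving_piFinSuccAbove μ 0
    set e := MeasurableEquiv.piFinSuccAbove (fun _ : Fin (n + 1) => E) 0 with he
    have hsymm : ∀ p : E × (Fin n → E), e.symm p = Fin.cons p.1 p.2 := by
      intro p
      simp [he, MeasurableEquiv.piFinSuccAbove, Fin.insertNthEquiv]
    have hchange : ∀ φ : (Fin (n + 1) → E) → ℝ, ∫ x, φ x ∂(Measure.pi μ)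
        = ∫ p : E × (Fin n → E), φ (Fin.cons p.1 p.2) ∂((μ 0).prod ν) := by
      intro φ
      have h1 := hmp.symm.integral_comp' φ
      rw [← h1]
      refine integral_congr_ae (Eventually.of_forall fun p => ?_)
      change φ (e.symm p) = _
      rw [hsymm]
    have hconsmeas : Measurable fun p : E × (Fin n → E) =>
        (Fin.cons p.1 p.2 : Fin (n + 1) → E) := by
      have : (fun p : E × (Fin n → E) => (Fin.cons p.1 p.2 : Fin (n + 1) → E)) = e.symm :=
        funext fun p => (hsymm p).symm
      rw [this]
      exact e.symm.measurable
    set F : E × (Fin n → E) → ℝ := fun p => f (Fin.cons p.1 p.2) with hF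
    have hFm : Measurable F := hf.comp hconsmeas
    have hFb : ∀ p, |F p| ≤ b := fun p => hb _
    have hFx : ∀ x, Measurable fun a => F (a, x) := fun x =>
      hFm.comp (measurable_id.prodMk measurable_const)
    have hFint : ∀ x, Integrable (fun a => F (a, x)) (μ 0) := fun x =>
      Integrable.of_bound (hFx x).aestronglyMeasurable b (Eventually.of_forall fun a => hFb _)
    set g : (Fin n → E) → ℝ := fun x => ∫ a, F (a, x) ∂(μ 0) with hg
    have hgm : Measurable g :=
      (hFm.stronglyMeasurable.integral_prod_left' (μ := μ 0)).measurable
    have hgb : ∀ x, |g x| ≤ b := fun x => by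
      have := norm_integral_le_of_norm_le_const (μ := μ 0) (f := fun a => F (a, x)) (C := b)
        (Eventually.of_forall fun a => hFb _)
      simpa using this
    have hgd : ∀ x i y, |g x - g (Function.update x i y)| ≤ c := by
      intro x i y
      rw [hg]
      simp only
      rw [← integral_sub (hFint _) (hFint _)]
      have := norm_integral_le_of_norm_le_const (μ := μ 0)
        (f := fun a => F (a, x) - F (a, Function.update x i y)) (C := c)
        (Eventually.of_forall fun a => by
          have := hd (Fin.cons a x) i.succ y
          rw [← Fin.cons_update] at this
          exact this)
      simpa using this
    have hFprod : Integrable F ((μ 0).prod ν) :=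
      Integrable.of_bound hFm.aestronglyMeasurable b (Eventually.of_forall hFb)
    have hmean : ∫ y, f y ∂(Measure.pi μ) = ∫ y, g y ∂ν := by
      rw [hchange f, ← integral_prod_symm _ hFprod]
    rw [hchange, hmean]
    set m := ∫ y, g y ∂ν with hm
    have hmb : |m| ≤ b := by
      have := norm_integral_le_of_norm_le_const (μ := ν) (f := g) (C := b)
        (Eventually.of_forall hgb)
      simpa using this
    have hexpb : ∀ u : ℝ, |u| ≤ b → Real.exp (t * (u - m)) ≤ Real.exp (|t| * (b + b)) := by
      intro u hu
      refine Real.exp_le_exp.2 ?_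
      calc t * (u - m) ≤ |t * (u - m)| := le_abs_self _
        _ = |t| * |u - m| := abs_mul _ _
        _ ≤ |t| * (b + b) := by
          gcongr
          exact (abs_sub _ _).trans (add_le_add hu hmb)
    have hint : Integrable (fun p : E × (Fin n → E) => Real.exp (t * (F p - m)))
        ((μ 0).prod ν) := by
      refine Integrable.of_bound (Measurable.aestronglyMeasurable (by fun_prop))
        (Real.exp (|t| * (b + b))) (Eventually.of_forall fun p => ?_)
      rw [Real.norm_of_nonneg (Real.exp_pos _).le]
      exact hexpb _ (hFb p)
    have hgint : Integrable (fun x => Real.exp (t * (g x - m))) ν := by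
      refine Integrable.of_bound (Measurable.aestronglyMeasurable (by fun_prop))
        (Real.exp (|t| * (b + b))) (Eventually.of_forall fun p => ?_)
      rw [Real.norm_of_nonneg (Real.exp_pos _).le]
      exact hexpb _ (hgb p)
    have hinner : ∀ x, ∫ a, Real.exp (t * (F (a, x) - m)) ∂(μ 0)
        ≤ Real.exp (c ^ 2 * t ^ 2 / 2) * Real.exp (t * (g x - m)) := by
      intro x
      obtain ⟨a₀⟩ := (μ 0).nonempty_of_neZero
      -- Comparison with one reference value gives an interval of length `2c`, hence the variance
      -- proxy `c ^ 2`. The optimal constant would be smaller, but it plays no role.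
      have hosc : ∀ a, F (a, x) ∈ Set.Icc (F (a₀, x) - c) (F (a₀, x) + c) := by
        intro a
        have := hd (Fin.cons a x) 0 a₀
        rw [Fin.update_cons_zero, abs_le] at this
        constructor <;> simp only [hF] <;> linarith [this.1, this.2]
      have hsub := (hasSubgaussianMGF_of_mem_Icc (μ := μ 0) (hFx x).aemeasurable
        (Eventually.of_forall hosc)).mgf_le t
      have hcc : (((‖F (a₀, x) + c - (F (a₀, x) - c)‖₊ / 2) ^ 2 : ℝ≥0) : ℝ) = c ^ 2 := by
        have h2 : F (a₀, x) + c - (F (a₀, x) - c) = 2 * c := by ring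
        rw [h2]
        push_cast
        rw [Real.norm_of_nonneg (by positivity)]
        ring
      rw [hcc] at hsub
      have hsplit : ∀ a, Real.exp (t * (F (a, x) - m))
          = Real.exp (t * (F (a, x) - g x)) * Real.exp (t * (g x - m)) := by
        intro a
        rw [← Real.exp_add]
        ring_nf
      simp_rw [hsplit]
      rw [integral_mul_const]
      gcongr
      exact hsub
    calc ∫ p : E × (Fin n → E), Real.exp (t * (F p - m)) ∂((μ 0).prod ν)
        = ∫ x, ∫ a, Real.exp (t * (F (a, x) - m)) ∂(μ 0) ∂ν := integral_prod_symm _ hint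
      _ ≤ ∫ x, Real.exp (c ^ 2 * t ^ 2 / 2) * Real.exp (t * (g x - m)) ∂ν :=
          integral_mono hint.integral_prod_right (hgint.const_mul _) hinner
      _ = Real.exp (c ^ 2 * t ^ 2 / 2) * ∫ x, Real.exp (t * (g x - m)) ∂ν :=
          integral_const_mul _ _
      _ ≤ Real.exp (c ^ 2 * t ^ 2 / 2) * Real.exp (n * c ^ 2 * t ^ 2 / 2) := by
          gcongr
          exact ih (fun j => μ j.succ) g hgm hgb hgd
      _ = Real.exp ((n + 1 : ℕ) * c ^ 2 * t ^ 2 / 2) := by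
          rw [← Real.exp_add]
          push_cast
          ring_nf

variable {Ω : Type*} [MeasurableSpace Ω] {P : Measure Ω} [IsProbabilityMeasure P]

/-- Independence makes the joint law a product measure, where the exponential estimate applies. -/
lemma hasSubgaussianMGF_of_bounded_differences {n : ℕ} {R : Fin n → Ω → E}
    (hR : ∀ i, Measurable (R i)) (hind : iIndepFun R P) {f : (Fin n → E) → ℝ} (hf : Measurable f)
    {c b : ℝ} (hc : 0 ≤ c) (hb : ∀ x, |f x| ≤ b)
    (hd : ∀ x i y, |f x - f (Function.update x i y)| ≤ c) :
    HasSubgaussianMGF (fun ω => f (fun i => R i ω) - ∫ ω, f (fun i => R i ω) ∂P)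
      (n * (c ^ 2).toNNReal) P := by
  have hRm : Measurable fun ω i => R i ω := measurable_pi_lambda _ hR
  have : ∀ i, IsProbabilityMeasure (P.map (R i)) := fun i =>
    Measure.isProbabilityMeasure_map (hR i).aemeasurable
  have hmap : P.map (fun ω i => R i ω) = Measure.pi fun i => P.map (R i) :=
    (iIndepFun_iff_map_fun_eq_pi_map fun i => (hR i).aemeasurable).1 hind
  have hmean : ∫ ω, f (fun i => R i ω) ∂P = ∫ x, f x ∂(Measure.pi fun i => P.map (R i)) := by
    rw [← hmap, integral_map hRm.aemeasurable hf.aestronglyMeasurable]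
  set m := ∫ ω, f (fun i => R i ω) ∂P with hm
  have hmb : |m| ≤ b := by
    have := norm_integral_le_of_norm_le_const (μ := P) (f := fun ω => f (fun i => R i ω)) (C := b)
      (Eventually.of_forall fun _ => hb _)
    simpa using this
  refine ⟨fun t => ?_, fun t => ?_⟩
  · refine Integrable.of_bound (Measurable.aestronglyMeasurable (by fun_prop))
      (Real.exp (|t| * (b + b))) (Eventually.of_forall fun ω => ?_)
    rw [Real.norm_of_nonneg (Real.exp_pos _).le]
    refine Real.exp_le_exp.2 ?_
    calc t * (f (fun i => R i ω) - m) ≤ |t * (f (fun i => R i ω) - m)| := le_abs_self _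
      _ = |t| * |f (fun i => R i ω) - m| := abs_mul _ _
      _ ≤ |t| * (b + b) := by
        gcongr
        exact (abs_sub _ _).trans (add_le_add (hb _) hmb)
  · have h1 := integral_exp_le_of_bounded_differences (E := E) hc t n (fun i => P.map (R i)) f hf
      hb hd
    rw [← hmean, ← hmap, integral_map hRm.aemeasurable
      (Measurable.aestronglyMeasurable (by fun_prop))] at h1
    have h2 : ((n * (c ^ 2).toNNReal : ℝ≥0) : ℝ) = n * c ^ 2 := by
      rw [NNReal.coe_mul, Real.coe_toNNReal _ (sq_nonneg c)]
      simp
    rw [h2]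
    exact h1

/-- A sequence of bounded functions of `n` independent variables with differences of order `1 / n`
is almost surely asymptotic to its sequence of means. -/
theorem ae_tendsto_sub_integral_of_bounded_differences {R : ℕ → Ω → E}
    (hR : ∀ i, Measurable (R i)) (hind : iIndepFun R P) {f : (n : ℕ) → (Fin n → E) → ℝ}
    (hf : ∀ n, Measurable (f n)) {C b : ℝ} (hC : 0 < C) (hb : ∀ n x, |f n x| ≤ b)
    (hd : ∀ n x i y, |f n x - f n (Function.update x i y)| ≤ C / n) :
    ∀ᵐ ω ∂P, Tendsto (fun n => f n (fun i => R i ω) - ∫ ω, f n (fun i => R i ω) ∂P) atTop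
      (𝓝 0) := by
  set X : ℕ → Ω → ℝ := fun n ω => f n (fun i => R i ω) - ∫ ω, f n (fun i => R i ω) ∂P with hX
  have hsub : ∀ n, HasSubgaussianMGF (X n) (n * ((C / n) ^ 2).toNNReal) P := fun n =>
    hasSubgaussianMGF_of_bounded_differences (fun i => hR i)
      (hind.precomp (g := fun i : Fin n => (i : ℕ)) Fin.val_injective) (hf n) (by positivity)
      (hb n) (hd n)
  have hpar : ∀ n : ℕ, ((n * ((C / n) ^ 2).toNNReal : ℝ≥0) : ℝ) = C ^ 2 / n := by
    intro n
    rw [NNReal.coe_mul, Real.coe_toNNReal _ (sq_nonneg _)]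
    rcases Nat.eq_zero_or_pos n with rfl | hn
    · simp
    · have : (n : ℝ) ≠ 0 := by positivity
      simp
      field_simp
  -- With differences `C / n` in `n` variables the variance proxy is `C ^ 2 / n`, so the tails decay
  -- geometrically in `n` and Borel-Cantelli applies.
  have htail : ∀ (ε : ℝ), 0 < ε → ∀ n : ℕ, P.real {ω | ε ≤ |X n ω|}
      ≤ 2 * (Real.exp (-ε ^ 2 / (2 * C ^ 2))) ^ n := by
    intro ε hε n
    have hexp : Real.exp (-ε ^ 2 / (2 * ((n * ((C / n) ^ 2).toNNReal : ℝ≥0) : ℝ)))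
        = (Real.exp (-ε ^ 2 / (2 * C ^ 2))) ^ n := by
      rw [hpar, ← Real.exp_nat_mul]
      rcases Nat.eq_zero_or_pos n with rfl | hn
      · simp
      · have : (n : ℝ) ≠ 0 := by positivity
        field_simp
    have h1 := (hsub n).measure_ge_le hε.le
    have h2 := (hsub n).neg.measure_ge_le hε.le
    rw [hexp] at h1 h2
    calc P.real {ω | ε ≤ |X n ω|} ≤ P.real ({ω | ε ≤ X n ω} ∪ {ω | ε ≤ (-X n) ω}) := by
          refine measureReal_mono ?_
          intro ω hω
          have h : ε ≤ |X n ω| := by simpa using hω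
          exact (le_abs.1 h).imp id id
      _ ≤ P.real {ω | ε ≤ X n ω} + P.real {ω | ε ≤ (-X n) ω} := measureReal_union_le _ _
      _ ≤ 2 * (Real.exp (-ε ^ 2 / (2 * C ^ 2))) ^ n := by linarith
  have hev : ∀ ε : ℝ, 0 < ε → ∀ᵐ ω ∂P, ∀ᶠ n in atTop, |X n ω| < ε := by
    intro ε hε
    have hsum : ∑' n, P {ω | ε ≤ |X n ω|} ≠ ⊤ := by
      have hr : Real.exp (-ε ^ 2 / (2 * C ^ 2)) < 1 := by
        rw [Real.exp_lt_one_iff]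
        have : 0 < ε ^ 2 / (2 * C ^ 2) := by positivity
        rw [neg_div]
        linarith
      have hs : Summable fun n : ℕ => 2 * (Real.exp (-ε ^ 2 / (2 * C ^ 2))) ^ n :=
        (summable_geometric_of_lt_one (Real.exp_pos _).le hr).mul_left 2
      refine ne_top_of_le_ne_top hs.tsum_ofReal_ne_top ?_
      refine ENNReal.tsum_le_tsum fun n => ?_
      rw [← ENNReal.ofReal_toReal (measure_ne_top P _)]
      exact ENNReal.ofReal_le_ofReal (htail ε hε n)
    filter_upwards [ae_eventually_notMem hsum] with ω hω
    filter_upwards [hω] with n hn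
    exact not_le.1 hn
  have hall : ∀ᵐ ω ∂P, ∀ k : ℕ, ∀ᶠ n in atTop, |X n ω| < 1 / ((k : ℝ) + 1) :=
    ae_all_iff.2 fun k => hev _ (by positivity)
  filter_upwards [hall] with ω hω
  rw [Metric.tendsto_atTop']
  intro ε hε
  obtain ⟨k, hk⟩ := exists_nat_one_div_lt hε
  obtain ⟨N, hN⟩ := eventually_atTop.1 (hω k)
  refine ⟨N, fun n hn => ?_⟩
  rw [Real.dist_eq, sub_zero]
  exact (hN n hn.le).trans hk

end BoundedDifferences

end

noncomputable section

/-! ### Resolvents of Hermitian matrices -/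

section Resolvent

open scoped Matrix.Norms.L2Operator
open Matrix

variable {N : Type*} [Fintype N] [DecidableEq N]

/-- The resolvent `(z - M)⁻¹` of a matrix. -/
def resolventMatrix (M : Matrix N N ℂ) (z : ℂ) : Matrix N N ℂ := (z • (1 : Matrix N N ℂ) - M)⁻¹

lemma sub_ofReal_ne_zero {z : ℂ} (hz : z.im ≠ 0) (x : ℝ) : z - x ≠ 0 := by
  intro h
  apply hz
  simpa using congrArg Complex.im h

lemma abs_im_le_norm_sub_ofReal (z : ℂ) (x : ℝ) : |z.im| ≤ ‖z - x‖ := by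
  simpa using Complex.abs_im_le_norm (z - x)

lemma Matrix.IsHermitian.smul_one_sub_eq {M : Matrix N N ℂ} (hM : M.IsHermitian) (z : ℂ) :
    z • (1 : Matrix N N ℂ) - M = hM.eigenvectorUnitary.1 *
      diagonal (fun j => z - hM.eigenvalues j) * star hM.eigenvectorUnitary.1 := by
  conv_lhs => rw [hM.spectral_theorem, Unitary.conjStarAlgAut_apply]
  have h1 : z • (1 : Matrix N N ℂ) = hM.eigenvectorUnitary.1 * diagonal (fun _ => z) *
      star hM.eigenvectorUnitary.1 := by
    rw [show (diagonal fun _ => z : Matrix N N ℂ) = z • 1 by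
      rw [smul_one_eq_diagonal], mul_smul_comm, mul_one, smul_mul_assoc,
      Unitary.mul_star_self_of_mem hM.eigenvectorUnitary.2]
  rw [h1, ← sub_mul, ← mul_sub, diagonal_sub]
  rfl

/-- Diagonalization in the eigenvector basis; `z` off the real axis keeps every diagonal entry `z -
λ_j` nonzero. -/
lemma Matrix.IsHermitian.resolvent_eq_and_isUnit {M : Matrix N N ℂ} (hM : M.IsHermitian) {z : ℂ}
    (hz : z.im ≠ 0) :
    resolventMatrix M z = hM.eigenvectorUnitary.1 *
      diagonal (fun j => (z - hM.eigenvalues j)⁻¹) * star hM.eigenvectorUnitary.1 ∧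
    (z • (1 : Matrix N N ℂ) - M) * resolventMatrix M z = 1 := by
  have hU := Unitary.star_mul_self_of_mem hM.eigenvectorUnitary.2
  have hU' := Unitary.mul_star_self_of_mem hM.eigenvectorUnitary.2
  have key : (z • (1 : Matrix N N ℂ) - M) * (hM.eigenvectorUnitary.1 *
      diagonal (fun j => (z - hM.eigenvalues j)⁻¹) * star hM.eigenvectorUnitary.1) = 1 := by
    rw [hM.smul_one_sub_eq]
    calc _ = hM.eigenvectorUnitary.1 * diagonal (fun j => z - hM.eigenvalues j) *
          (star hM.eigenvectorUnitary.1 * hM.eigenvectorUnitary.1) *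
          diagonal (fun j => (z - hM.eigenvalues j)⁻¹) * star hM.eigenvectorUnitary.1 := by
          simp only [Matrix.mul_assoc]
      _ = 1 := by
          rw [hU, mul_one, Matrix.mul_assoc hM.eigenvectorUnitary.1, diagonal_mul_diagonal]
          have : (fun j => (z - hM.eigenvalues j) * (z - hM.eigenvalues j)⁻¹)
              = fun _ => (1 : ℂ) := funext fun j => mul_inv_cancel₀ (sub_ofReal_ne_zero hz _)
          rw [this, diagonal_one, mul_one, hU']
  have h := Matrix.inv_eq_right_inv key
  refine ⟨h, ?_⟩
  rw [resolventMatrix, h, key]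

lemma Matrix.IsHermitian.mul_resolvent {M : Matrix N N ℂ} (hM : M.IsHermitian) {z : ℂ}
    (hz : z.im ≠ 0) : (z • (1 : Matrix N N ℂ) - M) * resolventMatrix M z = 1 :=
  (hM.resolvent_eq_and_isUnit hz).2

lemma Matrix.IsHermitian.resolvent_mul {M : Matrix N N ℂ} (hM : M.IsHermitian) {z : ℂ}
    (hz : z.im ≠ 0) : resolventMatrix M z * (z • (1 : Matrix N N ℂ) - M) = 1 :=
  mul_eq_one_comm.1 (hM.mul_resolvent hz)

lemma Matrix.IsHermitian.norm_resolvent_le {M : Matrix N N ℂ} (hM : M.IsHermitian) {z : ℂ}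
    (hz : z.im ≠ 0) : ‖resolventMatrix M z‖ ≤ |z.im|⁻¹ := by
  rw [(hM.resolvent_eq_and_isUnit hz).1]
  rw [CStarRing.norm_mul_mem_unitary _ (Unitary.star_mem hM.eigenvectorUnitary.2),
    CStarRing.norm_mem_unitary_mul _ hM.eigenvectorUnitary.2, l2_opNorm_diagonal,
    pi_norm_le_iff_of_nonneg (by positivity)]
  intro j
  rw [norm_inv]
  exact inv_anti₀ (abs_pos.2 hz) (abs_im_le_norm_sub_ofReal _ _)

lemma Matrix.sum_norm_sq_col_le (A : Matrix N N ℂ) (c : N) : ∑ a, ‖A a c‖ ^ 2 ≤ ‖A‖ ^ 2 := by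
  have h := l2_opNorm_mulVec A (EuclideanSpace.single c 1)
  rw [PiLp.norm_single, norm_one, mul_one] at h
  have h2 := pow_le_pow_left₀ (norm_nonneg _) h 2
  rw [EuclideanSpace.norm_sq_eq] at h2
  simpa using h2

lemma Matrix.norm_apply_le (A : Matrix N N ℂ) (a c : N) : ‖A a c‖ ≤ ‖A‖ := by
  have h1 := A.sum_norm_sq_col_le c
  have h2 : ‖A a c‖ ^ 2 ≤ ∑ a, ‖A a c‖ ^ 2 :=
    Finset.single_le_sum (f := fun a => ‖A a c‖ ^ 2) (fun _ _ => by positivity) (Finset.mem_univ a)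
  exact le_of_sq_le_sq (h2.trans h1) (norm_nonneg _)

/-- The trace may be computed on the range, where an orthonormal basis has as many elements as the
rank and each diagonal coefficient is at most the operator norm. -/
lemma Matrix.norm_trace_le_rank_mul (A : Matrix N N ℂ) : ‖A.trace‖ ≤ A.rank * ‖A‖ := by
  set f : EuclideanSpace ℂ N →ₗ[ℂ] EuclideanSpace ℂ N := toEuclideanLin A with hf
  have htr : LinearMap.trace ℂ _ f = A.trace := by
    rw [hf, toEuclideanLin_eq_toLin_orthonormal, trace_toLin_eq]
  have hrank : A.rank = Module.finrank ℂ (LinearMap.range f) := by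
    rw [hf, toEuclideanLin_eq_toLin_orthonormal]
    exact Matrix.rank_eq_finrank_range_toLin A _ _
  have hle : ∀ x, ‖f x‖ ≤ ‖A‖ * ‖x‖ := fun x => l2_opNorm_mulVec A x
  rw [← htr, ← LinearMap.trace_restrict_eq_of_forall_mem (LinearMap.range f) f
    (fun x => LinearMap.mem_range_self f x),
    LinearMap.trace_eq_sum_inner _ (stdOrthonormalBasis ℂ (LinearMap.range f)), hrank]
  refine (norm_sum_le _ _).trans ?_
  rw [← nsmul_eq_mul]
  have hcard : Module.finrank ℂ (LinearMap.range f)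
      = (Finset.univ : Finset (Fin (Module.finrank ℂ (LinearMap.range f)))).card := by simp
  conv_rhs => rw [hcard]
  refine Finset.sum_le_card_nsmul _ _ _ fun i _ => ?_
  set u := stdOrthonormalBasis ℂ (LinearMap.range f) i with hu
  have hu1 : ‖u‖ = 1 := (stdOrthonormalBasis ℂ (LinearMap.range f)).orthonormal.1 i
  refine (norm_inner_le_norm _ _).trans ?_
  rw [hu1, one_mul]
  have h3 := hle (u : EuclideanSpace ℂ N)
  rw [show ‖(u : EuclideanSpace ℂ N)‖ = 1 from hu1, mul_one] at h3
  exact h3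

/-- With `Q` the coordinate projection onto `S`, the corner `(1 - Q) D (1 - Q)` vanishes; what
remains is `Q D + (1 - Q) D Q`, two terms each of rank at most `|S|`. -/
lemma Matrix.rank_le_of_supported (D : Matrix N N ℂ) (S : Finset N)
    (hD : ∀ a c, a ∉ S → c ∉ S → D a c = 0) : D.rank ≤ 2 * S.card := by
  set Q : Matrix N N ℂ := diagonal fun a => if a ∈ S then 1 else 0 with hQ
  have hrQ : Q.rank = S.card := by
    rw [hQ, Matrix.rank_diagonal]
    simp
  have hdec : D = Q * D + (1 - Q) * D * Q := by
    ext a c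
    rw [add_apply, hQ, diagonal_mul, mul_diagonal, sub_mul, sub_apply, diagonal_mul, one_mul]
    by_cases ha : a ∈ S <;> by_cases hc : c ∈ S <;> simp [ha, hc, hD]
  rw [hdec]
  have h1 : (Q * D + (1 - Q) * D * Q).rank ≤ (Q * D).rank + ((1 - Q) * D * Q).rank := by
    rw [Matrix.rank, Matrix.rank, Matrix.rank, mulVecLin_add]
    refine (Submodule.finrank_mono (LinearMap.range_add_le _ _)).trans ?_
    exact Submodule.finrank_add_le_finrank_add_finrank _ _
  have h2 : (Q * D).rank ≤ S.card := hrQ ▸ rank_mul_le_left _ _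
  have h3 : ((1 - Q) * D * Q).rank ≤ S.card := hrQ ▸ rank_mul_le_right _ _
  omega

lemma resolventMatrix_sub {M M' : Matrix N N ℂ} (hM : M.IsHermitian) (hM' : M'.IsHermitian) {z : ℂ}
    (hz : z.im ≠ 0) : resolventMatrix M z - resolventMatrix M' z
      = resolventMatrix M z * (M - M') * resolventMatrix M' z := by
  have h1 : M - M' = (z • (1 : Matrix N N ℂ) - M') - (z • (1 : Matrix N N ℂ) - M) := by abel
  rw [h1, mul_sub, sub_mul, Matrix.mul_assoc, hM'.mul_resolvent hz, hM.resolvent_mul hz, mul_one,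
    one_mul]

/-- Changing the rows and columns of a Hermitian matrix with index in `S` changes
`Tr (Q (z - M)⁻¹)` by a quantity of order `|S|`. -/
lemma norm_trace_mul_resolvent_sub_le {M M' : Matrix N N ℂ} (hM : M.IsHermitian)
    (hM' : M'.IsHermitian) {z : ℂ} (hz : z.im ≠ 0) (S : Finset N)
    (hS : ∀ a c, a ∉ S → c ∉ S → M a c = M' a c) {Q : Matrix N N ℂ} (hQ : ‖Q‖ ≤ 1) :
    ‖(Q * resolventMatrix M z).trace - (Q * resolventMatrix M' z).trace‖
      ≤ 4 * S.card * |z.im|⁻¹ := by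
  rw [← trace_sub, ← mul_sub]
  refine (norm_trace_le_rank_mul _).trans ?_
  -- The resolvent identity factors the difference through `M - M'`, so its rank is at most `2 |S|`,
  -- however large the changed entries are.
  have h1 : (Q * (resolventMatrix M z - resolventMatrix M' z)).rank ≤ 2 * S.card := by
    refine (rank_mul_le_right _ _).trans ?_
    rw [resolventMatrix_sub hM hM' hz]
    refine (rank_mul_le_left _ _).trans ((rank_mul_le_right _ _).trans ?_)
    refine Matrix.rank_le_of_supported _ S fun a c ha hc => ?_
    rw [Matrix.sub_apply, hS a c ha hc, sub_self]
  have h2 : ‖Q * (resolventMatrix M z - resolventMatrix M' z)‖ ≤ 1 * (|z.im|⁻¹ + |z.im|⁻¹) := by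
    refine (norm_mul_le _ _).trans ?_
    gcongr
    exact (norm_sub_le _ _).trans
      (add_le_add (hM.norm_resolvent_le hz) (hM'.norm_resolvent_le hz))
  calc ((Q * (resolventMatrix M z - resolventMatrix M' z)).rank : ℝ)
        * ‖Q * (resolventMatrix M z - resolventMatrix M' z)‖
      ≤ ((2 * S.card : ℕ) : ℝ) * (1 * (|z.im|⁻¹ + |z.im|⁻¹)) := by gcongr
    _ = 4 * S.card * |z.im|⁻¹ := by push_cast; ring

lemma integral_spectralMeasure [Nonempty N] {M : Matrix N N ℂ} (hM : M.IsHermitian) {z : ℂ}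
    (hz : z.im ≠ 0) : ∫ x : ℝ, (z - x)⁻¹ ∂(spectralMeasure M hM : Measure ℝ)
      = (Fintype.card N : ℂ)⁻¹ * (resolventMatrix M z).trace := by
  have h1 : (spectralMeasure M hM : Measure ℝ)
      = (Fintype.card N : ℝ≥0∞)⁻¹ • ∑ j, Measure.dirac (hM.eigenvalues j) := rfl
  rw [h1, integral_smul_measure, integral_finsetSum_measure
    (fun i _ => integrable_dirac (by simp))]
  simp only [integral_dirac]
  rw [(hM.resolvent_eq_and_isUnit hz).1, trace_mul_comm, ← Matrix.mul_assoc,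
    Unitary.star_mul_self_of_mem hM.eigenvectorUnitary.2, one_mul, trace_diagonal]
  simp

end Resolvent

end

noncomputable section

/-! ### Independence of the entries of Wigner arrays -/

section Independence

variable {Ω : Type*} [MeasurableSpace Ω] {P : Measure Ω}

/-- The probability of a finite intersection factors first between the two classes of indices, then
inside each class. It serves to join the diagonal of a Wigner array to the entries above it. -/
lemma iIndepFun_of_indepFun_subtype [IsProbabilityMeasure P] {ι β : Type*} [MeasurableSpace β]
    {Y : ι → Ω → β} (p : ι → Prop)
    (h1 : iIndepFun (fun i : {i // p i} => Y i) P)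
    (h2 : iIndepFun (fun i : {i // ¬ p i} => Y i) P)
    (h12 : IndepFun (fun ω (i : {i // p i}) => Y i ω) (fun ω (i : {i // ¬ p i}) => Y i ω) P) :
    iIndepFun Y P := by
  classical
  rw [iIndepFun_iff_measure_inter_preimage_eq_mul]
  intro S t ht
  have hA : ∀ (q : ι → Prop) [DecidablePred q], (⋂ i ∈ S.filter q, Y i ⁻¹' t i)
      = (fun ω (i : {i // q i}) => Y i ω) ⁻¹'
        (Set.pi (S.subtype q) fun i => t i) := by
    intro q _
    ext ω
    simp only [Set.mem_iInter, Finset.mem_filter, Set.mem_preimage, Set.mem_pi, Finset.mem_coe,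
      Finset.mem_subtype, Subtype.forall]
    exact ⟨fun h i hq hi => h i ⟨hi, hq⟩, fun h i hi => h i hi.2 hi.1⟩
  have hB : ∀ (q : ι → Prop) [DecidablePred q], iIndepFun (fun i : {i // q i} => Y i) P →
      P (⋂ i ∈ S.filter q, Y i ⁻¹' t i) = ∏ i ∈ S.filter q, P (Y i ⁻¹' t i) := by
    intro q _ hq
    have h3 := (iIndepFun_iff_measure_inter_preimage_eq_mul.1 hq) (S.subtype q)
      (sets := fun i => t i) (fun i hi => ht i (by simpa using hi))
    rw [Finset.prod_subtype_eq_prod_filter (fun i => P (Y i ⁻¹' t i))] at h3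
    rw [← h3]
    congr 1
    ext ω
    simp only [Set.mem_iInter, Finset.mem_filter, Set.mem_preimage, Finset.mem_subtype,
      Subtype.forall]
    exact ⟨fun h i hq hi => h i ⟨hi, hq⟩, fun h i hi => h i hi.2 hi.1⟩
  have hS : (⋂ i ∈ S, Y i ⁻¹' t i)
      = (⋂ i ∈ S.filter p, Y i ⁻¹' t i) ∩ ⋂ i ∈ S.filter (fun i => ¬ p i), Y i ⁻¹' t i := by
    ext ω
    simp only [Set.mem_iInter, Finset.mem_filter, Set.mem_inter_iff]
    constructor
    · exact fun h => ⟨fun i hi => h i hi.1, fun i hi => h i hi.1⟩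
    · intro h i hi
      by_cases hp : p i
      · exact h.1 i ⟨hi, hp⟩
      · exact h.2 i ⟨hi, hp⟩
  have hm : ∀ (q : ι → Prop) [DecidablePred q], MeasurableSet (Set.pi (S.subtype q) fun i => t i :
      Set ({i // q i} → β)) := fun q _ =>
    MeasurableSet.pi (Finset.countable_toSet _) fun i hi => ht i (by simpa using hi)
  rw [hS, ← Finset.prod_filter_mul_prod_filter_not S p, ← hB p h1, ← hB _ h2, hA p,
    hA fun i => ¬ p i]
  exact h12.measure_inter_preimage_eq_mul _ _ (hm p) (hm _)

/-- One variable of an independent family is independent of the family of all others. -/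
lemma iIndepFun.indepFun_update {ι β : Type*} [MeasurableSpace β] [DecidableEq ι]
    {Y : ι → Ω → β} (hY : ∀ i, Measurable (Y i)) (h : iIndepFun Y P) (e : ι) (b : β) :
    IndepFun (Y e) (fun ω => Function.update (fun i => Y i ω) e b) P := by
  have h1 := indep_iSup_of_disjoint (fun i => (hY i).comap_le) h
    (S := {e}) (T := {e}ᶜ) (Set.disjoint_compl_right_iff_subset.2 subset_rfl)
  rw [IndepFun_iff_Indep]
  refine indep_of_indep_of_le_left (indep_of_indep_of_le_right h1 ?_) ?_
  -- Since coordinate `e` has been frozen to a constant, the updated family is measurable for the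
  -- σ-algebra generated by the other variables.
  · refine measurable_iff_comap_le.1 (@measurable_pi_lambda Ω ι (fun _ => β)
      (⨆ i ∈ ({e}ᶜ : Set ι), MeasurableSpace.comap (Y i) inferInstance) _ _ fun i => ?_)
    by_cases hi : i = e
    · subst hi
      simp
    · simp only [Function.update_of_ne hi]
      refine Measurable.mono (comap_measurable (Y i)) ?_ le_rfl
      exact le_iSup₂_of_le i hi le_rfl
  · exact le_iSup₂_of_le e rfl le_rfl

/-- The rows of an independent array are independent. -/
lemma iIndepFun.curry {ι κ β : Type*} [MeasurableSpace β] [IsProbabilityMeasure P]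
    {Y : ι × κ → Ω → β} (hY : ∀ i, Measurable (Y i)) (h : iIndepFun Y P) :
    iIndepFun (fun i ω (j : κ) => Y (i, j) ω) P := by
  have : ∀ i, IsProbabilityMeasure (P.map (Y i)) := fun i =>
    Measure.isProbabilityMeasure_map (hY i).aemeasurable
  have h1 := (iIndepFun_iff_map_fun_eq_infinitePi_map hY).1 h
  rw [iIndepFun_iff_map_fun_eq_infinitePi_map (fun i => measurable_pi_lambda _ fun j => hY _)]
  have h2 : ∀ i, P.map (fun ω (j : κ) => Y (i, j) ω)
      = Measure.infinitePi fun j => P.map (Y (i, j)) := fun i =>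
    (iIndepFun_iff_map_fun_eq_infinitePi_map fun j => hY (i, j)).1
      (h.precomp (g := fun j => (i, j)) (Prod.mk_right_injective i))
  simp_rw [h2]
  rw [← Measure.infinitePi_map_curry (fun i j => P.map (Y (i, j)))]
  rw [← h1, Measure.map_map (MeasurableEquiv.measurable _) (measurable_pi_lambda _ hY)]
  rfl

variable {h : ℕ}

/-- The entries of a family of arrays on and above the diagonal: the index `(i, l, d)` stands for
the entry `(i, i + d)` of the array `l`. -/
def upperEntries (X : Fin h → ℕ → ℕ → Ω → ℂ) (e : ℕ × Fin h × ℕ) (ω : Ω) : ℂ :=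
  X e.2.1 e.1 (e.1 + e.2.2) ω

lemma IsWignerArray.iIndepFun_upperEntries [IsProbabilityMeasure P] {X : ℕ → ℕ → Ω → ℂ} {v : ℝ≥0}
    (hX : IsWignerArray X v P) :
    iIndepFun (fun (p : ℕ × ℕ) ω => X p.1 (p.1 + p.2) ω) P := by
  refine iIndepFun_of_indepFun_subtype (fun p => p.2 = 0) ?_ ?_ ?_
  · have h1 := hX.indep_diag.precomp (g := fun p : {p : ℕ × ℕ // p.2 = 0} => p.1.1) (by
      rintro ⟨⟨a, b⟩, hb⟩ ⟨⟨c, d⟩, hd⟩ h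
      simp only at hb hd h
      subst hb hd h
      rfl)
    refine (iIndepFun_congr fun p => ?_).1 h1
    refine Eventually.of_forall fun ω => ?_
    obtain ⟨⟨a, b⟩, hb⟩ := p
    simp only at hb
    subst hb
    rfl
  · exact hX.indep_upper.precomp (g := fun p : {p : ℕ × ℕ // ¬ p.2 = 0} =>
      (⟨(p.1.1, p.1.1 + p.1.2), Nat.lt_add_of_pos_right (Nat.pos_of_ne_zero p.2)⟩ :
        {p : ℕ × ℕ // p.1 < p.2})) (by
      rintro ⟨⟨a, b⟩, hb⟩ ⟨⟨c, d⟩, hd⟩ h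
      simp only [Subtype.mk.injEq, Prod.mk.injEq] at h
      obtain ⟨rfl, h⟩ := h
      have : b = d := by omega
      subst this
      rfl)
  · have h2 := hX.indep_diag_upper.comp
      (φ := fun (x : ℕ → ℂ) (p : {p : ℕ × ℕ // p.2 = 0}) => x p.1.1)
      (ψ := fun (x : {p : ℕ × ℕ // p.1 < p.2} → ℂ) (p : {p : ℕ × ℕ // ¬ p.2 = 0}) =>
        x ⟨(p.1.1, p.1.1 + p.1.2), Nat.lt_add_of_pos_right (Nat.pos_of_ne_zero p.2)⟩)
      (by fun_prop) (by fun_prop)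
    have h3 : (fun ω (p : {p : ℕ × ℕ // p.2 = 0}) => X p.1.1 (p.1.1 + p.1.2) ω)
        = (fun (x : ℕ → ℂ) (p : {p : ℕ × ℕ // p.2 = 0}) => x p.1.1) ∘ fun ω i => X i i ω := by
      funext ω p
      obtain ⟨⟨a, b⟩, hb⟩ := p
      simp only at hb
      subst hb
      rfl
    rw [h3]
    exact h2

lemma measurable_upperEntries {X : Fin h → ℕ → ℕ → Ω → ℂ} {v : Fin h → ℝ≥0}
    (hX : ∀ l, IsWignerArray (X l) (v l) P) (e : ℕ × Fin h × ℕ) :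
    Measurable (upperEntries X e) := (hX _).measurable _ _

lemma iIndepFun_upperEntries [IsProbabilityMeasure P] {X : Fin h → ℕ → ℕ → Ω → ℂ}
    {v : Fin h → ℝ≥0} (hX : ∀ l, IsWignerArray (X l) (v l) P)
    (hind : iIndepFun (fun l ω (p : ℕ × ℕ) => X l p.1 p.2 ω) P) :
    iIndepFun (upperEntries X) P := by
  have h1 : iIndepFun (fun l ω (p : ℕ × ℕ) => X l p.1 (p.1 + p.2) ω) P :=
    hind.comp (fun _ (x : ℕ × ℕ → ℂ) (p : ℕ × ℕ) => x (p.1, p.1 + p.2)) fun _ => by fun_prop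
  have h2 := iIndepFun_uncurry' (X := fun (l : Fin h) (p : ℕ × ℕ) ω => X l p.1 (p.1 + p.2) ω)
    (fun l p => (hX l).measurable _ _) h1 fun l => (hX l).iIndepFun_upperEntries
  exact h2.precomp (g := fun e : ℕ × Fin h × ℕ => (e.2.1, (e.1, e.2.2))) (by
    rintro ⟨a, b, c⟩ ⟨a', b', c'⟩ h
    simp only [Prod.mk.injEq] at h ⊢
    tauto)

end Independence

end

noncomputable section

/-! ### Block resolvents of Hermitian arrays -/

section BlockResolvent

open scoped Matrix.Norms.L2Operator
open Matrix

variable {k h n : ℕ}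

/-- The `(i, j)` entry of the Hermitian array `l` with upper triangle `x`; here `x (i, l, d)`
is the entry `(i, i + d)` of the array `l`. -/
def hermEntry (x : ℕ × Fin h × ℕ → ℂ) (l : Fin h) (i j : ℕ) : ℂ :=
  if i < j then x (i, l, j - i) else if j < i then star (x (j, l, i - j))
  else ((x (i, l, 0)).re : ℂ)

/-- This holds for arbitrary `x`, because the diagonal is forced to be real. Entries can therefore
be set to `0`, or rows replaced, without leaving the Hermitian matrices and their resolvent bounds.
-/
lemma hermEntry_star (x : ℕ × Fin h × ℕ → ℂ) (l : Fin h) (i j : ℕ) :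
    star (hermEntry x l i j) = hermEntry x l j i := by
  unfold hermEntry
  rcases lt_trichotomy i j with hij | rfl | hij
  · simp [hij, hij.le]
  · simp
  · simp [hij, hij.not_gt]

lemma continuous_hermEntry (l : Fin h) (i j : ℕ) :
    Continuous fun x : ℕ × Fin h × ℕ → ℂ => hermEntry x l i j := by
  unfold hermEntry
  split_ifs <;> fun_prop

/-- The block matrix of size `n k` built from the Hermitian arrays with upper triangles `x`,
normalized by `n^{-1/2}`. -/
def hermBlock (B : Matrix (Fin k) (Fin k) (Fin h)) (n : ℕ) (x : ℕ × Fin h × ℕ → ℂ) :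
    Matrix (Fin k × Fin n) (Fin k × Fin n) ℂ :=
  blockMatrix B fun l => Matrix.of fun i j : Fin n => ((√(n : ℝ))⁻¹ : ℝ) * hermEntry x l i j

lemma hermBlock_apply (B : Matrix (Fin k) (Fin k) (Fin h)) (x : ℕ × Fin h × ℕ → ℂ) (p q : Fin k)
    (i j : Fin n) : hermBlock B n x (p, i) (q, j)
      = ((√(n : ℝ))⁻¹ : ℝ) * hermEntry x (B p q) i j := rfl

lemma hermBlock_isHermitian {B : Matrix (Fin k) (Fin k) (Fin h)} (hB : B.IsSymm) (n : ℕ)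
    (x : ℕ × Fin h × ℕ → ℂ) : (hermBlock B n x).IsHermitian := by
  refine blockMatrix_isHermitian hB fun l => ?_
  ext i j
  rw [conjTranspose_apply, of_apply, of_apply, star_mul', hermEntry_star]
  simp

lemma continuous_hermBlock (B : Matrix (Fin k) (Fin k) (Fin h)) (n : ℕ) :
    Continuous (hermBlock B n) := by
  refine continuous_matrix fun a c => ?_
  exact (continuous_const.mul (continuous_hermEntry _ _ _))

/-- The resolvent of `hermBlock B n x`. -/
def blockResolvent (B : Matrix (Fin k) (Fin k) (Fin h)) (z : ℂ) (n : ℕ) (x : ℕ × Fin h × ℕ → ℂ) :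
    Matrix (Fin k × Fin n) (Fin k × Fin n) ℂ :=
  resolventMatrix (hermBlock B n x) z

/-- By Cramer's rule the inverse is the adjugate divided by a determinant that never vanishes.
Continuity in `x` provides all the measurability needed later. -/
lemma continuous_blockResolvent {B : Matrix (Fin k) (Fin k) (Fin h)} (hB : B.IsSymm) {z : ℂ}
    (hz : z.im ≠ 0) (n : ℕ) : Continuous (blockResolvent B z n) := by
  unfold blockResolvent resolventMatrix
  have h1 : Continuous fun x => z • (1 : Matrix (Fin k × Fin n) (Fin k × Fin n) ℂ)
      - hermBlock B n x := continuous_const.sub (continuous_hermBlock B n)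
  have h2 : ∀ x, (z • (1 : Matrix (Fin k × Fin n) (Fin k × Fin n) ℂ) - hermBlock B n x).det ≠ 0 := by
    intro x h0
    have h3 := congrArg Matrix.det ((hermBlock_isHermitian hB n x).mul_resolvent hz)
    rw [det_mul, h0, zero_mul, det_one] at h3
    exact zero_ne_one h3
  simp_rw [Matrix.inv_def, Ring.inverse_eq_inv']
  exact (h1.matrix_det.inv₀ h2).smul h1.matrix_adjugate

/-- The block of a block matrix in position `(a, c)`, with respect to the second index. -/
def innerBlock (A : Matrix (Fin k × Fin n) (Fin k × Fin n) ℂ) (a c : Fin n) :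
    Matrix (Fin k) (Fin k) ℂ := Matrix.of fun p q => A (p, a) (q, c)

lemma innerBlock_mul (A A' : Matrix (Fin k × Fin n) (Fin k × Fin n) ℂ) (a c : Fin n) :
    innerBlock (A * A') a c = ∑ e, innerBlock A a e * innerBlock A' e c := by
  ext p q
  simp only [innerBlock, of_apply, Matrix.mul_apply, Matrix.sum_apply, Fintype.sum_prod_type]
  exact Finset.sum_comm

lemma innerBlock_sub (A A' : Matrix (Fin k × Fin n) (Fin k × Fin n) ℂ) (a c : Fin n) :
    innerBlock (A - A') a c = innerBlock A a c - innerBlock A' a c := rfl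

lemma innerBlock_smul (r : ℂ) (A : Matrix (Fin k × Fin n) (Fin k × Fin n) ℂ) (a c : Fin n) :
    innerBlock (r • A) a c = r • innerBlock A a c := rfl

lemma innerBlock_one (a c : Fin n) :
    innerBlock (1 : Matrix (Fin k × Fin n) (Fin k × Fin n) ℂ) a c = if a = c then 1 else 0 := by
  ext p q
  by_cases hac : a = c
  · subst hac
    simp [innerBlock, Matrix.one_apply]
  · simp [innerBlock, hac]

/-- Expand in matrix units; the C⋆-identity bounds the norm of each term by its coefficient. -/
lemma Matrix.norm_le_sum_norm_apply (D : Matrix (Fin k) (Fin k) ℂ) :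
    ‖D‖ ≤ ∑ p, ∑ q, ‖D p q‖ := by
  conv_lhs => rw [matrix_eq_sum_single D]
  refine (norm_sum_le _ _).trans (Finset.sum_le_sum fun p _ => ?_)
  refine (norm_sum_le _ _).trans (Finset.sum_le_sum fun q _ => ?_)
  have h1 : ‖Matrix.single p q (D p q)‖ * ‖Matrix.single p q (D p q)‖ ≤ ‖D p q‖ * ‖D p q‖ := by
    rw [← l2_opNorm_conjTranspose_mul_self, conjTranspose_single, single_mul_single_same,
      ← diagonal_single, l2_opNorm_diagonal, Pi.norm_single, norm_mul, norm_star]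
  exact (mul_self_le_mul_self_iff (norm_nonneg _) (norm_nonneg _)).2 h1

lemma norm_innerBlock_le (A : Matrix (Fin k × Fin n) (Fin k × Fin n) ℂ) (a c : Fin n) :
    ‖innerBlock A a c‖ ≤ k ^ 2 * ‖A‖ := by
  refine (Matrix.norm_le_sum_norm_apply _).trans ?_
  calc ∑ p, ∑ q, ‖innerBlock A a c p q‖ ≤ ∑ _p : Fin k, ∑ _q : Fin k, ‖A‖ :=
        Finset.sum_le_sum fun p _ => Finset.sum_le_sum fun q _ => A.norm_apply_le _ _
    _ = k ^ 2 * ‖A‖ := by simp; ring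

/-- A Hilbert-Schmidt estimate: each of the `k n` columns has square norm at most `‖A‖ ^ 2`, and
Cauchy-Schwarz over the `k ^ 2` entries of a block costs a factor `k ^ 2`. The total over `n ^ 2`
blocks is only of order `n`, which makes the off-diagonal resolvent blocks negligible. -/
lemma sum_norm_sq_innerBlock_le (A : Matrix (Fin k × Fin n) (Fin k × Fin n) ℂ) :
    ∑ a, ∑ c, ‖innerBlock A a c‖ ^ 2 ≤ k ^ 3 * n * ‖A‖ ^ 2 := by
  have h1 : ∀ a c, ‖innerBlock A a c‖ ^ 2 ≤ k ^ 2 * ∑ p, ∑ q, ‖A (p, a) (q, c)‖ ^ 2 := by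
    intro a c
    have h2 : ‖innerBlock A a c‖ ≤ ∑ pq : Fin k × Fin k, ‖A (pq.1, a) (pq.2, c)‖ := by
      rw [Fintype.sum_prod_type]
      exact Matrix.norm_le_sum_norm_apply _
    calc ‖innerBlock A a c‖ ^ 2 ≤ (∑ pq : Fin k × Fin k, ‖A (pq.1, a) (pq.2, c)‖) ^ 2 := by gcongr
      _ ≤ (Finset.univ : Finset (Fin k × Fin k)).card
          * ∑ pq : Fin k × Fin k, ‖A (pq.1, a) (pq.2, c)‖ ^ 2 := sq_sum_le_card_mul_sum_sq
      _ = k ^ 2 * ∑ p, ∑ q, ‖A (p, a) (q, c)‖ ^ 2 := by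
        rw [Fintype.sum_prod_type]
        simp
        ring_nf
        simp
  calc ∑ a, ∑ c, ‖innerBlock A a c‖ ^ 2
      ≤ ∑ a : Fin n, ∑ c : Fin n, (k ^ 2 * ∑ p, ∑ q, ‖A (p, a) (q, c)‖ ^ 2 : ℝ) :=
        Finset.sum_le_sum fun a _ => Finset.sum_le_sum fun c _ => h1 a c
    _ = k ^ 2 * ∑ qc : Fin k × Fin n, ∑ pa : Fin k × Fin n, ‖A pa qc‖ ^ 2 := by
        simp_rw [← Finset.mul_sum, Fintype.sum_prod_type]
        congr 1
        rw [Finset.sum_comm]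
        refine (Finset.sum_congr rfl fun c _ => Finset.sum_comm).trans ?_
        refine (Finset.sum_congr rfl fun c _ => Finset.sum_congr rfl fun p _ =>
          Finset.sum_comm).trans ?_
        refine (Finset.sum_congr rfl fun c _ => Finset.sum_comm).trans ?_
        rw [Finset.sum_comm]
    _ ≤ k ^ 2 * ∑ _qc : Fin k × Fin n, ‖A‖ ^ 2 := by
        gcongr with qc
        exact A.sum_norm_sq_col_le qc
    _ = k ^ 3 * n * ‖A‖ ^ 2 := by simp; ring

/-- The normalized partial trace `(id ⊗ tr_n)` of a block matrix. -/
def partialTrace (A : Matrix (Fin k × Fin n) (Fin k × Fin n) ℂ) : Matrix (Fin k) (Fin k) ℂ :=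
  (n : ℂ)⁻¹ • ∑ i, innerBlock A i i

/-- The indicator matrix of the letter `l` in the block-structure `B`. -/
def letterMatrix (B : Matrix (Fin k) (Fin k) (Fin h)) (l : Fin h) : Matrix (Fin k) (Fin k) ℂ :=
  Matrix.of fun p q => if B p q = l then 1 else 0

lemma innerBlock_hermBlock (B : Matrix (Fin k) (Fin k) (Fin h)) (x : ℕ × Fin h × ℕ → ℂ)
    (a c : Fin n) : innerBlock (hermBlock B n x) a c
      = ∑ l, (((√(n : ℝ))⁻¹ : ℝ) * hermEntry x l a c : ℂ) • letterMatrix B l := by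
  ext p q
  simp [innerBlock, hermBlock_apply, letterMatrix, Matrix.sum_apply]

/-- The index in the upper triangle of the entry `(i, j)` of the array `l`. -/
def upperIndex (l : Fin h) (i j : ℕ) : ℕ × Fin h × ℕ := (min i j, l, max i j - min i j)

/-- One upper-triangular variable occupies exactly two places of the array, the entry `(i, j)` and
its conjugate at `(j, i)`. -/
lemma hermEntry_sub_update (x : ℕ × Fin h × ℕ → ℂ) (l l' : Fin h) {i j : ℕ} (hij : i ≠ j)
    (a c : ℕ) : hermEntry x l' a c - hermEntry (Function.update x (upperIndex l i j) 0) l' a c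
      = if l' = l then (if a = i ∧ c = j then hermEntry x l i j
          else if a = j ∧ c = i then star (hermEntry x l i j) else 0) else 0 := by
  by_cases hl : l' = l
  · subst hl
    rw [if_pos rfl]
    rcases lt_trichotomy a c with hac | rfl | hac
    · by_cases h1 : a = i ∧ c = j
      · obtain ⟨rfl, rfl⟩ := h1
        simp [hermEntry, hac, upperIndex, hac.le]
      · by_cases h2 : a = j ∧ c = i
        · obtain ⟨rfl, rfl⟩ := h2
          simp [hermEntry, hac, upperIndex, hac.le, hac.not_gt, hac.ne, hac.ne']
        · rw [if_neg h1, if_neg h2]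
          have : (a, l', c - a) ≠ upperIndex l' i j := by
            intro h
            simp only [upperIndex, Prod.mk.injEq, true_and] at h
            omega
          simp [hermEntry, hac, Function.update_of_ne this]
    · have h1 : ¬ (a = i ∧ a = j) := by omega
      have h2 : ¬ (a = j ∧ a = i) := by omega
      rw [if_neg h1, if_neg h2]
      have : (a, l', 0) ≠ upperIndex l' i j := by
        intro h
        simp only [upperIndex, Prod.mk.injEq, true_and] at h
        omega
      simp [hermEntry, Function.update_of_ne this]
    · by_cases h1 : a = i ∧ c = j
      · obtain ⟨rfl, rfl⟩ := h1
        simp [hermEntry, hac, upperIndex, hac.le, hac.not_gt]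
      · by_cases h2 : a = j ∧ c = i
        · obtain ⟨rfl, rfl⟩ := h2
          simp [hermEntry, hac, upperIndex, hac.le, hac.not_gt, hac.ne, hac.ne']
        · rw [if_neg h1, if_neg h2]
          have : (c, l', a - c) ≠ upperIndex l' i j := by
            intro h
            simp only [upperIndex, Prod.mk.injEq, true_and] at h
            omega
          simp [hermEntry, hac, hac.not_gt, Function.update_of_ne this]
  · rw [if_neg hl]
    have : ∀ a d, (a, l', d) ≠ upperIndex l i j := by
      intro a d h
      simp only [upperIndex, Prod.mk.injEq] at h
      exact hl h.2.1
    simp [hermEntry, Function.update_of_ne (this _ _)]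

lemma innerBlock_hermBlock_sub_update (B : Matrix (Fin k) (Fin k) (Fin h))
    (x : ℕ × Fin h × ℕ → ℂ) (l : Fin h) {i j : Fin n} (hij : i ≠ j) (a c : Fin n) :
    innerBlock (hermBlock B n x
      - hermBlock B n (Function.update x (upperIndex l i j) 0)) a c
      = (((√(n : ℝ))⁻¹ : ℝ) * (if a = i ∧ c = j then hermEntry x l i j
          else if a = j ∧ c = i then star (hermEntry x l i j) else 0) : ℂ) • letterMatrix B l := by
  have hij' : (i : ℕ) ≠ j := fun h => hij (Fin.ext h)
  rw [innerBlock_sub, innerBlock_hermBlock, innerBlock_hermBlock, ← Finset.sum_sub_distrib]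
  simp_rw [← sub_smul, ← mul_sub, hermEntry_sub_update x l _ hij']
  rw [Finset.sum_eq_single l]
  · simp [Fin.ext_iff]
  · intro b _ hb
    simp [hb]
  · simp

end BlockResolvent

end

noncomputable section

/-! ### Expansion of the block resolvent in one entry -/

section Expansion

open scoped Matrix.Norms.L2Operator
open Matrix

variable {k h n : ℕ} {B : Matrix (Fin k) (Fin k) (Fin h)} {z : ℂ}

/-- The blocks of the resolvent. -/
def resolventBlock (B : Matrix (Fin k) (Fin k) (Fin h)) (z : ℂ) (n : ℕ) (a c : Fin n)
    (x : ℕ × Fin h × ℕ → ℂ) : Matrix (Fin k) (Fin k) ℂ :=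
  innerBlock (blockResolvent B z n x) a c

lemma continuous_resolventBlock (hB : B.IsSymm) (hz : z.im ≠ 0) (a c : Fin n) :
    Continuous (resolventBlock B z n a c) :=
  continuous_matrix fun _ _ => (continuous_blockResolvent hB hz n).matrix_elem _ _

lemma norm_blockResolvent_le (hB : B.IsSymm) (hz : z.im ≠ 0) (x : ℕ × Fin h × ℕ → ℂ) :
    ‖blockResolvent B z n x‖ ≤ |z.im|⁻¹ := (hermBlock_isHermitian hB n x).norm_resolvent_le hz

lemma norm_resolventBlock_le (hB : B.IsSymm) (hz : z.im ≠ 0) (a c : Fin n)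
    (x : ℕ × Fin h × ℕ → ℂ) : ‖resolventBlock B z n a c x‖ ≤ k ^ 2 * |z.im|⁻¹ := by
  refine (norm_innerBlock_le _ _ _).trans ?_
  gcongr
  exact norm_blockResolvent_le hB hz x

/-- The resolvent identity, where the perturbation has only two nonzero blocks. On the left of each
product stands the resolvent without the entry, which is independent of it. -/
lemma resolventBlock_sub_update (hB : B.IsSymm) (hz : z.im ≠ 0) (x : ℕ × Fin h × ℕ → ℂ)
    (l : Fin h) {i j : Fin n} (hij : i ≠ j) (a c : Fin n) :
    resolventBlock B z n a c x
      = resolventBlock B z n a c (Function.update x (upperIndex l i j) 0)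
        + (((√(n : ℝ))⁻¹ : ℝ) : ℂ) • (hermEntry x l i j •
            (resolventBlock B z n a i (Function.update x (upperIndex l i j) 0)
              * letterMatrix B l * resolventBlock B z n j c x)
          + star (hermEntry x l i j) •
            (resolventBlock B z n a j (Function.update x (upperIndex l i j) 0)
              * letterMatrix B l * resolventBlock B z n i c x)) := by
  set x' := Function.update x (upperIndex l i j) 0 with hx'
  rw [← sub_eq_iff_eq_add']
  have h1 : blockResolvent B z n x - blockResolvent B z n x'
      = blockResolvent B z n x' * (hermBlock B n x - hermBlock B n x') * blockResolvent B z n x := by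
    have h2 := resolventMatrix_sub (hermBlock_isHermitian hB n x') (hermBlock_isHermitian hB n x) hz
    unfold blockResolvent
    rw [← neg_sub, h2, ← neg_sub (hermBlock B n x'), mul_neg, neg_mul]
  unfold resolventBlock
  rw [← innerBlock_sub, h1, innerBlock_mul]
  simp_rw [innerBlock_mul]
  simp_rw [hx', innerBlock_hermBlock_sub_update B x l hij]
  rw [← hx']
  have h3 : ∀ f e : Fin n, (((√(n : ℝ))⁻¹ : ℝ) * (if f = i ∧ e = j then hermEntry x l i j
          else if f = j ∧ e = i then star (hermEntry x l i j) else 0) : ℂ) • letterMatrix B l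
      = (if f = i then if e = j then
          ((((√(n : ℝ))⁻¹ : ℝ) : ℂ) * hermEntry x l i j) • letterMatrix B l else 0 else 0)
        + if f = j then if e = i then
          ((((√(n : ℝ))⁻¹ : ℝ) : ℂ) * star (hermEntry x l i j)) • letterMatrix B l else 0 else 0 := by
    intro f e
    by_cases hfi : f = i
    · subst hfi
      by_cases h2 : e = j
      · simp [h2, hij]
      · simp [h2, hij]
    · by_cases h2 : f = j
      · subst h2
        by_cases h3 : e = i
        · simp [h3, hfi]
        · simp [h3, hfi]
      · simp [hfi, h2]
  simp_rw [h3, mul_add, Finset.sum_add_distrib, add_mul, Finset.sum_add_distrib, mul_ite, mul_zero,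
    Finset.sum_ite_eq', Finset.mem_univ, if_true, ite_mul, zero_mul, Finset.sum_ite_eq',
    Finset.mem_univ, if_true, smul_add, smul_smul, mul_smul_comm, smul_mul_assoc]

lemma norm_resolventBlock_sub_update_le (hB : B.IsSymm) (hz : z.im ≠ 0) (x : ℕ × Fin h × ℕ → ℂ)
    (l : Fin h) {i j : Fin n} (hij : i ≠ j) (a c : Fin n) :
    ‖resolventBlock B z n a c x
      - resolventBlock B z n a c (Function.update x (upperIndex l i j) 0)‖
      ≤ (√(n : ℝ))⁻¹ * (2 * ‖hermEntry x l i j‖ * (k ^ 2 * |z.im|⁻¹) ^ 2 * ‖letterMatrix B l‖) := by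
  conv_lhs => rw [resolventBlock_sub_update hB hz x l hij a c]
  set κ : ℝ := k ^ 2 * |z.im|⁻¹
  have hκ : ∀ (a c : Fin n) x, ‖resolventBlock B z n a c x‖ ≤ κ := norm_resolventBlock_le hB hz
  have h1 : ∀ (a c e f : Fin n) x x', ‖resolventBlock B z n a e x * letterMatrix B l *
      resolventBlock B z n f c x'‖ ≤ κ * ‖letterMatrix B l‖ * κ := by
    intro a c e f x x'
    refine (norm_mul_le _ _).trans ?_
    gcongr
    · exact (norm_mul_le _ _).trans (by gcongr; exact hκ _ _ _)
    · exact hκ _ _ _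
  rw [add_sub_cancel_left, norm_smul, Complex.norm_real, Real.norm_of_nonneg (by positivity)]
  gcongr
  refine (norm_add_le _ _).trans ?_
  rw [norm_smul, norm_smul, norm_star]
  calc _ ≤ ‖hermEntry x l i j‖ * (κ * ‖letterMatrix B l‖ * κ)
        + ‖hermEntry x l i j‖ * (κ * ‖letterMatrix B l‖ * κ) := by
        gcongr <;> exact h1 _ _ _ _ _ _
    _ = _ := by ring

/-- Second order expansion of `X u_{ji}`, where `X` is the entry `(i, j)` of the array `l`. -/
lemma norm_hermEntry_smul_resolventBlock_sub_le (hB : B.IsSymm) (hz : z.im ≠ 0)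
    (x : ℕ × Fin h × ℕ → ℂ) (l : Fin h) {i j : Fin n} (hij : i ≠ j) :
    ‖hermEntry x l i j • resolventBlock B z n j i x
      - hermEntry x l i j • resolventBlock B z n j i (Function.update x (upperIndex l i j) 0)
      - (((√(n : ℝ))⁻¹ * ‖hermEntry x l i j‖ ^ 2 : ℝ) : ℂ) •
        (resolventBlock B z n j j (Function.update x (upperIndex l i j) 0) * letterMatrix B l
          * resolventBlock B z n i i (Function.update x (upperIndex l i j) 0))‖
      ≤ (√(n : ℝ))⁻¹ * ‖letterMatrix B l‖ * (‖hermEntry x l i j‖ ^ 2 *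
          ‖resolventBlock B z n j i (Function.update x (upperIndex l i j) 0)‖ ^ 2)
        + ((√(n : ℝ))⁻¹) ^ 2 * (4 * (k ^ 2 * |z.im|⁻¹) ^ 3 * ‖letterMatrix B l‖ ^ 2)
          * ‖hermEntry x l i j‖ ^ 3 := by
  have hd1 := norm_resolventBlock_sub_update_le hB hz x l hij i i
  have hd2 := norm_resolventBlock_sub_update_le hB hz x l hij j i
  set x' := Function.update x (upperIndex l i j) 0 with hx'
  have hexp := resolventBlock_sub_update hB hz x l hij j i
  rw [← hx'] at hexp
  set κ : ℝ := k ^ 2 * |z.im|⁻¹ with hκdef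
  have hκ0 : 0 ≤ κ := by positivity
  have hκ : ∀ (a c : Fin n) x, ‖resolventBlock B z n a c x‖ ≤ κ := norm_resolventBlock_le hB hz
  set X := hermEntry x l i j with hX
  set s : ℝ := (√(n : ℝ))⁻¹ with hs
  have hs0 : 0 ≤ s := by positivity
  set b := letterMatrix B l with hb
  set u := resolventBlock B z n j i x with hu
  set u' := resolventBlock B z n j i x' with hu'
  set w := resolventBlock B z n i i x with hw
  set w' := resolventBlock B z n i i x' with hw'
  set y' := resolventBlock B z n j j x' with hy'
  have hXX : X * star X = ((‖X‖ ^ 2 : ℝ) : ℂ) := by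
    rw [Complex.star_def, Complex.mul_conj, Complex.normSq_eq_norm_sq]
  -- Expand once, then replace `u` and `w` by their versions without the entry. The term with `X *
  -- X` produces no main contribution: nothing is known about `E X²`, so it is kept quadratic in
  -- `u'`, an off-diagonal block whose squares are summable. The term with `|X|²` is the main one.
  have hdec : X • u - X • u' - ((s * ‖X‖ ^ 2 : ℝ) : ℂ) • (y' * b * w')
      = (s : ℂ) • ((X * X) • (u' * b * u') + (X * X) • (u' * b * (u - u'))
        + ((‖X‖ ^ 2 : ℝ) : ℂ) • (y' * b * (w - w'))) := by
    have h1 : X • u = X • u' + (s : ℂ) • ((X * X) • (u' * b * u) + (X * star X) • (y' * b * w)) := by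
      conv_lhs => rw [hexp]
      simp only [smul_add, smul_smul]
      congr 2
      · congr 1; ring
      · congr 1; ring
    rw [h1, hXX]
    simp only [mul_sub, smul_sub, smul_add, smul_smul, Complex.ofReal_mul]
    abel
  rw [hdec, norm_smul, Complex.norm_real, Real.norm_of_nonneg hs0]
  have t1 : ‖(X * X) • (u' * b * u')‖ ≤ ‖b‖ * (‖X‖ ^ 2 * ‖u'‖ ^ 2) := by
    rw [norm_smul, norm_mul]
    calc ‖X‖ * ‖X‖ * ‖u' * b * u'‖ ≤ ‖X‖ * ‖X‖ * (‖u'‖ * ‖b‖ * ‖u'‖) := by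
          gcongr
          exact (norm_mul_le _ _).trans (by gcongr; exact norm_mul_le _ _)
      _ = _ := by ring
  have t2 : ‖(X * X) • (u' * b * (u - u'))‖ ≤ s * (2 * κ ^ 3 * ‖b‖ ^ 2) * ‖X‖ ^ 3 := by
    rw [norm_smul, norm_mul]
    calc ‖X‖ * ‖X‖ * ‖u' * b * (u - u')‖
        ≤ ‖X‖ * ‖X‖ * (κ * ‖b‖ * (s * (2 * ‖X‖ * κ ^ 2 * ‖b‖))) := by
          gcongr
          refine (norm_mul_le _ _).trans ?_
          gcongr
          exact (norm_mul_le _ _).trans (by gcongr; exact hκ _ _ _)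
      _ = _ := by ring
  have t3 : ‖((‖X‖ ^ 2 : ℝ) : ℂ) • (y' * b * (w - w'))‖ ≤ s * (2 * κ ^ 3 * ‖b‖ ^ 2) * ‖X‖ ^ 3 := by
    rw [norm_smul, Complex.norm_real, Real.norm_of_nonneg (by positivity)]
    calc ‖X‖ ^ 2 * ‖y' * b * (w - w')‖
        ≤ ‖X‖ ^ 2 * (κ * ‖b‖ * (s * (2 * ‖X‖ * κ ^ 2 * ‖b‖))) := by
          gcongr
          refine (norm_mul_le _ _).trans ?_
          gcongr
          exact (norm_mul_le _ _).trans (by gcongr; exact hκ _ _ _)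
      _ = _ := by ring
  calc s * ‖(X * X) • (u' * b * u') + (X * X) • (u' * b * (u - u'))
        + ((‖X‖ ^ 2 : ℝ) : ℂ) • (y' * b * (w - w'))‖
      ≤ s * (‖b‖ * (‖X‖ ^ 2 * ‖u'‖ ^ 2) + s * (2 * κ ^ 3 * ‖b‖ ^ 2) * ‖X‖ ^ 3
          + s * (2 * κ ^ 3 * ‖b‖ ^ 2) * ‖X‖ ^ 3) := by
        gcongr
        exact norm_add₃_le.trans (add_le_add (add_le_add t1 t2) t3)
    _ = _ := by ring

end Expansion

end

noncomputable section

/-! ### The expected Dyson equation, up to an error -/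

section Expectation

open scoped Matrix.Norms.L2Operator
open Matrix

variable {Ω : Type*} [MeasurableSpace Ω] {k h n : ℕ}

/-- A family of independent random variables that serves as upper triangles of random Hermitian
arrays; the entries above the diagonal are centred, the array `l` has variance `v l`, and `m`
bounds the moments of first order, and off the diagonal the moments of third order. -/
structure IsUpperFamily (Y : ℕ × Fin h × ℕ → Ω → ℂ) (v : Fin h → ℝ≥0) (m : ℝ) (P : Measure Ω) :
    Prop where
  measurable : ∀ e, Measurable (Y e)
  indep : iIndepFun Y P
  integrable : ∀ e, Integrable (Y e) P
  integral_norm_le : ∀ e, ∫ ω, ‖Y e ω‖ ∂P ≤ m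
  mean : ∀ i l d, d ≠ 0 → ∫ ω, Y (i, l, d) ω ∂P = 0
  variance : ∀ i l d, d ≠ 0 → ∫ ω, ‖Y (i, l, d) ω‖ ^ 2 ∂P = v l
  integrable_cube : ∀ i l d, d ≠ 0 → Integrable (fun ω => ‖Y (i, l, d) ω‖ ^ 3) P
  integral_cube_le : ∀ i l d, d ≠ 0 → ∫ ω, ‖Y (i, l, d) ω‖ ^ 3 ∂P ≤ m

variable {P : Measure Ω} {Y : ℕ × Fin h × ℕ → Ω → ℂ} {v : Fin h → ℝ≥0} {m : ℝ}

/-- The alternative does not depend on `x`, so it can be used under integrals and for independence.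
-/
lemma hermEntry_eq_or (l : Fin h) {i j : ℕ} (hij : i ≠ j) :
    (∀ x : ℕ × Fin h × ℕ → ℂ, hermEntry x l i j = x (upperIndex l i j)) ∨
    (∀ x : ℕ × Fin h × ℕ → ℂ, hermEntry x l i j = star (x (upperIndex l i j))) := by
  rcases lt_or_gt_of_ne hij with hij | hij
  · left
    intro x
    simp [hermEntry, hij, upperIndex, hij.le]
  · right
    intro x
    simp [hermEntry, hij, upperIndex, hij.le, hij.not_gt]

lemma upperIndex_ne (l : Fin h) {i j : ℕ} (hij : i ≠ j) :
    ∃ a d, d ≠ 0 ∧ upperIndex l i j = (a, l, d) :=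
  ⟨min i j, max i j - min i j, by omega, rfl⟩

lemma norm_hermEntry (x : ℕ × Fin h × ℕ → ℂ) (l : Fin h) {i j : ℕ} (hij : i ≠ j) :
    ‖hermEntry x l i j‖ = ‖x (upperIndex l i j)‖ := by
  rcases hermEntry_eq_or l hij with h | h <;> simp [h x]

namespace IsUpperFamily

lemma measurable_pi (hY : IsUpperFamily Y v m P) : Measurable fun ω e => Y e ω :=
  measurable_pi_lambda _ hY.measurable

lemma measurable_hermEntry (hY : IsUpperFamily Y v m P) (l : Fin h) (i j : ℕ) :
    Measurable fun ω => hermEntry (fun e => Y e ω) l i j :=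
  (continuous_hermEntry l i j).measurable.comp hY.measurable_pi

lemma measurable_update (hY : IsUpperFamily Y v m P) (e : ℕ × Fin h × ℕ) :
    Measurable fun ω => Function.update (fun e => Y e ω) e 0 := by
  refine measurable_pi_lambda _ fun i => ?_
  by_cases hi : i = e
  · subst hi
    simp
  · simpa only [Function.update_of_ne hi] using hY.measurable i

lemma indepFun_hermEntry (hY : IsUpperFamily Y v m P) (l : Fin h) {i j : ℕ} (hij : i ≠ j) :
    IndepFun (fun ω => hermEntry (fun e => Y e ω) l i j)
      (fun ω => Function.update (fun e => Y e ω) (upperIndex l i j) 0) P := by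
  have h1 := iIndepFun.indepFun_update hY.measurable hY.indep (upperIndex l i j) 0
  rcases hermEntry_eq_or l hij with h | h
  · simp_rw [h]
    exact h1
  · simp_rw [h]
    exact h1.comp (φ := fun w : ℂ => star w) (ψ := id) continuous_star.measurable measurable_id

lemma integrable_hermEntry (hY : IsUpperFamily Y v m P) (l : Fin h) (i j : ℕ) :
    Integrable (fun ω => hermEntry (fun e => Y e ω) l i j) P := by
  by_cases hij : i = j
  · subst hij
    simp only [hermEntry, lt_irrefl, if_false]
    exact (hY.integrable _).re.ofReal
  · refine (hY.integrable (upperIndex l i j)).mono (hY.measurable_hermEntry l i j).aestronglyMeasurable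
      (Eventually.of_forall fun ω => ?_)
    rw [norm_hermEntry _ l hij]

lemma integral_norm_hermEntry_le (hY : IsUpperFamily Y v m P) (l : Fin h) (i j : ℕ) :
    ∫ ω, ‖hermEntry (fun e => Y e ω) l i j‖ ∂P ≤ m := by
  by_cases hij : i = j
  · subst hij
    refine le_trans ?_ (hY.integral_norm_le (i, l, 0))
    refine integral_mono (hY.integrable_hermEntry l i i).norm (hY.integrable _).norm fun ω => ?_
    simp only [hermEntry, lt_irrefl, if_false, Complex.norm_real]
    exact Complex.abs_re_le_norm _
  · simp_rw [norm_hermEntry _ l hij]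
    exact hY.integral_norm_le _

lemma integral_hermEntry (hY : IsUpperFamily Y v m P) (l : Fin h) {i j : ℕ} (hij : i ≠ j) :
    ∫ ω, hermEntry (fun e => Y e ω) l i j ∂P = 0 := by
  obtain ⟨a, d, hd, he⟩ := upperIndex_ne l hij
  rcases hermEntry_eq_or l hij with h | h
  · simp_rw [h, he]
    exact hY.mean a l d hd
  · simp_rw [h, he]
    have h1 := hY.mean a l d hd
    have h2 : ∫ ω, star (Y (a, l, d) ω) ∂P = star (∫ ω, Y (a, l, d) ω ∂P) := integral_conj
    rw [h2, h1, star_zero]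

lemma integral_norm_sq_hermEntry (hY : IsUpperFamily Y v m P) (l : Fin h) {i j : ℕ}
    (hij : i ≠ j) : ∫ ω, ‖hermEntry (fun e => Y e ω) l i j‖ ^ 2 ∂P = v l := by
  obtain ⟨a, d, hd, he⟩ := upperIndex_ne l hij
  simp_rw [norm_hermEntry _ l hij, he]
  exact hY.variance a l d hd

lemma integrable_cube_hermEntry (hY : IsUpperFamily Y v m P) (l : Fin h) {i j : ℕ}
    (hij : i ≠ j) : Integrable (fun ω => ‖hermEntry (fun e => Y e ω) l i j‖ ^ 3) P := by
  obtain ⟨a, d, hd, he⟩ := upperIndex_ne l hij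
  simp_rw [norm_hermEntry _ l hij, he]
  exact hY.integrable_cube a l d hd

lemma integral_cube_hermEntry_le (hY : IsUpperFamily Y v m P) (l : Fin h) {i j : ℕ}
    (hij : i ≠ j) : ∫ ω, ‖hermEntry (fun e => Y e ω) l i j‖ ^ 3 ∂P ≤ m := by
  obtain ⟨a, d, hd, he⟩ := upperIndex_ne l hij
  simp_rw [norm_hermEntry _ l hij, he]
  exact hY.integral_cube_le a l d hd

lemma integrable_sq_hermEntry [IsFiniteMeasure P] (hY : IsUpperFamily Y v m P) (l : Fin h)
    {i j : ℕ} (hij : i ≠ j) :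
    Integrable (fun ω => ‖hermEntry (fun e => Y e ω) l i j‖ ^ 2) P := by
  refine ((integrable_const (1 : ℝ)).add (hY.integrable_cube_hermEntry l hij)).mono
    ((hY.measurable_hermEntry l i j).norm.pow_const 2).aestronglyMeasurable
    (Eventually.of_forall fun ω => ?_)
  set t := ‖hermEntry (fun e => Y e ω) l i j‖
  have ht : 0 ≤ t := norm_nonneg _
  have h1 : 0 ≤ 1 + t ^ 3 := by positivity
  rw [Real.norm_of_nonneg (by positivity), Pi.add_apply, Real.norm_of_nonneg h1]
  rcases le_total t 1 with h | h
  · nlinarith [pow_nonneg ht 3]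
  · nlinarith [pow_nonneg ht 2]

end IsUpperFamily

variable {B : Matrix (Fin k) (Fin k) (Fin h)} {z : ℂ}

lemma integrable_comp_of_continuous {E : Type*} [NormedAddCommGroup E] [IsFiniteMeasure P]
    {F : (ℕ × Fin h × ℕ → ℂ) → E} (hF : Continuous F) {C : ℝ} (hC : ∀ x, ‖F x‖ ≤ C)
    {x : Ω → ℕ × Fin h × ℕ → ℂ} (hx : Measurable x) : Integrable (fun ω => F (x ω)) P :=
  Integrable.of_bound (hF.comp_aestronglyMeasurable hx.aestronglyMeasurable) C
    (Eventually.of_forall fun _ => hC _)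

variable [IsProbabilityMeasure P]

/-- Approximate integration by parts for one entry off the diagonal. -/
lemma norm_integral_hermEntry_smul_sub_le (hY : IsUpperFamily Y v m P) (hB : B.IsSymm)
    (hz : z.im ≠ 0) (l : Fin h) {i j : Fin n} (hij : i ≠ j) :
    ‖∫ ω, hermEntry (fun e => Y e ω) l i j • resolventBlock B z n j i (fun e => Y e ω) ∂P
      - (((√(n : ℝ))⁻¹ * v l : ℝ) : ℂ) • ∫ ω, resolventBlock B z n j j (fun e => Y e ω)
          * letterMatrix B l * resolventBlock B z n i i (fun e => Y e ω) ∂P‖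
      ≤ (√(n : ℝ))⁻¹ * v l * ‖letterMatrix B l‖
          * ∫ ω, ‖resolventBlock B z n j i (fun e => Y e ω)‖ ^ 2 ∂P
        + ((√(n : ℝ))⁻¹) ^ 2 *
          (4 * (k ^ 2 * |z.im|⁻¹) ^ 3 * ‖letterMatrix B l‖ ^ 2 * (1 + 2 * v l) * m) := by
  have hij' : (i : ℕ) ≠ j := fun h => hij (Fin.ext h)
  set κ : ℝ := k ^ 2 * |z.im|⁻¹ with hκdef
  have hκ0 : 0 ≤ κ := by positivity
  have hκ : ∀ (a c : Fin n) x, ‖resolventBlock B z n a c x‖ ≤ κ := norm_resolventBlock_le hB hz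
  have hcont : ∀ a c : Fin n, Continuous (resolventBlock B z n a c) :=
    continuous_resolventBlock hB hz
  set s : ℝ := (√(n : ℝ))⁻¹ with hs
  have hs0 : 0 ≤ s := by positivity
  set b := letterMatrix B l with hb
  set x : Ω → ℕ × Fin h × ℕ → ℂ := fun ω e => Y e ω with hx
  have hxm : Measurable x := hY.measurable_pi
  set x' : Ω → ℕ × Fin h × ℕ → ℂ := fun ω => Function.update (fun e => Y e ω) (upperIndex l i j) 0
    with hx'
  have hxm' : Measurable x' := hY.measurable_update _
  set X : Ω → ℂ := fun ω => hermEntry (fun e => Y e ω) l i j with hX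
  have hXm : Measurable X := hY.measurable_hermEntry l i j
  have hind : IndepFun X x' P := hY.indepFun_hermEntry l hij'
  set u := resolventBlock B z n j i with hu
  set F : (ℕ × Fin h × ℕ → ℂ) → Matrix (Fin k) (Fin k) ℂ := fun x =>
    resolventBlock B z n j j x * b * resolventBlock B z n i i x with hF
  have hFc : Continuous F := ((hcont j j).mul continuous_const).mul (hcont i i)
  have hFb : ∀ x, ‖F x‖ ≤ κ * ‖b‖ * κ := by
    intro x
    refine (norm_mul_le _ _).trans ?_
    gcongr
    · exact (norm_mul_le _ _).trans (by gcongr; exact hκ _ _ _)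
    · exact hκ _ _ _
  have huc : Continuous u := hcont j i
  have hub : ∀ x, ‖u x‖ ≤ κ := hκ j i
  have hu2c : Continuous fun x => ‖u x‖ ^ 2 := huc.norm.pow 2
  have hu2b : ∀ x, ‖‖u x‖ ^ 2‖ ≤ κ ^ 2 := fun x => by
    rw [Real.norm_of_nonneg (by positivity)]
    gcongr
    exact hub x
  have hX1 : Integrable X P := hY.integrable_hermEntry l i j
  have hX2 : Integrable (fun ω => ‖X ω‖ ^ 2) P := hY.integrable_sq_hermEntry l hij'
  have hX3 : Integrable (fun ω => ‖X ω‖ ^ 3) P := hY.integrable_cube_hermEntry l hij'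
  have hm1 : ∫ ω, ‖X ω‖ ∂P ≤ m := hY.integral_norm_hermEntry_le l i j
  have hm3 : ∫ ω, ‖X ω‖ ^ 3 ∂P ≤ m := hY.integral_cube_hermEntry_le l hij'
  -- independence
  have e1 : ∫ ω, X ω • u (x' ω) ∂P = 0 := by
    rw [hind.integral_fun_comp_smul_comp (f := fun w => w) (g := u) hXm.aemeasurable
      hxm'.aemeasurable aestronglyMeasurable_id huc.aestronglyMeasurable]
    rw [show ∫ ω, X ω ∂P = 0 from hY.integral_hermEntry l hij', zero_smul]
  have e2 : ∫ ω, ((s * ‖X ω‖ ^ 2 : ℝ) : ℂ) • F (x' ω) ∂P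
      = ((s * v l : ℝ) : ℂ) • ∫ ω, F (x' ω) ∂P := by
    rw [hind.integral_fun_comp_smul_comp (f := fun w => ((s * ‖w‖ ^ 2 : ℝ) : ℂ)) (g := F)
      hXm.aemeasurable hxm'.aemeasurable
      (Continuous.aestronglyMeasurable (by fun_prop)) hFc.aestronglyMeasurable]
    rw [integral_complex_ofReal, integral_const_mul,
      show ∫ ω, ‖X ω‖ ^ 2 ∂P = v l from hY.integral_norm_sq_hermEntry l hij']
  have e3 : ∫ ω, ‖X ω‖ ^ 2 * ‖u (x' ω)‖ ^ 2 ∂P = v l * ∫ ω, ‖u (x' ω)‖ ^ 2 ∂P := by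
    have := hind.integral_fun_comp_smul_comp (f := fun w => ‖w‖ ^ 2) (g := fun x => ‖u x‖ ^ 2)
      hXm.aemeasurable hxm'.aemeasurable
      (Continuous.aestronglyMeasurable (by fun_prop)) hu2c.aestronglyMeasurable
    simp only [smul_eq_mul] at this
    rw [this, show ∫ ω, ‖X ω‖ ^ 2 ∂P = v l from hY.integral_norm_sq_hermEntry l hij']
  -- integrability
  have hXsm : ∀ {G : (ℕ × Fin h × ℕ → ℂ) → Matrix (Fin k) (Fin k) ℂ} {C : ℝ}, Continuous G →
      (∀ x, ‖G x‖ ≤ C) → ∀ {f : Ω → ℂ}, Integrable f P → ∀ {y : Ω → ℕ × Fin h × ℕ → ℂ},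
      Measurable y → Integrable (fun ω => f ω • G (y ω)) P := by
    intro G C hG hC f hf y hy
    exact hf.smul_bdd C (hG.comp_aestronglyMeasurable hy.aestronglyMeasurable)
      (Eventually.of_forall fun _ => hC _)
  have i1 : Integrable (fun ω => X ω • u (x ω)) P := hXsm huc hub hX1 hxm
  have i2 : Integrable (fun ω => X ω • u (x' ω)) P := hXsm huc hub hX1 hxm'
  have i3 : Integrable (fun ω => ((s * ‖X ω‖ ^ 2 : ℝ) : ℂ) • F (x' ω)) P :=
    hXsm hFc hFb (hX2.const_mul s).ofReal hxm'
  have i4 : Integrable (fun ω => ‖X ω‖ ^ 2 * ‖u (x' ω)‖ ^ 2) P :=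
    hX2.mul_bdd (c := κ ^ 2) (hu2c.comp_aestronglyMeasurable hxm'.aestronglyMeasurable)
      (Eventually.of_forall fun ω => hu2b _)
  have i5 : Integrable (fun ω => F (x ω)) P := integrable_comp_of_continuous hFc hFb hxm
  have i6 : Integrable (fun ω => F (x' ω)) P := integrable_comp_of_continuous hFc hFb hxm'
  have i7 : Integrable (fun ω => ‖u (x ω)‖ ^ 2) P := integrable_comp_of_continuous hu2c hu2b hxm
  have i8 : Integrable (fun ω => ‖u (x' ω)‖ ^ 2) P := integrable_comp_of_continuous hu2c hu2b hxm'
  -- the three estimates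
  have b1 : ‖∫ ω, X ω • u (x ω) ∂P - ((s * v l : ℝ) : ℂ) • ∫ ω, F (x' ω) ∂P‖
      ≤ s * ‖b‖ * (v l * ∫ ω, ‖u (x' ω)‖ ^ 2 ∂P) + s ^ 2 * (4 * κ ^ 3 * ‖b‖ ^ 2) * m := by
    have h1 : ∫ ω, X ω • u (x ω) ∂P - ((s * v l : ℝ) : ℂ) • ∫ ω, F (x' ω) ∂P
        = ∫ ω, (X ω • u (x ω) - X ω • u (x' ω) - ((s * ‖X ω‖ ^ 2 : ℝ) : ℂ) • F (x' ω)) ∂P := by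
      have i12 : Integrable (fun ω => X ω • u (x ω) - X ω • u (x' ω)) P := i1.sub i2
      rw [integral_sub i12 i3, integral_sub i1 i2, e1, e2, sub_zero]
    rw [h1]
    calc _ ≤ ∫ ω, (s * ‖b‖ * (‖X ω‖ ^ 2 * ‖u (x' ω)‖ ^ 2)
          + s ^ 2 * (4 * κ ^ 3 * ‖b‖ ^ 2) * ‖X ω‖ ^ 3) ∂P :=
          norm_integral_le_of_norm_le ((i4.const_mul _).add (hX3.const_mul _))
            (Eventually.of_forall fun ω =>
              norm_hermEntry_smul_resolventBlock_sub_le hB hz (x ω) l hij)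
      _ = s * ‖b‖ * (v l * ∫ ω, ‖u (x' ω)‖ ^ 2 ∂P)
          + s ^ 2 * (4 * κ ^ 3 * ‖b‖ ^ 2) * ∫ ω, ‖X ω‖ ^ 3 ∂P := by
          rw [integral_add (i4.const_mul _) (hX3.const_mul _), integral_const_mul,
            integral_const_mul, e3]
      _ ≤ _ := by gcongr
  have hd : ∀ a c ω, ‖resolventBlock B z n a c (x ω) - resolventBlock B z n a c (x' ω)‖
      ≤ s * (2 * ‖X ω‖ * κ ^ 2 * ‖b‖) := fun a c ω =>
    norm_resolventBlock_sub_update_le hB hz (x ω) l hij a c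
  -- Having used independence, the full resolvent is restored in the main term; this costs one more
  -- factor `n^{-1/2}`.
  have b2 : ‖∫ ω, F (x' ω) ∂P - ∫ ω, F (x ω) ∂P‖ ≤ s * (4 * κ ^ 3 * ‖b‖ ^ 2) * m := by
    rw [← integral_sub i6 i5]
    calc _ ≤ ∫ ω, s * (4 * κ ^ 3 * ‖b‖ ^ 2) * ‖X ω‖ ∂P := by
          refine norm_integral_le_of_norm_le (hX1.norm.const_mul _)
            (Eventually.of_forall fun ω => ?_)
          have h1 : F (x' ω) - F (x ω)
              = (resolventBlock B z n j j (x' ω) - resolventBlock B z n j j (x ω)) * b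
                  * resolventBlock B z n i i (x' ω)
                + resolventBlock B z n j j (x ω) * b
                  * (resolventBlock B z n i i (x' ω) - resolventBlock B z n i i (x ω)) := by
            simp only [hF]
            noncomm_ring
          rw [h1]
          calc _ ≤ s * (2 * ‖X ω‖ * κ ^ 2 * ‖b‖) * ‖b‖ * κ
                + κ * ‖b‖ * (s * (2 * ‖X ω‖ * κ ^ 2 * ‖b‖)) := by
                refine (norm_add_le _ _).trans (add_le_add ?_ ?_)
                · refine (norm_mul_le _ _).trans ?_
                  gcongr
                  · refine (norm_mul_le _ _).trans ?_
                    gcongr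
                    rw [norm_sub_rev]
                    exact hd _ _ _
                  · exact hκ _ _ _
                · refine (norm_mul_le _ _).trans ?_
                  gcongr
                  · exact (norm_mul_le _ _).trans (by gcongr; exact hκ _ _ _)
                  · rw [norm_sub_rev]
                    exact hd _ _ _
            _ = _ := by ring
      _ = s * (4 * κ ^ 3 * ‖b‖ ^ 2) * ∫ ω, ‖X ω‖ ∂P := integral_const_mul _ _
      _ ≤ _ := by gcongr
  -- The same is done in the error term, because the Hilbert-Schmidt bound sums the blocks of one
  -- fixed resolvent, whereas `x'` changes with `(i, j)`.
  have b3 : ∫ ω, ‖u (x' ω)‖ ^ 2 ∂P ≤ ∫ ω, ‖u (x ω)‖ ^ 2 ∂P + s * (4 * κ ^ 3 * ‖b‖) * m := by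
    calc _ ≤ ∫ ω, (‖u (x ω)‖ ^ 2 + s * (4 * κ ^ 3 * ‖b‖) * ‖X ω‖) ∂P := by
          refine integral_mono i8 (i7.add (hX1.norm.const_mul _)) fun ω => ?_
          have h1 := hd j i ω
          have h2 : ‖u (x' ω)‖ ≤ ‖u (x ω)‖ + s * (2 * ‖X ω‖ * κ ^ 2 * ‖b‖) := by
            have := norm_sub_norm_le (u (x' ω)) (u (x ω))
            rw [norm_sub_rev] at this
            linarith
          have h3 : ‖u (x' ω)‖ ≤ κ := hub _
          have h4 : ‖u (x ω)‖ ≤ κ := hub _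
          have h5 : 0 ≤ ‖u (x' ω)‖ := norm_nonneg _
          have h6 : 0 ≤ ‖u (x ω)‖ := norm_nonneg _
          have h7 : 0 ≤ s * (2 * ‖X ω‖ * κ ^ 2 * ‖b‖) := by positivity
          have h8 : ‖u (x' ω)‖ ^ 2 - ‖u (x ω)‖ ^ 2
              ≤ 2 * κ * (s * (2 * ‖X ω‖ * κ ^ 2 * ‖b‖)) := by
            nlinarith
          calc ‖u (x' ω)‖ ^ 2 ≤ ‖u (x ω)‖ ^ 2 + 2 * κ * (s * (2 * ‖X ω‖ * κ ^ 2 * ‖b‖)) := by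
                linarith
            _ = _ := by ring
      _ = ∫ ω, ‖u (x ω)‖ ^ 2 ∂P + s * (4 * κ ^ 3 * ‖b‖) * ∫ ω, ‖X ω‖ ∂P := by
          rw [integral_add i7 (hX1.norm.const_mul _), integral_const_mul]
      _ ≤ _ := by gcongr
  have hfin : ∫ ω, X ω • u (x ω) ∂P - ((s * v l : ℝ) : ℂ) • ∫ ω, F (x ω) ∂P
      = (∫ ω, X ω • u (x ω) ∂P - ((s * v l : ℝ) : ℂ) • ∫ ω, F (x' ω) ∂P)
        + ((s * v l : ℝ) : ℂ) • (∫ ω, F (x' ω) ∂P - ∫ ω, F (x ω) ∂P) := by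
    rw [smul_sub]
    abel
  have hv0 : (0 : ℝ) ≤ v l := NNReal.coe_nonneg _
  change ‖∫ ω, X ω • u (x ω) ∂P - ((s * v l : ℝ) : ℂ) • ∫ ω, F (x ω) ∂P‖ ≤ _
  rw [hfin]
  refine (norm_add_le _ _).trans ?_
  rw [norm_smul, Complex.norm_real, Real.norm_of_nonneg (by positivity)]
  calc _ ≤ (s * ‖b‖ * (v l * (∫ ω, ‖u (x ω)‖ ^ 2 ∂P + s * (4 * κ ^ 3 * ‖b‖) * m))
        + s ^ 2 * (4 * κ ^ 3 * ‖b‖ ^ 2) * m) + s * v l * (s * (4 * κ ^ 3 * ‖b‖ ^ 2) * m) := by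
        refine add_le_add (b1.trans ?_) ?_
        · gcongr
        · gcongr
    _ = _ := by ring

end Expectation

end

noncomputable section

/-! ### The operator-valued Dyson equation for random block matrices -/

section Dyson

open scoped Matrix.Norms.L2Operator
open Matrix

variable {Ω : Type*} [MeasurableSpace Ω] {k h n : ℕ}

/-- The covariance map of the block-structure `B` with variances `v`. -/
def covarianceMap (B : Matrix (Fin k) (Fin k) (Fin h)) (v : Fin h → ℝ≥0) :
    Matrix (Fin k) (Fin k) ℂ →ₗ[ℂ] Matrix (Fin k) (Fin k) ℂ :=
  ∑ l, ((v l : ℝ) : ℂ) • (LinearMap.mulRight ℂ (letterMatrix B l) ∘ₗ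
    LinearMap.mulLeft ℂ (letterMatrix B l))

lemma covarianceMap_apply (B : Matrix (Fin k) (Fin k) (Fin h)) (v : Fin h → ℝ≥0)
    (D : Matrix (Fin k) (Fin k) ℂ) : covarianceMap B v D
      = ∑ l, ((v l : ℝ) : ℂ) • (letterMatrix B l * D * letterMatrix B l) := by
  simp [covarianceMap]

/-- A bound for the norm of the covariance map. -/
def covarianceBound (B : Matrix (Fin k) (Fin k) (Fin h)) (v : Fin h → ℝ≥0) : ℝ :=
  ∑ l, (v l : ℝ) * ‖letterMatrix B l‖ ^ 2

lemma covarianceBound_nonneg (B : Matrix (Fin k) (Fin k) (Fin h)) (v : Fin h → ℝ≥0) :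
    0 ≤ covarianceBound B v := Finset.sum_nonneg fun _ _ => by positivity

lemma norm_covarianceMap_le (B : Matrix (Fin k) (Fin k) (Fin h)) (v : Fin h → ℝ≥0)
    (D : Matrix (Fin k) (Fin k) ℂ) : ‖covarianceMap B v D‖ ≤ covarianceBound B v * ‖D‖ := by
  rw [covarianceMap_apply, covarianceBound, Finset.sum_mul]
  refine (norm_sum_le _ _).trans (Finset.sum_le_sum fun l _ => ?_)
  rw [norm_smul, Complex.norm_real, Real.norm_of_nonneg (NNReal.coe_nonneg _)]
  calc (v l : ℝ) * ‖letterMatrix B l * D * letterMatrix B l‖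
      ≤ v l * (‖letterMatrix B l‖ * ‖D‖ * ‖letterMatrix B l‖) := by
        gcongr
        exact (norm_mul_le _ _).trans (by gcongr; exact norm_mul_le _ _)
    _ = _ := by ring

/-- The partial trace of the resolvent. -/
def meanResolvent (B : Matrix (Fin k) (Fin k) (Fin h)) (z : ℂ) (n : ℕ) (x : ℕ × Fin h × ℕ → ℂ) :
    Matrix (Fin k) (Fin k) ℂ :=
  partialTrace (blockResolvent B z n x)

lemma meanResolvent_eq (B : Matrix (Fin k) (Fin k) (Fin h)) (z : ℂ) (n : ℕ)
    (x : ℕ × Fin h × ℕ → ℂ) :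
    meanResolvent B z n x = (n : ℂ)⁻¹ • ∑ i, resolventBlock B z n i i x := rfl

variable {B : Matrix (Fin k) (Fin k) (Fin h)} {z : ℂ}

lemma continuous_meanResolvent (hB : B.IsSymm) (hz : z.im ≠ 0) (n : ℕ) :
    Continuous (meanResolvent B z n) :=
  (continuous_finsetSum Finset.univ fun i _ =>
    continuous_resolventBlock hB hz i i).const_smul (n : ℂ)⁻¹

lemma norm_meanResolvent_le (hB : B.IsSymm) (hz : z.im ≠ 0) (n : ℕ) (x : ℕ × Fin h × ℕ → ℂ) :
    ‖meanResolvent B z n x‖ ≤ k ^ 2 * |z.im|⁻¹ := by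
  rw [meanResolvent_eq, norm_smul, norm_inv, Complex.norm_natCast]
  calc (n : ℝ)⁻¹ * ‖∑ i, resolventBlock B z n i i x‖
      ≤ (n : ℝ)⁻¹ * ∑ _i : Fin n, (k ^ 2 * |z.im|⁻¹ : ℝ) := by
        gcongr
        exact norm_sum_le_of_le _ fun i _ => norm_resolventBlock_le hB hz i i x
    _ ≤ _ := by
        rw [Finset.sum_const, Finset.card_univ, Fintype.card_fin, nsmul_eq_mul, ← mul_assoc]
        have h1 : (n : ℝ)⁻¹ * n ≤ 1 := inv_mul_le_one
        have h2 : (0 : ℝ) ≤ k ^ 2 * |z.im|⁻¹ := by positivity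
        nlinarith

/-- The diagonal block of `R (z - M) = 1`. The products `X_ij R_ji` on the right are those to which
integration by parts applies. -/
lemma smul_resolventBlock_self (hB : B.IsSymm) (hz : z.im ≠ 0) (x : ℕ × Fin h × ℕ → ℂ)
    (j : Fin n) : z • resolventBlock B z n j j x = 1 + ∑ l, ∑ i : Fin n,
      (((√(n : ℝ))⁻¹ : ℝ) : ℂ) • ((hermEntry x l i j • resolventBlock B z n j i x)
        * letterMatrix B l) := by
  have h1 := (hermBlock_isHermitian hB n x).resolvent_mul hz
  have h2 := congrArg (fun A => innerBlock A j j) h1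
  simp only [mul_sub, innerBlock_sub, innerBlock_one, if_true, mul_smul_comm, mul_one,
    innerBlock_smul, innerBlock_mul] at h2
  rw [sub_eq_iff_eq_add] at h2
  change z • innerBlock (resolventMatrix (hermBlock B n x) z) j j = _
  rw [h2]
  congr 1
  rw [Finset.sum_comm]
  refine Finset.sum_congr rfl fun i _ => ?_
  rw [innerBlock_hermBlock, Finset.mul_sum]
  refine Finset.sum_congr rfl fun l _ => ?_
  rw [mul_smul_comm, smul_mul_assoc, smul_smul]
  rfl

variable {P : Measure Ω} [IsProbabilityMeasure P] {Y : ℕ × Fin h × ℕ → Ω → ℂ} {v : Fin h → ℝ≥0}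
  {m : ℝ}

/-- The constant in the error term of the expected Dyson equation. -/
def dysonConstant (B : Matrix (Fin k) (Fin k) (Fin h)) (v : Fin h → ℝ≥0) (m : ℝ) (z : ℂ) : ℝ :=
  ∑ l, ‖letterMatrix B l‖ * (v l * ‖letterMatrix B l‖ * (k ^ 3 * |z.im|⁻¹ ^ 2)
    + 4 * (k ^ 2 * |z.im|⁻¹) ^ 3 * ‖letterMatrix B l‖ ^ 2 * (1 + 2 * v l) * m
    + (m * (k ^ 2 * |z.im|⁻¹) + v l * (k ^ 2 * |z.im|⁻¹) ^ 2 * ‖letterMatrix B l‖))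

/-- The main terms of the integration by parts recombine, by bilinearity, into the partial trace
times its image under the covariance map. Three errors remain, each of order `n^{-1/2}` after
averaging: the squared off-diagonal blocks, the third-moment remainders, and the `n` diagonal
entries. -/
lemma norm_integral_dyson_le (hY : IsUpperFamily Y v m P) (hB : B.IsSymm) (hz : z.im ≠ 0)
    (hn : n ≠ 0) (hm : 0 ≤ m) :
    ‖∫ ω, (z • meanResolvent B z n (fun e => Y e ω) - 1 - meanResolvent B z n (fun e => Y e ω) *
        covarianceMap B v (meanResolvent B z n fun e => Y e ω)) ∂P‖
      ≤ (√(n : ℝ))⁻¹ * dysonConstant B v m z := by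
  set κ : ℝ := k ^ 2 * |z.im|⁻¹ with hκdef
  have hκ0 : 0 ≤ κ := by positivity
  set s : ℝ := (√(n : ℝ))⁻¹ with hs
  have hs0 : 0 ≤ s := by positivity
  have hn1 : (1 : ℝ) ≤ n := by exact_mod_cast Nat.one_le_iff_ne_zero.2 hn
  have hs1 : s ≤ 1 := inv_le_one_of_one_le₀ (by rwa [Real.one_le_sqrt])
  have hsn : s ^ 2 * n = 1 := by
    rw [hs, inv_pow, Real.sq_sqrt (by positivity)]
    exact inv_mul_cancel₀ (by positivity)
  have hnC : (n : ℂ) ≠ 0 := by exact_mod_cast hn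
  set x : Ω → ℕ × Fin h × ℕ → ℂ := fun ω e => Y e ω with hx
  have hxm : Measurable x := hY.measurable_pi
  have hκ : ∀ (a c : Fin n) x, ‖resolventBlock B z n a c x‖ ≤ κ := norm_resolventBlock_le hB hz
  have hcont : ∀ a c : Fin n, Continuous (resolventBlock B z n a c) :=
    continuous_resolventBlock hB hz
  set b : Fin h → Matrix (Fin k) (Fin k) ℂ := letterMatrix B with hb
  set W : Fin h → Fin n → Fin n → Ω → Matrix (Fin k) (Fin k) ℂ := fun l i j ω =>
    hermEntry (x ω) l i j • resolventBlock B z n j i (x ω) with hW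
  set F : Fin h → Fin n → Fin n → Ω → Matrix (Fin k) (Fin k) ℂ := fun l i j ω =>
    resolventBlock B z n j j (x ω) * b l * resolventBlock B z n i i (x ω) with hF
  have hWi : ∀ l i j, Integrable (W l i j) P := fun l i j =>
    (hY.integrable_hermEntry l i j).smul_bdd κ
      ((hcont j i).comp_aestronglyMeasurable hxm.aestronglyMeasurable)
      (Eventually.of_forall fun _ => hκ _ _ _)
  have hFn : ∀ l i j ω, ‖F l i j ω‖ ≤ κ * ‖b l‖ * κ := by
    intro l i j ω
    refine (norm_mul_le _ _).trans ?_
    gcongr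
    · exact (norm_mul_le _ _).trans (by gcongr; exact hκ _ _ _)
    · exact hκ _ _ _
  have hFi : ∀ l i j, Integrable (F l i j) P := fun l i j =>
    Integrable.of_bound (((((hcont j j).mul continuous_const).mul
      (hcont i i)).comp_aestronglyMeasurable hxm.aestronglyMeasurable)) (κ * ‖b l‖ * κ)
      (Eventually.of_forall fun _ => hFn _ _ _ _)
  -- A pointwise rearrangement in which the deterministic weights `s * v l` are the expected leading
  -- terms; `s * s = n⁻¹` turns the double sum into a product of two partial traces.
  have hpt : ∀ ω, z • meanResolvent B z n (x ω) - 1 - meanResolvent B z n (x ω) *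
        covarianceMap B v (meanResolvent B z n (x ω))
      = ∑ l, ∑ i, ∑ j, ((n : ℂ)⁻¹ * s) • ((W l i j ω - ((s * v l : ℝ) : ℂ) • F l i j ω) * b l) := by
    intro ω
    have h1 : z • meanResolvent B z n (x ω) - 1
        = ∑ l, ∑ i, ∑ j, ((n : ℂ)⁻¹ * s) • (W l i j ω * b l) := by
      rw [meanResolvent_eq, smul_comm, Finset.smul_sum]
      simp_rw [smul_resolventBlock_self hB hz]
      rw [Finset.sum_add_distrib, Finset.sum_const, Finset.card_univ, Fintype.card_fin, smul_add,
        ← Nat.cast_smul_eq_nsmul ℂ, smul_smul, inv_mul_cancel₀ hnC, one_smul, add_sub_cancel_left,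
        Finset.sum_comm, Finset.smul_sum]
      refine Finset.sum_congr rfl fun l _ => ?_
      rw [Finset.sum_comm, Finset.smul_sum]
      refine Finset.sum_congr rfl fun i _ => ?_
      rw [Finset.smul_sum]
      refine Finset.sum_congr rfl fun j _ => ?_
      rw [smul_smul]
    have h2 : meanResolvent B z n (x ω) * covarianceMap B v (meanResolvent B z n (x ω))
        = ∑ l, ∑ i, ∑ j, ((n : ℂ)⁻¹ * s) • ((((s * v l : ℝ) : ℂ) • F l i j ω) * b l) := by
      rw [covarianceMap_apply, Finset.mul_sum]
      refine Finset.sum_congr rfl fun l _ => ?_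
      have h3 : ((n : ℂ)⁻¹ * s) * ((s * v l : ℝ) : ℂ) = (n : ℂ)⁻¹ * (n : ℂ)⁻¹ * ((v l : ℝ) : ℂ) := by
        have h4 : (s : ℂ) * s = (n : ℂ)⁻¹ := by
          rw [← Complex.ofReal_mul, ← sq, eq_inv_of_mul_eq_one_left hsn]
          simp
        rw [Complex.ofReal_mul, ← h4]
        ring
      have h5 : ∑ i, ∑ j, F l i j ω = (∑ j, resolventBlock B z n j j (x ω)) * b l
          * ∑ i, resolventBlock B z n i i (x ω) := by
        simp only [hF, ← Finset.sum_mul, ← Finset.mul_sum]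
      have h6 : ∑ i, ∑ j, ((n : ℂ)⁻¹ * s) • ((((s * v l : ℝ) : ℂ) • F l i j ω) * b l)
          = (((n : ℂ)⁻¹ * s) * ((s * v l : ℝ) : ℂ)) • ((∑ i, ∑ j, F l i j ω) * b l) := by
        simp only [Finset.sum_mul, Finset.smul_sum, smul_mul_assoc, smul_smul]
      rw [h6, h5, h3, meanResolvent_eq]
      simp only [smul_mul_assoc, mul_smul_comm, smul_smul, mul_assoc]
      congr 1
      ring
    rw [h1, h2, ← Finset.sum_sub_distrib]
    refine Finset.sum_congr rfl fun l _ => ?_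
    rw [← Finset.sum_sub_distrib]
    refine Finset.sum_congr rfl fun i _ => ?_
    rw [← Finset.sum_sub_distrib]
    refine Finset.sum_congr rfl fun j _ => ?_
    rw [← smul_sub, sub_mul]
  have hint : ∀ l i j, Integrable (fun ω =>
      ((n : ℂ)⁻¹ * s) • ((W l i j ω - ((s * v l : ℝ) : ℂ) • F l i j ω) * b l)) P := by
    intro l i j
    have := (((hWi l i j).sub ((hFi l i j).smul ((s * v l : ℝ) : ℂ))).mul_const (b l)).smul
      ((n : ℂ)⁻¹ * s)
    exact this
  have heq : ∫ ω, (z • meanResolvent B z n (x ω) - 1 - meanResolvent B z n (x ω) *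
        covarianceMap B v (meanResolvent B z n (x ω))) ∂P
      = ∑ l, ∑ i, ∑ j, ((n : ℂ)⁻¹ * s) •
        ((∫ ω, W l i j ω ∂P - ((s * v l : ℝ) : ℂ) • ∫ ω, F l i j ω ∂P) * b l) := by
    simp_rw [hpt]
    rw [integral_finsetSum _ fun l _ => integrable_finsetSum _ fun i _ =>
      integrable_finsetSum _ fun j _ => hint l i j]
    refine Finset.sum_congr rfl fun l _ => ?_
    rw [integral_finsetSum _ fun i _ => integrable_finsetSum _ fun j _ => hint l i j]
    refine Finset.sum_congr rfl fun i _ => ?_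
    rw [integral_finsetSum _ fun j _ => hint l i j]
    refine Finset.sum_congr rfl fun j _ => ?_
    have i1 : Integrable (fun ω => ((s * v l : ℝ) : ℂ) • F l i j ω) P := (hFi l i j).fun_smul _
    have i2 : Integrable (fun ω => W l i j ω - ((s * v l : ℝ) : ℂ) • F l i j ω) P :=
      (hWi l i j).sub i1
    rw [integral_smul, integral_mul_const_of_integrable i2, integral_sub (hWi l i j) i1,
      integral_smul]
  rw [heq]
  set C1 : Fin h → ℝ := fun l => 4 * κ ^ 3 * ‖b l‖ ^ 2 * (1 + 2 * v l) * m with hC1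
  have hC1' : ∀ l, 0 ≤ C1 l := fun l => by positivity
  have hest : ∀ l i j, ‖∫ ω, W l i j ω ∂P - ((s * v l : ℝ) : ℂ) • ∫ ω, F l i j ω ∂P‖
      ≤ v l * ‖b l‖ * ∫ ω, ‖resolventBlock B z n j i (x ω)‖ ^ 2 ∂P + s ^ 2 * C1 l
        + if j = i then m * κ + v l * κ ^ 2 * ‖b l‖ else 0 := by
    intro l i j
    have hI : 0 ≤ ∫ ω, ‖resolventBlock B z n j i (x ω)‖ ^ 2 ∂P :=
      integral_nonneg fun _ => by positivity
    -- Diagonal entries need not be centred, so they are bounded crudely through the first moment;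
    -- there are only `n` of them for each letter.
    by_cases hij : j = i
    · rw [if_pos hij]
      have h1 : ‖∫ ω, W l i j ω ∂P‖ ≤ m * κ := by
        calc _ ≤ ∫ ω, ‖hermEntry (x ω) l i j‖ * κ ∂P := by
              refine norm_integral_le_of_norm_le
                ((hY.integrable_hermEntry l i j).norm.mul_const κ) (Eventually.of_forall fun ω => ?_)
              rw [hW, norm_smul]
              gcongr
              exact hκ _ _ _
          _ = (∫ ω, ‖hermEntry (x ω) l i j‖ ∂P) * κ := integral_mul_const _ _
          _ ≤ m * κ := by
              gcongr
              exact hY.integral_norm_hermEntry_le l i j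
      have h2 : ‖((s * v l : ℝ) : ℂ) • ∫ ω, F l i j ω ∂P‖ ≤ v l * κ ^ 2 * ‖b l‖ := by
        rw [norm_smul, Complex.norm_real, Real.norm_of_nonneg (by positivity)]
        have h3 : ‖∫ ω, F l i j ω ∂P‖ ≤ κ * ‖b l‖ * κ := by
          have := norm_integral_le_of_norm_le_const (μ := P) (Eventually.of_forall (hFn l i j))
          simpa using this
        calc s * v l * ‖∫ ω, F l i j ω ∂P‖ ≤ 1 * v l * (κ * ‖b l‖ * κ) := by gcongr
          _ = _ := by ring
      have h4 := norm_sub_le (∫ ω, W l i j ω ∂P) (((s * v l : ℝ) : ℂ) • ∫ ω, F l i j ω ∂P)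
      have h5 : 0 ≤ v l * ‖b l‖ * ∫ ω, ‖resolventBlock B z n j i (x ω)‖ ^ 2 ∂P + s ^ 2 * C1 l := by
        have := hC1' l
        positivity
      linarith
    · rw [if_neg hij, add_zero]
      refine (norm_integral_hermEntry_smul_sub_le hY hB hz l (Ne.symm hij)).trans ?_
      gcongr
      calc s * v l ≤ 1 * v l := by gcongr
        _ = v l := one_mul _
  -- All `n ^ 2` blocks together contribute order `n`, by the Hilbert-Schmidt bound.
  have hsq : ∑ i : Fin n, ∑ j : Fin n, ∫ ω, ‖resolventBlock B z n j i (x ω)‖ ^ 2 ∂P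
      ≤ n * (k ^ 3 * |z.im|⁻¹ ^ 2) := by
    have i1 : ∀ i j : Fin n, Integrable (fun ω => ‖resolventBlock B z n j i (x ω)‖ ^ 2) P := by
      intro i j
      refine integrable_comp_of_continuous (F := fun x => ‖resolventBlock B z n j i x‖ ^ 2)
        ((hcont j i).norm.pow 2) (C := κ ^ 2) (fun x => ?_) hxm
      rw [Real.norm_of_nonneg (by positivity)]
      gcongr
      exact hκ _ _ _
    simp_rw [← integral_finsetSum Finset.univ fun j _ => i1 _ j]
    rw [← integral_finsetSum _ fun i _ => integrable_finsetSum _ fun j _ => i1 i j]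
    have : ∀ ω, ∑ i : Fin n, ∑ j : Fin n, ‖resolventBlock B z n j i (x ω)‖ ^ 2
        ≤ n * (k ^ 3 * |z.im|⁻¹ ^ 2) := by
      intro ω
      rw [Finset.sum_comm]
      refine (sum_norm_sq_innerBlock_le (blockResolvent B z n (x ω))).trans ?_
      have := norm_blockResolvent_le (n := n) hB hz (x ω)
      calc (k : ℝ) ^ 3 * n * ‖blockResolvent B z n (x ω)‖ ^ 2
          ≤ (k : ℝ) ^ 3 * n * |z.im|⁻¹ ^ 2 := by gcongr
        _ = _ := by ring
    refine (integral_mono (integrable_finsetSum _ fun i _ => integrable_finsetSum _ fun j _ =>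
      i1 i j) (integrable_const _) this).trans ?_
    simp
  refine (norm_sum_le _ _).trans ?_
  rw [dysonConstant, Finset.mul_sum]
  refine Finset.sum_le_sum fun l _ => ?_
  calc ‖∑ i, ∑ j, ((n : ℂ)⁻¹ * s) •
        ((∫ ω, W l i j ω ∂P - ((s * v l : ℝ) : ℂ) • ∫ ω, F l i j ω ∂P) * b l)‖
      ≤ ∑ i, ∑ j, ((n : ℝ)⁻¹ * s) * ((v l * ‖b l‖ * ∫ ω, ‖resolventBlock B z n j i (x ω)‖ ^ 2 ∂P
        + s ^ 2 * C1 l + if j = i then m * κ + v l * κ ^ 2 * ‖b l‖ else 0) * ‖b l‖) := by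
        refine norm_sum_le_of_le _ fun i _ => norm_sum_le_of_le _ fun j _ => ?_
        rw [norm_smul, norm_mul, norm_inv, Complex.norm_natCast, Complex.norm_real,
          Real.norm_of_nonneg hs0]
        gcongr
        refine (norm_mul_le _ _).trans ?_
        gcongr
        exact hest l i j
    _ = ((n : ℝ)⁻¹ * s) * ((v l * ‖b l‖ *
          ∑ i : Fin n, ∑ j : Fin n, ∫ ω, ‖resolventBlock B z n j i (x ω)‖ ^ 2 ∂P
        + n * (s ^ 2 * n) * C1 l + n * (m * κ + v l * κ ^ 2 * ‖b l‖)) * ‖b l‖) := by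
        simp_rw [← Finset.mul_sum, ← Finset.sum_mul, Finset.sum_add_distrib, ← Finset.mul_sum]
        simp only [Finset.sum_ite_eq', Finset.mem_univ, if_true, Finset.sum_const,
          Finset.card_univ, Fintype.card_fin, nsmul_eq_mul]
        ring
    _ ≤ ((n : ℝ)⁻¹ * s) * ((v l * ‖b l‖ * (n * (k ^ 3 * |z.im|⁻¹ ^ 2))
        + n * 1 * C1 l + n * (m * κ + v l * κ ^ 2 * ‖b l‖)) * ‖b l‖) := by
        rw [hsn]
        gcongr
    _ = ((n : ℝ)⁻¹ * n) * (s * (‖b l‖ * (v l * ‖b l‖ * (k ^ 3 * |z.im|⁻¹ ^ 2)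
        + C1 l + (m * κ + v l * κ ^ 2 * ‖b l‖)))) := by ring
    _ = _ := by
        rw [inv_mul_cancel₀ (by positivity), one_mul]

end Dyson

end

noncomputable section

/-! ### Concentration and almost sure convergence of the partial trace of the resolvent -/

section Concentration

open scoped Matrix.Norms.L2Operator
open Matrix

variable {Ω : Type*} [MeasurableSpace Ω] {k h n : ℕ}

/-- The family with the given rows of index less than `n`, all other entries being zero. -/
def ofRows (n : ℕ) (r : Fin n → Fin h × ℕ → ℂ) : ℕ × Fin h × ℕ → ℂ :=
  fun e => if he : e.1 < n then r ⟨e.1, he⟩ e.2 else 0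

lemma measurable_ofRows (n : ℕ) : Measurable (ofRows n : (Fin n → Fin h × ℕ → ℂ) → _) := by
  refine measurable_pi_lambda _ fun e => ?_
  unfold ofRows
  by_cases he : e.1 < n
  · simp only [he, dif_pos]
    fun_prop
  · simp [he]

lemma hermEntry_congr {x y : ℕ × Fin h × ℕ → ℂ} {l : Fin h} {i j : ℕ}
    (hxy : ∀ a d, a = i ∨ a = j → x (a, l, d) = y (a, l, d)) :
    hermEntry x l i j = hermEntry y l i j := by
  unfold hermEntry
  rw [hxy i _ (Or.inl rfl), hxy j _ (Or.inr rfl), hxy i 0 (Or.inl rfl)]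

/-- The `n`-th matrix involves only rows of index below `n`, so the partial trace is a function of
`n` independent rows. -/
lemma meanResolvent_ofRows (B : Matrix (Fin k) (Fin k) (Fin h)) (z : ℂ) (n : ℕ)
    (x : ℕ × Fin h × ℕ → ℂ) :
    meanResolvent B z n (ofRows n fun i e => x (i, e)) = meanResolvent B z n x := by
  have : hermBlock B n (ofRows n fun i e => x (i, e)) = hermBlock B n x := by
    ext ⟨p, i⟩ ⟨q, j⟩
    rw [hermBlock_apply, hermBlock_apply]
    congr 1
    refine hermEntry_congr fun a d ha => ?_
    have : a < n := by rcases ha with rfl | rfl <;> exact Fin.is_lt _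
    simp [ofRows, this]
  simp only [meanResolvent, blockResolvent, this]

/-- Writing an entry as a trace against a fixed contraction makes the rank perturbation bound
applicable. -/
lemma meanResolvent_apply (B : Matrix (Fin k) (Fin k) (Fin h)) (z : ℂ) (n : ℕ)
    (x : ℕ × Fin h × ℕ → ℂ) (p q : Fin k) : meanResolvent B z n x p q
      = (n : ℂ)⁻¹ * (kroneckerMap (· * ·) (Matrix.single q p (1 : ℂ)) (1 : Matrix (Fin n) (Fin n) ℂ)
        * blockResolvent B z n x).trace := by
  rw [meanResolvent, partialTrace, Matrix.smul_apply, smul_eq_mul]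
  congr 1
  simp [Matrix.sum_apply, Matrix.trace, Matrix.mul_apply, Fintype.sum_prod_type, innerBlock,
    Matrix.one_apply, Matrix.single_apply, ite_and]

lemma norm_kronecker_single_one_le (p q : Fin k) (n : ℕ) :
    ‖kroneckerMap (· * ·) (Matrix.single q p (1 : ℂ)) (1 : Matrix (Fin n) (Fin n) ℂ)‖ ≤ 1 := by
  set Q := kroneckerMap (· * ·) (Matrix.single q p (1 : ℂ)) (1 : Matrix (Fin n) (Fin n) ℂ) with hQ
  have h1 : Qᴴ * Q = diagonal fun a : Fin k × Fin n => if a.1 = p then (1 : ℂ) else 0 := by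
    ext ⟨a, i⟩ ⟨c, j⟩
    simp only [hQ, Matrix.mul_apply, Fintype.sum_prod_type, conjTranspose_apply, kroneckerMap_apply,
      Matrix.single_apply, Matrix.one_apply, diagonal_apply, Prod.mk.injEq]
    by_cases h1 : p = a
    · subst h1
      by_cases h2 : p = c
      · subst h2
        simp [eq_comm]
      · simp [h2]
    · simp [h1, Ne.symm h1, ite_and, eq_comm]
  have h2 : ‖Q‖ * ‖Q‖ ≤ 1 * 1 := by
    rw [← l2_opNorm_conjTranspose_mul_self, h1, l2_opNorm_diagonal, mul_one]
    refine (pi_norm_le_iff_of_nonneg zero_le_one).2 fun a => ?_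
    split_ifs <;> simp
  exact (mul_self_le_mul_self_iff (norm_nonneg _) zero_le_one).2 h2

variable {B : Matrix (Fin k) (Fin k) (Fin h)} {z : ℂ}

/-- Row `i` of the upper triangles meets only the rows and columns with the `k` indices `(p, i)`.
The rank bound then applies with `|S| = k`, and the normalization supplies the factor `1 / n`. -/
lemma norm_meanResolvent_sub_update_le (hB : B.IsSymm) (hz : z.im ≠ 0) (n : ℕ)
    (r : Fin n → Fin h × ℕ → ℂ) (i : Fin n) (y : Fin h × ℕ → ℂ) (p q : Fin k) :
    ‖meanResolvent B z n (ofRows n r) p q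
      - meanResolvent B z n (ofRows n (Function.update r i y)) p q‖ ≤ 4 * k * |z.im|⁻¹ / n := by
  rw [meanResolvent_apply, meanResolvent_apply, ← mul_sub, norm_mul, norm_inv,
    Complex.norm_natCast, div_eq_inv_mul]
  gcongr
  have h1 := norm_trace_mul_resolvent_sub_le (hermBlock_isHermitian hB n (ofRows n r))
    (hermBlock_isHermitian hB n (ofRows n (Function.update r i y))) hz
    (Finset.univ.map ⟨fun p : Fin k => (p, i), fun _ _ h => (Prod.mk.inj h).1⟩) (fun a c ha hc => ?_)
    (norm_kronecker_single_one_le p q n)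
  · simpa [blockResolvent] using h1
  · have ha' : a.2 ≠ i := by
      rintro rfl
      exact ha (Finset.mem_map.2 ⟨a.1, Finset.mem_univ _, rfl⟩)
    have hc' : c.2 ≠ i := by
      rintro rfl
      exact hc (Finset.mem_map.2 ⟨c.1, Finset.mem_univ _, rfl⟩)
    obtain ⟨a, a'⟩ := a
    obtain ⟨c, c'⟩ := c
    rw [hermBlock_apply, hermBlock_apply]
    congr 1
    refine hermEntry_congr fun e d he => ?_
    have hne : ∀ hen : e < n, (⟨e, hen⟩ : Fin n) ≠ i := by
      rintro hen rfl
      rcases he with he | he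
      · exact ha' (Fin.ext he.symm)
      · exact hc' (Fin.ext he.symm)
    unfold ofRows
    split_ifs with hen
    · rw [Function.update_of_ne (hne hen)]
    · rfl

variable {P : Measure Ω} [IsProbabilityMeasure P] {Y : ℕ × Fin h × ℕ → Ω → ℂ} {v : Fin h → ℝ≥0}
  {m : ℝ}

lemma integrable_meanResolvent (hY : IsUpperFamily Y v m P) (hB : B.IsSymm) (hz : z.im ≠ 0)
    (n : ℕ) : Integrable (fun ω => meanResolvent B z n fun e => Y e ω) P :=
  integrable_comp_of_continuous (continuous_meanResolvent hB hz n)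
    (norm_meanResolvent_le hB hz n) hY.measurable_pi

/-- McDiarmid's inequality concerns real functions; it is applied with `φ` the real and the
imaginary part. -/
lemma ae_tendsto_clm_meanResolvent_sub (hY : IsUpperFamily Y v m P) (hB : B.IsSymm)
    (hz : z.im ≠ 0) (p q : Fin k) (φ : ℂ →L[ℝ] ℝ) (hφ : ‖φ‖ ≤ 1) :
    ∀ᵐ ω ∂P, Tendsto (fun n => φ (meanResolvent B z n (fun e => Y e ω) p q)
      - ∫ ω, φ (meanResolvent B z n (fun e => Y e ω) p q) ∂P) atTop (𝓝 0) := by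
  have hk : (0 : ℝ) < k := by exact_mod_cast (Fin.pos p)
  have hφ' : ∀ w, |φ w| ≤ ‖w‖ := fun w => (φ.le_opNorm w).trans (by
    have := norm_nonneg w
    nlinarith)
  have h1 := ae_tendsto_sub_integral_of_bounded_differences (P := P)
    (R := fun i ω (e : Fin h × ℕ) => Y (i, e) ω)
    (fun i => measurable_pi_lambda _ fun e => hY.measurable _)
    (iIndepFun.curry hY.measurable hY.indep)
    (f := fun n r => φ (meanResolvent B z n (ofRows n r) p q))
    (fun n => φ.continuous.measurable.comp
      (((continuous_meanResolvent hB hz n).matrix_elem p q).measurable.comp (measurable_ofRows n)))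
    (C := 4 * k * |z.im|⁻¹) (b := k ^ 2 * |z.im|⁻¹)
    (by have := inv_pos.2 (abs_pos.2 hz); positivity)
    (fun n r => (hφ' _).trans ((Matrix.norm_apply_le _ _ _).trans
      (norm_meanResolvent_le hB hz n _)))
    (fun n r i y => by
      rw [← map_sub]
      exact (hφ' _).trans (norm_meanResolvent_sub_update_le hB hz n r i y p q))
  have h2 : ∀ n ω, meanResolvent B z n (ofRows n fun i e => Y (i, e) ω)
      = meanResolvent B z n fun e => Y e ω := fun n ω => meanResolvent_ofRows B z n fun e => Y e ω
  simpa only [h2] using h1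

lemma ae_tendsto_meanResolvent_sub_integral (hY : IsUpperFamily Y v m P) (hB : B.IsSymm)
    (hz : z.im ≠ 0) :
    ∀ᵐ ω ∂P, Tendsto (fun n => meanResolvent B z n (fun e => Y e ω)
      - ∫ ω, meanResolvent B z n (fun e => Y e ω) ∂P) atTop (𝓝 0) := by
  have h1 : ∀ᵐ ω ∂P, ∀ p q, Tendsto (fun n => meanResolvent B z n (fun e => Y e ω) p q
      - ∫ ω, meanResolvent B z n (fun e => Y e ω) p q ∂P) atTop (𝓝 0) := by
    refine ae_all_iff.2 fun p => ae_all_iff.2 fun q => ?_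
    have hi : ∀ n, Integrable (fun ω => meanResolvent B z n (fun e => Y e ω) p q) P := fun n =>
      integrable_comp_of_continuous (F := fun x => meanResolvent B z n x p q)
        ((continuous_meanResolvent hB hz n).matrix_elem p q)
        (fun x => (Matrix.norm_apply_le _ _ _).trans (norm_meanResolvent_le hB hz n x))
        hY.measurable_pi
    filter_upwards [ae_tendsto_clm_meanResolvent_sub hY hB hz p q Complex.reCLM
        Complex.reCLM_norm.le,
      ae_tendsto_clm_meanResolvent_sub hY hB hz p q Complex.imCLM Complex.imCLM_norm.le] with ω h1 h2
    simp_rw [ContinuousLinearMap.integral_comp_comm _ (hi _), ← map_sub] at h1 h2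
    have h3 := (Complex.continuous_ofReal.tendsto 0).comp h1
    have h4 := (Complex.continuous_ofReal.tendsto 0).comp h2
    have h5 := h3.add (h4.mul_const Complex.I)
    simp only [Complex.ofReal_zero, zero_mul, add_zero] at h5
    refine h5.congr fun n => ?_
    simp only [Function.comp_apply, Complex.reCLM_apply, Complex.imCLM_apply]
    exact Complex.re_add_im _
  filter_upwards [h1] with ω hω
  refine tendsto_pi_nhds.2 fun p => tendsto_pi_nhds.2 fun q => ?_
  refine (hω p q).congr fun n => ?_
  rw [Matrix.sub_apply]
  congr 1
  let L : Matrix (Fin k) (Fin k) ℂ →L[ℂ] ℂ := ⟨Matrix.entryLinearMap ℂ ℂ p q,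
    continuous_id.matrix_elem p q⟩
  exact L.integral_comp_comm (integrable_meanResolvent hY hB hz n)

/-- Stability of the Dyson equation for large spectral parameters. -/
lemma norm_sub_le_of_dyson {D G : Matrix (Fin k) (Fin k) ℂ} {κ : ℝ} (hD : ‖D‖ ≤ κ) (hG : ‖G‖ ≤ κ)
    (hGD : z • G = 1 + G * covarianceMap B v G) :
    (‖z‖ - 2 * κ * covarianceBound B v) * ‖D - G‖ ≤ ‖z • D - 1 - D * covarianceMap B v D‖ := by
  have hc := covarianceBound_nonneg B v
  have h1 : z • (D - G) = (z • D - 1 - D * covarianceMap B v D) + (D - G) * covarianceMap B v D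
      + G * covarianceMap B v (D - G) := by
    rw [smul_sub, hGD, map_sub, mul_sub, sub_mul]
    abel
  have h2 := congrArg norm h1
  rw [norm_smul] at h2
  have h3 : ‖(D - G) * covarianceMap B v D‖ ≤ ‖D - G‖ * (covarianceBound B v * κ) := by
    refine (norm_mul_le _ _).trans ?_
    gcongr
    exact (norm_covarianceMap_le _ _ _).trans (by gcongr)
  have h4 : ‖G * covarianceMap B v (D - G)‖ ≤ κ * (covarianceBound B v * ‖D - G‖) := by
    refine (norm_mul_le _ _).trans ?_
    gcongr
    · exact (norm_nonneg _).trans hG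
    · exact norm_covarianceMap_le _ _ _
  have h5 := norm_add₃_le (a := z • D - 1 - D * covarianceMap B v D)
    (b := (D - G) * covarianceMap B v D) (c := G * covarianceMap B v (D - G))
  linarith

/-- Concentration reduces the claim to the means `D n`. These solve the Dyson equation up to the
error of the expected equation and a covariance term, both tending to `0`, and stability forces `D
n` to approach `G`. The constant `K` supplies a common bound for the random and the limiting
transforms. -/
theorem ae_tendsto_meanResolvent (hY : IsUpperFamily Y v m P) (hB : B.IsSymm) (hz : z.im ≠ 0)
    (hm : 0 ≤ m) {G : Matrix (Fin k) (Fin k) ℂ} {K : ℝ} (hK : k ^ 2 ≤ K)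
    (hG : ‖G‖ ≤ K * |z.im|⁻¹) (hGD : z • G = 1 + G * covarianceMap B v G)
    (hlarge : 2 * (K * |z.im|⁻¹) * covarianceBound B v < ‖z‖) :
    ∀ᵐ ω ∂P, Tendsto (fun n => meanResolvent B z n fun e => Y e ω) atTop (𝓝 G) := by
  set c := covarianceBound B v
  have hc : 0 ≤ c := covarianceBound_nonneg B v
  set κ := K * |z.im|⁻¹ with hκdef
  have hκ0 : 0 ≤ κ := (norm_nonneg _).trans hG
  set g : ℕ → Ω → Matrix (Fin k) (Fin k) ℂ := fun n ω => meanResolvent B z n fun e => Y e ω with hg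
  have hgκ : ∀ n ω, ‖g n ω‖ ≤ κ := fun n ω => (norm_meanResolvent_le hB hz n _).trans (by
    rw [hκdef]
    gcongr)
  have hgi : ∀ n, Integrable (g n) P := integrable_meanResolvent hY hB hz
  set D : ℕ → Matrix (Fin k) (Fin k) ℂ := fun n => ∫ ω, g n ω ∂P with hD
  have hDκ : ∀ n, ‖D n‖ ≤ κ := fun n => by
    have := norm_integral_le_of_norm_le_const (μ := P) (Eventually.of_forall (hgκ n))
    simpa using this
  have hconc : ∀ᵐ ω ∂P, Tendsto (fun n => g n ω - D n) atTop (𝓝 0) :=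
    ae_tendsto_meanResolvent_sub_integral hY hB hz
  set η := covarianceMap B v with hη
  have hηc : Continuous η := η.continuous_of_finiteDimensional
  have hηn : ∀ A, ‖η A‖ ≤ c * ‖A‖ := norm_covarianceMap_le B v
  have hprod : ∀ n, Integrable (fun ω => g n ω * η (g n ω)) P := by
    intro n
    refine Integrable.of_bound (C := κ * (c * κ)) ?_ (Eventually.of_forall fun ω => ?_)
    · exact (continuous_id.mul hηc).comp_aestronglyMeasurable (hgi n).aestronglyMeasurable
    · refine (norm_mul_le _ _).trans ?_
      gcongr
      · exact hgκ n ω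
      · exact (hηn _).trans (by gcongr; exact hgκ n ω)
  set V : ℕ → Ω → Matrix (Fin k) (Fin k) ℂ := fun n ω => (g n ω - D n) * η (g n ω - D n) with hV
  have hVn : ∀ n ω, ‖V n ω‖ ≤ (2 * κ) * (c * (2 * κ)) := by
    intro n ω
    have h1 : ‖g n ω - D n‖ ≤ 2 * κ := (norm_sub_le _ _).trans (by linarith [hgκ n ω, hDκ n])
    refine (norm_mul_le _ _).trans ?_
    gcongr
    exact (hηn _).trans (by gcongr)
  have hVm : ∀ n, AEStronglyMeasurable (V n) P := fun n =>
    (continuous_id.mul hηc).comp_aestronglyMeasurable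
      ((hgi n).aestronglyMeasurable.sub aestronglyMeasurable_const)
  have hVi : ∀ n, Integrable (V n) P := fun n =>
    Integrable.of_bound (hVm n) _ (Eventually.of_forall (hVn n))
  -- Almost sure concentration and the uniform bound give this by dominated convergence; no rate for
  -- the variance is needed.
  have hV0 : Tendsto (fun n => ∫ ω, V n ω ∂P) atTop (𝓝 0) := by
    have h1 := tendsto_integral_of_dominated_convergence (μ := P) (F := V) (f := fun _ => 0)
      (fun _ => (2 * κ) * (c * (2 * κ))) hVm (integrable_const _)
      (fun n => Eventually.of_forall (hVn n)) (by
        filter_upwards [hconc] with ω hω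
        have h2 := hω.mul ((hηc.tendsto 0).comp hω)
        rwa [map_zero, mul_zero] at h2)
    simpa using h1
  -- Expand about the mean: the cross terms vanish after integration, leaving the covariance.
  have hcov : ∀ n, ∫ ω, g n ω * η (g n ω) ∂P = D n * η (D n) + ∫ ω, V n ω ∂P := by
    intro n
    let Lη : Matrix (Fin k) (Fin k) ℂ →L[ℂ] Matrix (Fin k) (Fin k) ℂ := ⟨η, hηc⟩
    have h1 : ∀ ω, g n ω * η (g n ω)
        = V n ω + D n * Lη (g n ω) + g n ω * η (D n) - D n * η (D n) := by
      intro ω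
      change _ = (g n ω - D n) * η (g n ω - D n) + D n * η (g n ω) + _ - _
      rw [map_sub]
      noncomm_ring
    have i2 : Integrable (fun ω => D n * Lη (g n ω)) P :=
      (Lη.integrable_comp (hgi n)).const_mul (D n)
    have i3 : Integrable (fun ω => g n ω * η (D n)) P := (hgi n).mul_const _
    have i12 : Integrable (fun ω => V n ω + D n * Lη (g n ω)) P := (hVi n).add i2
    have i123 : Integrable (fun ω => V n ω + D n * Lη (g n ω) + g n ω * η (D n)) P := i12.add i3
    simp_rw [h1]
    rw [integral_sub i123 (integrable_const _), integral_add i12 i3, integral_add (hVi n) i2,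
      integral_mul_const_of_integrable (hgi n),
      integral_const_mul_of_integrable (Lη.integrable_comp (hgi n)), Lη.integral_comp_comm (hgi n)]
    have h2 : Lη (∫ ω, g n ω ∂P) = η (D n) := rfl
    rw [h2, integral_const]
    simp only [probReal_univ, one_smul]
    abel
  have hε : Tendsto (fun n => z • D n - 1 - D n * η (D n)) atTop (𝓝 0) := by
    have h1 : Tendsto (fun n => ∫ ω, (z • g n ω - 1 - g n ω * η (g n ω)) ∂P) atTop (𝓝 0) := by
      refine squeeze_zero_norm' (a := fun n : ℕ => (√(n : ℝ))⁻¹ * dysonConstant B v m z) ?_ ?_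
      · filter_upwards [eventually_ne_atTop 0] with n hn
        exact norm_integral_dyson_le hY hB hz hn hm
      · have h2 : Tendsto (fun n : ℕ => (√(n : ℝ))⁻¹) atTop (𝓝 0) :=
          tendsto_inv_atTop_zero.comp (Real.tendsto_sqrt_atTop.comp tendsto_natCast_atTop_atTop)
        simpa using h2.mul_const (dysonConstant B v m z)
    have h2 := h1.add hV0
    rw [add_zero] at h2
    refine h2.congr fun n => ?_
    have i1 : Integrable (fun ω => z • g n ω) P := (hgi n).fun_smul z
    have i2 : Integrable (fun ω => z • g n ω - 1) P := i1.sub (integrable_const _)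
    rw [integral_sub i2 (hprod n), integral_sub i1 (integrable_const _), integral_smul, hcov,
      integral_const]
    simp only [probReal_univ, one_smul]
    abel
  have hDG : Tendsto (fun n => D n - G) atTop (𝓝 0) := by
    have hpos : 0 < ‖z‖ - 2 * κ * c := by linarith
    refine squeeze_zero_norm
      (a := fun n => (‖z‖ - 2 * κ * c)⁻¹ * ‖z • D n - 1 - D n * η (D n)‖) (fun n => ?_) ?_
    · rw [← div_eq_inv_mul, le_div_iff₀' hpos]
      exact norm_sub_le_of_dyson (hDκ n) hG hGD
    · simpa using hε.norm.const_mul (‖z‖ - 2 * κ * c)⁻¹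
  filter_upwards [hconc] with ω hω
  have h1 := (hω.add hDG).add_const G
  simpa using h1

end Concentration

end

noncomputable section

/-! ### Convergence of the spectral measures of Wigner block matrices -/

section Wigner

open scoped Matrix.Norms.L2Operator
open Matrix

variable {Ω : Type*} [MeasurableSpace Ω] {P : Measure Ω} {k h : ℕ}
  {X : Fin h → ℕ → ℕ → Ω → ℂ} {v : Fin h → ℝ≥0}

/-- A bound for the moments of the entries of a family of Wigner arrays. -/
def momentBound (X : Fin h → ℕ → ℕ → Ω → ℂ) (P : Measure Ω) : ℝ :=
  ∑ l, (∫ ω, ‖X l 0 1 ω‖ ∂P + ∫ ω, ‖X l 0 0 ω‖ ∂P + ∫ ω, ‖X l 0 1 ω‖ ^ 3 ∂P)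

lemma momentBound_summand_nonneg (X : Fin h → ℕ → ℕ → Ω → ℂ) (P : Measure Ω) (l : Fin h) :
    0 ≤ ∫ ω, ‖X l 0 1 ω‖ ∂P + ∫ ω, ‖X l 0 0 ω‖ ∂P + ∫ ω, ‖X l 0 1 ω‖ ^ 3 ∂P :=
  add_nonneg (add_nonneg (integral_nonneg fun _ => norm_nonneg _)
    (integral_nonneg fun _ => norm_nonneg _)) (integral_nonneg fun _ => by positivity)

lemma momentBound_nonneg (X : Fin h → ℕ → ℕ → Ω → ℂ) (P : Measure Ω) : 0 ≤ momentBound X P :=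
  Finset.sum_nonneg fun l _ => momentBound_summand_nonneg X P l

lemma le_momentBound (X : Fin h → ℕ → ℕ → Ω → ℂ) (P : Measure Ω) (l : Fin h) :
    ∫ ω, ‖X l 0 1 ω‖ ∂P + ∫ ω, ‖X l 0 0 ω‖ ∂P + ∫ ω, ‖X l 0 1 ω‖ ^ 3 ∂P ≤ momentBound X P :=
  Finset.single_le_sum (fun l _ => momentBound_summand_nonneg X P l) (Finset.mem_univ l)

/-- On the diagonal this uses that Hermitian symmetry makes `X l j j ω` real. -/
lemma hermBlock_upperEntries (hX : ∀ l, IsWignerArray (X l) (v l) P)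
    (B : Matrix (Fin k) (Fin k) (Fin h)) (n : ℕ) (ω : Ω) :
    hermBlock B n (fun e => upperEntries X e ω) = blockMatrix B fun l => wignerMatrix (X l) n ω := by
  unfold hermBlock
  congr 1
  funext l
  ext i j
  simp only [wignerMatrix, of_apply]
  congr 1
  unfold hermEntry
  split_ifs with h1 h2
  · simp [upperEntries, h1.le]
  · simp [upperEntries, h2.le, (hX l).hermitian j i]
  · have h3 : (i : ℕ) = j := by omega
    simp only [upperEntries, h3, add_zero]
    have h4 := (hX l).hermitian j j ω
    exact Complex.conj_eq_iff_re.1 h4.symm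

variable [IsProbabilityMeasure P]

lemma isUpperFamily_upperEntries (hX : ∀ l, IsWignerArray (X l) (v l) P)
    (hind : iIndepFun (fun l ω (p : ℕ × ℕ) => X l p.1 p.2 ω) P)
    (h4 : ∀ l, MemLp (X l 0 1) 4 P) (h2 : ∀ l, MemLp (X l 0 0) 2 P) :
    IsUpperFamily (upperEntries X) v (momentBound X P) P := by
  have hup : ∀ i l d, d ≠ 0 → IdentDistrib (upperEntries X (i, l, d)) (X l 0 1) P P :=
    fun i l d hd => (hX l).identDistrib_upper _ _ (by simp; omega)
  have hdiag : ∀ i l, IdentDistrib (upperEntries X (i, l, 0)) (X l 0 0) P P :=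
    fun i l => (hX l).identDistrib_diag i
  have n1 : ∀ l, 0 ≤ ∫ ω, ‖X l 0 1 ω‖ ∂P := fun l => integral_nonneg fun _ => norm_nonneg _
  have n2 : ∀ l, 0 ≤ ∫ ω, ‖X l 0 0 ω‖ ∂P := fun l => integral_nonneg fun _ => norm_nonneg _
  have n3 : ∀ l, 0 ≤ ∫ ω, ‖X l 0 1 ω‖ ^ 3 ∂P := fun l => integral_nonneg fun _ => by positivity
  refine ⟨measurable_upperEntries hX, iIndepFun_upperEntries hX hind, ?_, ?_, ?_, ?_, ?_, ?_⟩
  · rintro ⟨i, l, d⟩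
    by_cases hd : d = 0
    · subst hd
      exact (hdiag i l).integrable_iff.2 ((h2 l).integrable (by norm_num))
    · exact (hup i l d hd).integrable_iff.2 ((h4 l).integrable (by norm_num))
  · rintro ⟨i, l, d⟩
    refine le_trans ?_ (le_momentBound X P l)
    by_cases hd : d = 0
    · subst hd
      rw [(hdiag i l).norm.integral_eq]
      linarith [n1 l, n3 l]
    · rw [(hup i l d hd).norm.integral_eq]
      linarith [n2 l, n3 l]
  · intro i l d hd
    rw [(hup i l d hd).integral_eq, (hX l).mean_upper]
  · intro i l d hd
    rw [← (hX l).variance_upper]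
    exact ((hup i l d hd).comp (u := fun w : ℂ => ‖w‖ ^ 2) (by fun_prop)).integral_eq
  · intro i l d hd
    have h3 : IdentDistrib (fun ω => ‖upperEntries X (i, l, d) ω‖ ^ 3) (fun ω => ‖X l 0 1 ω‖ ^ 3)
      P P := (hup i l d hd).comp (u := fun w : ℂ => ‖w‖ ^ 3) (by fun_prop)
    refine h3.integrable_iff.2 ?_
    exact ((h4 l).mono_exponent (p := 3) (by norm_num)).integrable_norm_pow (by norm_num)
  · intro i l d hd
    refine le_trans ?_ (le_momentBound X P l)
    have h3 : IdentDistrib (fun ω => ‖upperEntries X (i, l, d) ω‖ ^ 3) (fun ω => ‖X l 0 1 ω‖ ^ 3)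
      P P := (hup i l d hd).comp (u := fun w : ℂ => ‖w‖ ^ 3) (by fun_prop)
    rw [h3.integral_eq]
    linarith [n1 l, n2 l]

/-- The full normalized trace factors as `tr_k` of the partial trace. The shift to `n + 1` keeps the
index type nonempty. -/
lemma integral_spectralMeasure_hermBlock [NeZero k] {B : Matrix (Fin k) (Fin k) (Fin h)}
    {z : ℂ} (hz : z.im ≠ 0) (n : ℕ) (x : ℕ × Fin h × ℕ → ℂ)
    {M : Matrix (Fin k × Fin (n + 1)) (Fin k × Fin (n + 1)) ℂ} (hM : M.IsHermitian)
    (hMx : hermBlock B (n + 1) x = M) :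
    ∫ x : ℝ, (z - x)⁻¹ ∂(spectralMeasure M hM : Measure ℝ)
      = (k : ℂ)⁻¹ * (meanResolvent B z (n + 1) x).trace := by
  subst hMx
  rw [integral_spectralMeasure hM hz]
  simp only [Fintype.card_prod, Fintype.card_fin, meanResolvent, partialTrace, trace_smul,
    smul_eq_mul]
  rw [Nat.cast_mul, mul_inv, mul_assoc]
  congr 2
  rw [trace_sum]
  simp only [Matrix.trace, Fintype.sum_prod_type]
  exact Finset.sum_comm

theorem ae_tendsto_spectralMeasure [NeZero k] {B : Matrix (Fin k) (Fin k) (Fin h)} (hB : B.IsSymm)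
    (hX : ∀ l, IsWignerArray (X l) (v l) P)
    (hind : iIndepFun (fun l ω (p : ℕ × ℕ) => X l p.1 p.2 ω) P)
    (h4 : ∀ l, MemLp (X l 0 1) 4 P) (h2 : ∀ l, MemLp (X l 0 0) 2 P)
    {μ : ProbabilityMeasure ℝ} {G : ℝ → Matrix (Fin k) (Fin k) ℂ} {K y₀ : ℝ} (hK : k ^ 2 ≤ K)
    (hy₀ : 0 ≤ y₀) (hG : ∀ y, y₀ < y → ‖G y‖ ≤ K * |y|⁻¹)
    (hGD : ∀ y : ℝ, y₀ < y → (y * Complex.I) • G y = 1 + G y * covarianceMap B v (G y))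
    (hlarge : ∀ y, y₀ < y → 2 * (K * |y|⁻¹) * covarianceBound B v < |y|)
    (hμ : ∀ y : ℝ, y₀ < y → ∫ x : ℝ, ((y : ℂ) * Complex.I - x)⁻¹ ∂(μ : Measure ℝ)
      = (k : ℂ)⁻¹ * (G y).trace) :
    ∀ᵐ ω ∂P, Tendsto (fun n : ℕ => spectralMeasure
        (blockMatrix B fun l => wignerMatrix (X l) (n + 1) ω)
        (blockMatrix_isHermitian hB fun l => (hX l).isHermitian (n + 1) ω)) atTop (𝓝 μ) := by
  have hY := isUpperFamily_upperEntries hX hind h4 h2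
  have him : ∀ y : ℝ, ((y : ℂ) * Complex.I).im = y := fun y => by simp
  -- Rational spectral parameters permit one common almost sure event.
  have h1 : ∀ᵐ ω ∂P, ∀ q : ℚ, y₀ < q → Tendsto (fun n => meanResolvent B ((q : ℝ) * Complex.I) n
      fun e => upperEntries X e ω) atTop (𝓝 (G q)) := by
    refine ae_all_iff.2 fun q => ?_
    by_cases hq : y₀ < q
    · have hq0 : ((q : ℝ) : ℝ) ≠ 0 := (hy₀.trans_lt hq).ne'
      filter_upwards [ae_tendsto_meanResolvent hY hB (z := (q : ℝ) * Complex.I) (by rwa [him])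
        (momentBound_nonneg X P) hK (by rw [him]; exact hG q hq) (hGD q hq) (by
          rw [him]
          simpa using hlarge q hq)] with ω hω _ using hω
    · exact Eventually.of_forall fun ω h => absurd h hq
  filter_upwards [h1] with ω hω
  refine tendsto_of_tendsto_stieltjes (y₀ := y₀) fun q hq => ?_
  have hq0 : ((q : ℝ) : ℝ) ≠ 0 := (hy₀.trans_lt hq).ne'
  rw [hμ q hq]
  simp_rw [fun n => integral_spectralMeasure_hermBlock (z := (q : ℝ) * Complex.I)
    (by rwa [him]) n (fun e => upperEntries X e ω)
    (blockMatrix_isHermitian hB fun l => (hX l).isHermitian (n + 1) ω)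
    (hermBlock_upperEntries hX B (n + 1) ω)]
  have h3 : Continuous fun A : Matrix (Fin k) (Fin k) ℂ => (k : ℂ)⁻¹ * A.trace :=
    continuous_const.mul continuous_id.matrix_trace
  exact (h3.tendsto _).comp ((hω q hq).comp (tendsto_add_atTop_nat 1))

end Wigner

end

noncomputable section

/-! ### Full Fock space -/

section Shift

variable {ι : Type*}

open scoped Classical in
/-- The standard basis of `ℓ²(ι)`. -/
def stdVec (i : ι) : lp (fun _ : ι => ℂ) 2 := lp.single 2 i 1

lemma inner_stdVec (i : ι) (f : lp (fun _ : ι => ℂ) 2) : inner ℂ (stdVec i) f = f i := by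
  classical
  unfold stdVec
  convert! lp.inner_single_left (𝕜 := ℂ) i (1 : ℂ) f using 1
  simp

lemma stdVec_apply_self (i : ι) : stdVec i i = 1 := by
  classical
  simp [stdVec]

lemma stdVec_apply_ne {i j : ι} (hij : i ≠ j) : stdVec i j = 0 := by
  classical
  simp [stdVec, Ne.symm hij]

lemma orthonormal_stdVec : Orthonormal ℂ (stdVec : ι → lp (fun _ : ι => ℂ) 2) := by
  classical
  rw [orthonormal_iff_ite]
  intro i j
  rw [inner_stdVec]
  split_ifs with hij
  · subst hij
    exact stdVec_apply_self i
  · exact stdVec_apply_ne (Ne.symm hij)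

lemma ext_stdVec {E : Type*} [NormedAddCommGroup E] [NormedSpace ℂ E]
    {S T : lp (fun _ : ι => ℂ) 2 →L[ℂ] E} (hST : ∀ i, S (stdVec i) = T (stdVec i)) : S = T := by
  classical
  refine lp.ext_continuousLinearMap (p := 2) ENNReal.ofNat_ne_top fun i => ?_
  refine ContinuousLinearMap.ext_ring ?_
  convert! hST i using 2

/-- The isometry of `ℓ²(ι)` induced by an injective map of `ι`. -/
def shift (φ : ι → ι) (hφ : Function.Injective φ) :
    lp (fun _ : ι => ℂ) 2 →L[ℂ] lp (fun _ : ι => ℂ) 2 :=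
  ((orthonormal_stdVec (ι := ι)).comp φ hφ).orthogonalFamily.linearIsometry.toContinuousLinearMap

variable {φ : ι → ι} (hφ : Function.Injective φ)

lemma shift_stdVec (i : ι) : shift φ hφ (stdVec i) = stdVec (φ i) := by
  classical
  have := ((orthonormal_stdVec (ι := ι)).comp φ hφ).orthogonalFamily.linearIsometry_apply_single
    (i := i) 1
  simp only [LinearIsometry.toSpanSingleton_apply, one_smul, Function.comp_apply] at this
  convert! this using 1

lemma adjoint_shift_apply (f : lp (fun _ : ι => ℂ) 2) (i : ι) :
    ContinuousLinearMap.adjoint (shift φ hφ) f i = f (φ i) := by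
  rw [← inner_stdVec, ContinuousLinearMap.adjoint_inner_right, shift_stdVec, inner_stdVec]

lemma adjoint_shift_stdVec (i : ι) :
    ContinuousLinearMap.adjoint (shift φ hφ) (stdVec (φ i)) = stdVec i := by
  ext j
  rw [adjoint_shift_apply]
  by_cases hij : i = j
  · subst hij
    rw [stdVec_apply_self, stdVec_apply_self]
  · rw [stdVec_apply_ne hij, stdVec_apply_ne (hφ.ne hij)]

lemma adjoint_shift_stdVec_of_notMem {i : ι} (hi : ∀ j, φ j ≠ i) :
    ContinuousLinearMap.adjoint (shift φ hφ) (stdVec i) = 0 := by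
  ext j
  rw [adjoint_shift_apply, stdVec_apply_ne (hi j).symm]
  rfl

end Shift

/-! ### Creation operators and the vacuum state -/

section Fock

variable {J : Type*}

/-- The full Fock space over `ℓ²(J)`. -/
abbrev FockSpace (J : Type*) := lp (fun _ : List J => ℂ) 2

/-- The left creation operator. -/
def leftCreation (l : J) : FockSpace J →L[ℂ] FockSpace J :=
  shift (fun w => l :: w) List.cons_injective

/-- The right creation operator. -/
def rightCreation (l : J) : FockSpace J →L[ℂ] FockSpace J :=
  shift (fun w => w ++ [l]) (List.append_left_injective [l])

/-- The vacuum vector. -/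
def vacuum : FockSpace J := stdVec []

/-- The projection onto the vacuum vector. -/
def vacuumProjection : FockSpace J →L[ℂ] FockSpace J :=
  (innerSL ℂ (vacuum : FockSpace J)).smulRight vacuum

lemma vacuumProjection_apply (f : FockSpace J) :
    vacuumProjection f = inner ℂ vacuum f • vacuum := rfl

lemma norm_vacuum : ‖(vacuum : FockSpace J)‖ = 1 := orthonormal_stdVec.1 _

lemma star_leftCreation_mul_self (l : J) : star (leftCreation l) * leftCreation l = 1 := by
  refine ext_stdVec fun w => ?_
  rw [mul_apply_eq_comp, leftCreation, shift_stdVec,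
    ContinuousLinearMap.star_eq_adjoint, adjoint_shift_stdVec List.cons_injective w]
  rfl

lemma star_leftCreation_mul_of_ne {l m : J} (hlm : l ≠ m) :
    star (leftCreation l) * leftCreation m = 0 := by
  refine ext_stdVec fun w => ?_
  rw [mul_apply_eq_comp, leftCreation, leftCreation, shift_stdVec,
    ContinuousLinearMap.star_eq_adjoint, adjoint_shift_stdVec_of_notMem]
  · rfl
  · intro j h
    exact hlm (List.cons.inj h).1

lemma star_leftCreation_vacuum (l : J) : star (leftCreation l) vacuum = 0 := by
  rw [ContinuousLinearMap.star_eq_adjoint, leftCreation, vacuum, adjoint_shift_stdVec_of_notMem]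
  exact fun j => List.cons_ne_nil _ _

lemma star_rightCreation_vacuum (l : J) : star (rightCreation l) vacuum = 0 := by
  rw [ContinuousLinearMap.star_eq_adjoint, rightCreation, vacuum, adjoint_shift_stdVec_of_notMem]
  exact fun j => by simp

lemma leftCreation_vacuum (l : J) : leftCreation l vacuum = rightCreation l vacuum := by
  rw [leftCreation, rightCreation, vacuum, shift_stdVec, shift_stdVec]
  rfl

lemma leftCreation_mul_rightCreation (m l : J) :
    leftCreation m * rightCreation l = rightCreation l * leftCreation m := by
  refine ext_stdVec fun w => ?_
  simp only [mul_apply_eq_comp, leftCreation, rightCreation, shift_stdVec,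
    List.cons_append]

open scoped Classical in
-- Removing the first letter of a word and appending a last one commute, except on the empty word,
-- where the appended letter is the one that gets removed; this exception is the vacuum projection.
lemma star_leftCreation_mul_rightCreation (m l : J) :
    star (leftCreation m) * rightCreation l
      = rightCreation l * star (leftCreation m) + if m = l then vacuumProjection else 0 := by
  refine ext_stdVec fun w => ?_
  rw [add_apply, mul_apply_eq_comp, mul_apply_eq_comp,
    ContinuousLinearMap.star_eq_adjoint, rightCreation, shift_stdVec]
  cases w with
  | nil =>
    have h1 : ContinuousLinearMap.adjoint (leftCreation m) (stdVec []) = 0 := by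
      have := star_leftCreation_vacuum m
      rwa [ContinuousLinearMap.star_eq_adjoint] at this
    rw [h1, map_zero, zero_add]
    by_cases hml : m = l
    · subst hml
      rw [if_pos rfl, List.nil_append, leftCreation,
        adjoint_shift_stdVec List.cons_injective ([] : List J), vacuumProjection_apply, vacuum,
        inner_stdVec, stdVec_apply_self, one_smul]
    · rw [if_neg hml, List.nil_append, leftCreation, adjoint_shift_stdVec_of_notMem]
      · rfl
      · intro j h
        exact hml (List.cons.inj h).1
  | cons c u =>
    have h1 : (if m = l then (vacuumProjection : FockSpace J →L[ℂ] FockSpace J) else 0)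
        (stdVec (c :: u)) = 0 := by
      split_ifs
      · rw [vacuumProjection_apply, vacuum, inner_stdVec, stdVec_apply_ne (by simp), zero_smul]
      · rfl
    rw [h1, add_zero, leftCreation]
    by_cases hmc : m = c
    · subst hmc
      rw [List.cons_append, adjoint_shift_stdVec List.cons_injective (u ++ [l]),
        adjoint_shift_stdVec List.cons_injective u, shift_stdVec]
    · rw [List.cons_append, adjoint_shift_stdVec_of_notMem, adjoint_shift_stdVec_of_notMem,
        map_zero]
      · intro j h
        exact hmc (List.cons.inj h).1
      · intro j h
        exact hmc (List.cons.inj h).1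

/-- The vacuum state. -/
def vacuumState : (FockSpace J →L[ℂ] FockSpace J) →ₗ[ℂ] ℂ where
  toFun x := inner ℂ vacuum (x vacuum)
  map_add' x y := by simp
  map_smul' c x := by simp

lemma vacuumState_apply (x : FockSpace J →L[ℂ] FockSpace J) :
    vacuumState x = inner ℂ vacuum (x vacuum) := rfl

lemma isState_vacuumState : IsState (vacuumState (J := J)) where
  map_one := by
    rw [vacuumState_apply, one_apply_eq_self, inner_self_eq_norm_sq_to_K, norm_vacuum]
    simp
  map_star x := by
    rw [vacuumState_apply, vacuumState_apply, ContinuousLinearMap.star_eq_adjoint,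
      ContinuousLinearMap.adjoint_inner_right]
    exact (inner_conj_symm _ _).symm
  nonneg x := by
    rw [vacuumState_apply, mul_apply_eq_comp, ContinuousLinearMap.star_eq_adjoint,
      ContinuousLinearMap.adjoint_inner_right, inner_self_eq_norm_sq_to_K]
    have h1 : (0 : ℂ) ≤ ((‖x vacuum‖ ^ 2 : ℝ) : ℂ) := Complex.zero_le_real.2 (sq_nonneg _)
    rwa [Complex.ofReal_pow] at h1

lemma norm_vacuumState_le (x : FockSpace J →L[ℂ] FockSpace J) : ‖vacuumState x‖ ≤ ‖x‖ := by
  rw [vacuumState_apply]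
  refine (norm_inner_le_norm _ _).trans ?_
  rw [norm_vacuum, one_mul]
  refine (x.le_opNorm _).trans ?_
  rw [norm_vacuum, mul_one]

/-- The semicircular elements on the Fock space. -/
def fockSemicircular (v : J → ℝ≥0) (l : J) : FockSpace J →L[ℂ] FockSpace J :=
  ((√(v l : ℝ) : ℝ) : ℂ) • (leftCreation l + star (leftCreation l))

lemma isSelfAdjoint_fockSemicircular (v : J → ℝ≥0) (l : J) :
    IsSelfAdjoint (fockSemicircular v l) := by
  rw [fockSemicircular, isSelfAdjoint_iff, star_smul, star_add, star_star, add_comm]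
  simp

end Fock

end

noncomputable section

/-! ### The semicircular elements of the Fock space -/

section FockLaw

open Polynomial

/-- The action of `c (ℓ + ℓ^*)` on polynomials in the left creation operator `ℓ`. -/
def creationStep (c : ℂ) (r : ℂ[X]) : ℂ[X] := c • (X * r + r.divX)

variable {J : Type*}

lemma aeval_leftCreation_apply (l : J) (r : ℂ[X]) (ξ : FockSpace J) :
    aeval (leftCreation l) r ξ
      = leftCreation l (aeval (leftCreation l) r.divX ξ) + r.coeff 0 • ξ := by
  conv_lhs => rw [← divX_mul_X_add r, mul_comm]
  rw [map_add, map_mul, aeval_X, aeval_C, add_apply, mul_apply_eq_comp]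
  rfl

lemma star_leftCreation_leftCreation_apply (l : J) (ξ : FockSpace J) :
    star (leftCreation l) (leftCreation l ξ) = ξ := by
  rw [← mul_apply_eq_comp, star_leftCreation_mul_self, one_apply_eq_self]

/-- On polynomials in `ℓ` applied to a vector killed by `ℓ^*`, the operator `ℓ` multiplies by `X`
and `ℓ^*` removes one factor `X`, dropping the constant term. -/
lemma fockSemicircular_aeval_apply (v : J → ℝ≥0) (l : J) (r : ℂ[X]) {ξ : FockSpace J}
    (hξ : star (leftCreation l) ξ = 0) :
    fockSemicircular v l (aeval (leftCreation l) r ξ)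
      = aeval (leftCreation l) (creationStep ((√(v l : ℝ) : ℝ) : ℂ) r) ξ := by
  have h1 : star (leftCreation l) (aeval (leftCreation l) r ξ)
      = aeval (leftCreation l) r.divX ξ := by
    rw [aeval_leftCreation_apply, map_add, star_leftCreation_leftCreation_apply, map_smul, hξ,
      smul_zero, add_zero]
  rw [fockSemicircular, creationStep, map_smul, map_add, map_mul, aeval_X, smul_apply, add_apply,
    smul_apply, add_apply, h1, mul_apply_eq_comp]

lemma fockSemicircular_pow_apply (v : J → ℝ≥0) (l : J) (s : ℕ) {ξ : FockSpace J}
    (hξ : star (leftCreation l) ξ = 0) : (fockSemicircular v l ^ s) ξ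
      = aeval (leftCreation l) ((creationStep ((√(v l : ℝ) : ℝ) : ℂ))^[s] 1) ξ := by
  induction s with
  | zero => simp
  | succ s ih =>
    rw [pow_succ', mul_apply_eq_comp, ih, fockSemicircular_aeval_apply v l _ hξ,
      Function.iterate_succ_apply']

lemma exists_aeval_of_mem_adjoin (v : J → ℝ≥0) (l : J) {x : FockSpace J →L[ℂ] FockSpace J}
    (hx : x ∈ Algebra.adjoin ℂ {fockSemicircular v l}) :
    ∃ r : ℂ[X], ∀ ξ, star (leftCreation l) ξ = 0 → x ξ = aeval (leftCreation l) r ξ := by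
  rw [Algebra.adjoin_singleton_eq_range_aeval] at hx
  obtain ⟨q, rfl⟩ := hx
  induction q using Polynomial.induction_on' with
  | add p q hp hq =>
    obtain ⟨r, hr⟩ := hp
    obtain ⟨r', hr'⟩ := hq
    refine ⟨r + r', fun ξ hξ => ?_⟩
    have h1 := hr ξ hξ
    have h2 := hr' ξ hξ
    simp only [AlgHom.toRingHom_eq_coe, RingHom.coe_coe] at h1 h2 ⊢
    rw [map_add, map_add, add_apply, add_apply, h1, h2]
  | monomial s c =>
    refine ⟨c • (creationStep ((√(v l : ℝ) : ℝ) : ℂ))^[s] 1, fun ξ hξ => ?_⟩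
    simp only [AlgHom.toRingHom_eq_coe, RingHom.coe_coe]
    rw [aeval_monomial, ← Algebra.smul_def, smul_apply, fockSemicircular_pow_apply v l s hξ,
      map_smul, smul_apply]

lemma inner_vacuum_leftCreation (l : J) (ξ : FockSpace J) :
    inner ℂ vacuum (leftCreation l ξ) = 0 := by
  rw [← ContinuousLinearMap.adjoint_inner_left, ← ContinuousLinearMap.star_eq_adjoint,
    star_leftCreation_vacuum, inner_zero_left]

lemma inner_vacuum_aeval (l : J) (r : ℂ[X]) :
    inner ℂ vacuum (aeval (leftCreation l) r vacuum) = r.coeff 0 := by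
  rw [aeval_leftCreation_apply, inner_add_right, inner_vacuum_leftCreation, zero_add,
    inner_smul_right, inner_self_eq_norm_sq_to_K, norm_vacuum]
  simp

lemma vacuumState_fockSemicircular_pow (v : J → ℝ≥0) (l : J) (s : ℕ) :
    vacuumState (fockSemicircular v l ^ s)
      = ((creationStep ((√(v l : ℝ) : ℝ) : ℂ))^[s] 1).coeff 0 := by
  rw [vacuumState_apply, fockSemicircular_pow_apply v l s (star_leftCreation_vacuum l),
    inner_vacuum_aeval]

/-- The vacuum expectation is the constant coefficient of the representing polynomial. A centred
element therefore carries any vector killed by `ℓ^*`, not just the vacuum, into the range of `ℓ`. -/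
lemma exists_leftCreation_of_mem_adjoin (v : J → ℝ≥0) (l : J)
    {x : FockSpace J →L[ℂ] FockSpace J} (hx : x ∈ Algebra.adjoin ℂ {fockSemicircular v l})
    (hx0 : vacuumState x = 0) {ξ : FockSpace J} (hξ : star (leftCreation l) ξ = 0) :
    ∃ η, x ξ = leftCreation l η := by
  obtain ⟨r, hr⟩ := exists_aeval_of_mem_adjoin v l hx
  have h1 : r.coeff 0 = 0 := by
    rw [← inner_vacuum_aeval l, ← hr _ (star_leftCreation_vacuum l)]
    exact hx0
  refine ⟨aeval (leftCreation l) r.divX ξ, ?_⟩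
  rw [hr ξ hξ, aeval_leftCreation_apply, h1, zero_smul, add_zero]

/-- Apply the alternating product to the vacuum from the right. After each centred factor the vector
lies in the range of that factor's creation operator, hence is killed by the annihilator of the
next, different index. The final vector is orthogonal to the vacuum. -/
lemma areFree_fockSemicircular (v : J → ℝ≥0) :
    AreFree vacuumState fun l => Algebra.adjoin ℂ {fockSemicircular v l} := by
  suffices H : ∀ (m : ℕ) (j : Fin (m + 1) → J) (x : Fin (m + 1) → FockSpace J →L[ℂ] FockSpace J),
      (∀ i : Fin m, j i.castSucc ≠ j i.succ) →
      (∀ i, x i ∈ Algebra.adjoin ℂ {fockSemicircular v (j i)}) → (∀ i, vacuumState (x i) = 0) →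
      ∃ η, (List.ofFn x).prod vacuum = leftCreation (j 0) η by
    intro m j x hj hx hx0
    obtain ⟨η, hη⟩ := H m j x hj hx hx0
    rw [vacuumState_apply, hη, inner_vacuum_leftCreation]
  intro m
  induction m with
  | zero =>
    intro j x _ hx hx0
    simpa using exists_leftCreation_of_mem_adjoin v (j 0) (hx 0) (hx0 0)
      (star_leftCreation_vacuum (j 0))
  | succ m ih =>
    intro j x hj hx hx0
    obtain ⟨η, hη⟩ := ih (fun i => j i.succ) (fun i => x i.succ) (fun i => hj i.succ)
      (fun i => hx i.succ) fun i => hx0 i.succ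
    rw [List.ofFn_succ, List.prod_cons, mul_apply_eq_comp, hη]
    refine exists_leftCreation_of_mem_adjoin v (j 0) (hx 0) (hx0 0) ?_
    have h1 : j 0 ≠ j (Fin.succ 0) := hj 0
    rw [← mul_apply_eq_comp, star_leftCreation_mul_of_ne h1]
    rfl

/-! ### The moments of the semicircle law -/

/-- The linear map that sends `X ^ n` to `sin ((n + 1) θ)`. -/
def sineSum (θ : ℝ) : ℂ[X] →ₗ[ℂ] ℂ :=
  lsum fun n => LinearMap.toSpanSingleton ℂ ℂ ((Real.sin ((n + 1) * θ) : ℝ) : ℂ)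

lemma sineSum_monomial (θ : ℝ) (n : ℕ) (c : ℂ) :
    sineSum θ (monomial n c) = c * ((Real.sin ((n + 1) * θ) : ℝ) : ℂ) := by
  simp [sineSum, lsum_apply, sum_monomial_index]

/-- The Chebyshev recurrence `sin((n+2)θ) + sin(nθ) = 2 cos θ sin((n+1)θ)`: the map diagonalizes the
creation-annihilation step. -/
lemma sineSum_creationStep (θ : ℝ) (c : ℂ) (r : ℂ[X]) :
    sineSum θ (creationStep c r) = c * (2 * Real.cos θ : ℝ) * sineSum θ r := by
  rw [creationStep, map_smul, smul_eq_mul, mul_assoc]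
  congr 1
  induction r using Polynomial.induction_on' with
  | add p q hp hq =>
    have h1 : X * (p + q) + (p + q).divX = (X * p + p.divX) + (X * q + q.divX) := by
      rw [divX_add]
      ring
    rw [h1, map_add, hp, hq, map_add, mul_add]
  | monomial n c =>
    rw [X_mul_monomial, map_add, sineSum_monomial, sineSum_monomial]
    cases n with
    | zero =>
      rw [monomial_zero_left, divX_C, map_zero, add_zero]
      have : Real.sin (((0 + 1 : ℕ) + 1) * θ) = 2 * Real.cos θ * Real.sin (((0 : ℕ) + 1) * θ) := by
        push_cast
        rw [show (1 + 1) * θ = 2 * θ by ring, Real.sin_two_mul]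
        ring_nf
      rw [this]
      push_cast
      ring
    | succ n =>
      have h0 : (monomial (n + 1) c).divX = monomial n c := by
        ext m
        simp [coeff_divX, coeff_monomial]
      rw [h0, sineSum_monomial]
      have : Real.sin (((n + 1 + 1 : ℕ) + 1) * θ) + Real.sin (((n : ℕ) + 1) * θ)
          = 2 * Real.cos θ * Real.sin (((n + 1 : ℕ) + 1) * θ) := by
        push_cast
        rw [show ((n : ℝ) + 1 + 1 + 1) * θ = (n + 1 + 1) * θ + θ by ring,
          show ((n : ℝ) + 1) * θ = (n + 1 + 1) * θ - θ by ring, Real.sin_add, Real.sin_sub]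
        ring
      rw [← mul_add, ← Complex.ofReal_add, this]
      push_cast
      ring

lemma sineSum_iterate (θ : ℝ) (c : ℝ) (s : ℕ) :
    sineSum θ ((creationStep (c : ℂ))^[s] 1) = (((2 * c * Real.cos θ) ^ s * Real.sin θ : ℝ) : ℂ) := by
  induction s with
  | zero =>
    rw [Function.iterate_zero, id, ← monomial_zero_one, sineSum_monomial]
    simp
  | succ s ih =>
    rw [Function.iterate_succ_apply', sineSum_creationStep, ih]
    push_cast
    ring

lemma continuous_sineSum (r : ℂ[X]) : Continuous fun θ => sineSum θ r := by
  induction r using Polynomial.induction_on' with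
  | add p q hp hq =>
    simp_rw [map_add]
    exact hp.add hq
  | monomial n c =>
    simp_rw [sineSum_monomial]
    fun_prop

lemma integral_sin_mul_sin (n : ℕ) :
    ∫ θ in (0 : ℝ)..Real.pi, Real.sin ((n + 1) * θ) * Real.sin θ
      = if n = 0 then Real.pi / 2 else 0 := by
  split_ifs with hn
  · subst hn
    simp_rw [Nat.cast_zero, zero_add, one_mul, ← sq]
    rw [integral_sin_sq]
    simp
  · have hn' : (n : ℝ) ≠ 0 := by exact_mod_cast hn
    have hn2 : (n : ℝ) + 2 ≠ 0 := by positivity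
    have h1 : ∀ θ : ℝ, HasDerivAt (fun θ => (Real.sin (n * θ) / n - Real.sin ((n + 2) * θ) / (n + 2))
        / 2) (Real.sin ((n + 1) * θ) * Real.sin θ) θ := by
      intro θ
      have e1 : HasDerivAt (fun θ : ℝ => Real.sin (n * θ)) (Real.cos (n * θ) * n) θ := by
        simpa using ((hasDerivAt_id θ).const_mul (n : ℝ)).sin
      have e2 : HasDerivAt (fun θ : ℝ => Real.sin ((n + 2) * θ))
          (Real.cos ((n + 2) * θ) * (n + 2)) θ := by
        simpa using ((hasDerivAt_id θ).const_mul ((n : ℝ) + 2)).sin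
      refine HasDerivAt.congr_deriv
        (((e1.div_const (n : ℝ)).fun_sub (e2.div_const ((n : ℝ) + 2))).div_const 2) ?_
      rw [mul_div_cancel_right₀ _ hn', mul_div_cancel_right₀ _ hn2,
        show (n : ℝ) * θ = (n + 1) * θ - θ by ring, show ((n : ℝ) + 2) * θ = (n + 1) * θ + θ by ring,
        Real.cos_sub, Real.cos_add]
      ring
    rw [intervalIntegral.integral_eq_sub_of_hasDerivAt (fun θ _ => h1 θ)
      (Continuous.intervalIntegrable (by fun_prop) _ _)]
    have e3 : Real.sin (((n : ℝ) + 2) * Real.pi) = 0 := by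
      exact_mod_cast Real.sin_nat_mul_pi (n + 2)
    simp [Real.sin_nat_mul_pi, e3]

/-- Orthogonality of the sines on `[0, π]` extracts the constant coefficient, which is the vacuum
moment. -/
lemma integral_sineSum_mul_sin (r : ℂ[X]) :
    ∫ θ in (0 : ℝ)..Real.pi, sineSum θ r * ((Real.sin θ : ℝ) : ℂ) = r.coeff 0 * (Real.pi / 2 : ℝ) := by
  induction r using Polynomial.induction_on' with
  | add p q hp hq =>
    simp_rw [map_add, add_mul]
    rw [intervalIntegral.integral_add, hp, hq, coeff_add, add_mul]
    · exact Continuous.intervalIntegrable ((continuous_sineSum p).mul (by fun_prop)) _ _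
    · exact Continuous.intervalIntegrable ((continuous_sineSum q).mul (by fun_prop)) _ _
  | monomial n c =>
    simp_rw [sineSum_monomial, mul_assoc, ← Complex.ofReal_mul]
    rw [intervalIntegral.integral_const_mul, intervalIntegral.integral_ofReal,
      integral_sin_mul_sin, coeff_monomial]
    split_ifs <;> simp

/-- The substitution `x = 2√v cos θ`; the density supplies one factor `sin θ` and the Jacobian the
other. -/
lemma integral_semicircleLaw {v : ℝ≥0} (hv : v ≠ 0) {f : ℝ → ℝ} (hf : Continuous f) :
    ∫ x, f x ∂semicircleLaw v
      = (2 / Real.pi) * ∫ θ in (0 : ℝ)..Real.pi, f (2 * √v * Real.cos θ) * Real.sin θ ^ 2 := by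
  have hv0 : (0 : ℝ) < v := lt_of_le_of_ne v.2 fun h => hv (NNReal.coe_eq_zero.1 h.symm)
  set c : ℝ := √v with hc
  have hc0 : 0 < c := Real.sqrt_pos.2 hv0
  have hcv : c ^ 2 = v := Real.sq_sqrt hv0.le
  have hpi := Real.pi_pos
  rw [semicircleLaw, if_neg hv, integral_withDensity_eq_integral_toReal_smul
    (by fun_prop) (Eventually.of_forall fun _ => ENNReal.ofReal_lt_top)]
  have hd : ∀ x : ℝ, (ENNReal.ofReal ((2 * Real.pi * v)⁻¹ * √(4 * v - x ^ 2))).toReal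
      = (2 * Real.pi * v)⁻¹ * √(4 * v - x ^ 2) := fun x =>
    ENNReal.toReal_ofReal (by positivity)
  simp_rw [hd, smul_eq_mul]
  set F : ℝ → ℝ := fun x => (2 * Real.pi * v)⁻¹ * √(4 * v - x ^ 2) * f x with hF
  have hFc : Continuous F := by
    rw [hF]
    fun_prop
  have h1 : ∫ x, F x = ∫ x in (-(2 * c))..(2 * c), F x := by
    rw [intervalIntegral.integral_of_le (by linarith), ← integral_Icc_eq_integral_Ioc,
      setIntegral_eq_integral_of_forall_compl_eq_zero]
    intro x hx
    have h2 : 4 * (v : ℝ) - x ^ 2 ≤ 0 := by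
      rw [← hcv]
      by_contra! h3
      refine hx (Set.mem_Icc.2 (abs_le.1 (abs_le_of_sq_le_sq ?_ (by positivity))))
      nlinarith
    rw [hF]
    simp [Real.sqrt_eq_zero_of_nonpos h2]
  rw [h1]
  have h2 : ∫ θ in (0 : ℝ)..Real.pi, F (2 * c * Real.cos θ) * (2 * c * -Real.sin θ)
      = ∫ x in (2 * c * Real.cos 0)..(2 * c * Real.cos Real.pi), F x :=
    intervalIntegral.integral_comp_mul_deriv (f := fun θ => 2 * c * Real.cos θ)
      (fun θ _ => (Real.hasDerivAt_cos θ).const_mul (2 * c))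
      (by fun_prop) hFc
  rw [Real.cos_zero, Real.cos_pi, mul_one, mul_neg_one] at h2
  rw [intervalIntegral.integral_symm (2 * c) (-(2 * c)), ← h2, ← intervalIntegral.integral_neg,
    ← intervalIntegral.integral_const_mul]
  refine intervalIntegral.integral_congr fun θ hθ => ?_
  rw [Set.uIcc_of_le hpi.le] at hθ
  have hs : 0 ≤ Real.sin θ := Real.sin_nonneg_of_mem_Icc hθ
  have h3 : √(4 * (v : ℝ) - (2 * c * Real.cos θ) ^ 2) = 2 * c * Real.sin θ := by
    rw [← hcv, show 4 * c ^ 2 - (2 * c * Real.cos θ) ^ 2 = (2 * c * Real.sin θ) ^ 2 by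
      have := Real.sin_sq_add_cos_sq θ
      linear_combination (-4 * c ^ 2) * this]
    exact Real.sqrt_sq (by positivity)
  simp only [hF, h3]
  rw [← hcv]
  field_simp

lemma integral_pow_semicircleLaw (v : ℝ≥0) (s : ℕ) :
    ((∫ x, x ^ s ∂semicircleLaw v : ℝ) : ℂ) = ((creationStep ((√(v : ℝ) : ℝ) : ℂ))^[s] 1).coeff 0 := by
  by_cases hv : v = 0
  · subst hv
    rw [semicircleLaw, if_pos rfl, integral_dirac]
    cases s with
    | zero => simp
    | succ s => simp [Function.iterate_succ_apply', creationStep]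
  · rw [integral_semicircleLaw hv (by fun_prop)]
    have h1 := integral_sineSum_mul_sin ((creationStep ((√(v : ℝ) : ℝ) : ℂ))^[s] 1)
    simp_rw [sineSum_iterate, ← Complex.ofReal_mul, mul_assoc, ← sq] at h1
    rw [intervalIntegral.integral_ofReal] at h1
    simp_rw [mul_assoc] at h1 ⊢
    rw [Complex.ofReal_mul, h1, mul_comm, mul_assoc, ← Complex.ofReal_mul]
    have : Real.pi / 2 * (2 / Real.pi) = 1 := by
      have := Real.pi_pos.ne'
      field_simp
    rw [this, Complex.ofReal_one, mul_one]

theorem isFreeSemicircular_fockSemicircular (v : J → ℝ≥0) :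
    IsFreeSemicircular vacuumState v (fockSemicircular v) where
  selfAdjoint := isSelfAdjoint_fockSemicircular v
  law l s := by rw [vacuumState_fockSemicircular_pow, integral_pow_semicircleLaw]
  free := areFree_fockSemicircular v

end FockLaw

end

noncomputable section

/-! ### The joint moments of free semicircular families -/

section JointMoments

open Polynomial

variable {𝒜 : Type*} [Ring 𝒜] [Algebra ℂ 𝒜] {J : Type*}

/-- The product `q₁(a_{j₁}) ⋯ q_s(a_{j_s})`. -/
def wordProd (a : J → 𝒜) (L : List (J × ℂ[X])) : 𝒜 :=
  (L.map fun p => aeval (a p.1) p.2).prod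

lemma wordProd_append (a : J → 𝒜) (L L' : List (J × ℂ[X])) :
    wordProd a (L ++ L') = wordProd a L * wordProd a L' := by
  simp [wordProd]

lemma wordProd_cons (a : J → 𝒜) (p : J × ℂ[X]) (L : List (J × ℂ[X])) :
    wordProd a (p :: L) = aeval (a p.1) p.2 * wordProd a L := by
  simp [wordProd]

lemma wordProd_concat_append_cons (a : J → 𝒜) (L L' : List (J × ℂ[X])) (j : J) (q r : ℂ[X]) :
    wordProd a ((L ++ [(j, q)]) ++ (j, r) :: L') = wordProd a (L ++ (j, q * r) :: L') := by
  simp only [wordProd_append, wordProd_cons, map_mul, mul_assoc]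
  simp [wordProd]

/-- The centring step of the moment recursion: with `c` the expectation of the factor, one summand
has a centred letter and the other is a shorter word. -/
lemma wordProd_append_cons_sub (a : J → 𝒜) (L L' : List (J × ℂ[X])) (j : J) (q : ℂ[X]) (c : ℂ) :
    wordProd a (L ++ (j, q) :: L')
      = wordProd a ((L ++ [(j, q - C c)]) ++ L') + c • wordProd a (L ++ L') := by
  rw [List.append_assoc, List.singleton_append]
  simp only [wordProd_append, wordProd_cons, map_sub, aeval_C, Algebra.algebraMap_eq_smul_one,
    sub_mul, mul_sub, smul_mul_assoc, one_mul, mul_smul_comm, sub_add_cancel]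

lemma AreFree.map_wordProd_eq_zero {τ : 𝒜 →ₗ[ℂ] ℂ} {a : J → 𝒜}
    (h : AreFree τ fun l => Algebra.adjoin ℂ {a l}) {L : List (J × ℂ[X])} (hL : L ≠ [])
    (hc : L.IsChain fun p q => p.1 ≠ q.1) (h0 : ∀ p ∈ L, τ (aeval (a p.1) p.2) = 0) :
    τ (wordProd a L) = 0 := by
  obtain ⟨p, L, rfl⟩ := List.exists_cons_of_ne_nil hL
  have h1 := h L.length (fun i => ((p :: L).get i).1)
    (fun i => aeval (a ((p :: L).get i).1) ((p :: L).get i).2)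
    (fun i => List.isChain_iff_getElem.1 hc i (by simp))
    (fun i => aeval_mem_adjoin_singleton ℂ _) (fun i => h0 _ (List.get_mem _ _))
  have h2 : List.ofFn (fun i : Fin (L.length + 1) =>
      aeval (a ((p :: L).get i).1) ((p :: L).get i).2)
      = (p :: L).map fun p => aeval (a p.1) p.2 := by
    conv_rhs => rw [← List.ofFn_get (p :: L), List.map_ofFn]
    rfl
  rw [h2] at h1
  exact h1

/-- The power is computed once with free noncommuting letters and then evaluated, so its entries
depend only on joint moments of words. -/
lemma substitute_pow_eq {k h : ℕ} (B : Matrix (Fin k) (Fin k) (Fin h)) (a : Fin h → 𝒜) (s : ℕ) :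
    substitute B a ^ s = (substitute B (fun l => MonoidAlgebra.of ℂ (FreeMonoid (Fin h))
      (FreeMonoid.of l)) ^ s).map
        (MonoidAlgebra.lift ℂ 𝒜 (FreeMonoid (Fin h)) (FreeMonoid.lift a)) := by
  have h1 := map_pow (MonoidAlgebra.lift ℂ 𝒜 (FreeMonoid (Fin h)) (FreeMonoid.lift a)).mapMatrix
    (substitute B (fun l => MonoidAlgebra.of ℂ (FreeMonoid (Fin h)) (FreeMonoid.of l))) s
  rw [AlgHom.mapMatrix_apply, AlgHom.mapMatrix_apply] at h1
  rw [h1]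
  congr 1
  ext i j
  simp [substitute]

variable [StarRing 𝒜] {𝒜' : Type*} [Ring 𝒜'] [StarRing 𝒜'] [Algebra ℂ 𝒜']
variable {τ : 𝒜 →ₗ[ℂ] ℂ} {a : J → 𝒜} {τ' : 𝒜' →ₗ[ℂ] ℂ} {a' : J → 𝒜'} {v : J → ℝ≥0}

lemma IsFreeSemicircular.map_aeval_eq (ha : IsFreeSemicircular τ v a)
    (ha' : IsFreeSemicircular τ' v a') (j : J) (q : ℂ[X]) :
    τ (aeval (a j) q) = τ' (aeval (a' j) q) := by
  induction q using Polynomial.induction_on' with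
  | add p q hp hq => rw [map_add, map_add, map_add, map_add, hp, hq]
  | monomial s c =>
    rw [aeval_monomial, aeval_monomial, ← Algebra.smul_def, ← Algebra.smul_def, map_smul, map_smul,
      ha.law, ha'.law]

/-- Freeness with given marginals determines joint moments. In a strong induction on length, a
centred alternating prefix is extended letter by letter: equal neighbours merge into a shorter word,
a new letter is centred at the cost of a shorter word, and a fully centred alternating word has
moment zero on both sides. -/
lemma IsFreeSemicircular.map_wordProd_eq (hτ : IsState τ) (hτ' : IsState τ')
    (ha : IsFreeSemicircular τ v a) (ha' : IsFreeSemicircular τ' v a') (L : List (J × ℂ[X])) :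
    τ (wordProd a L) = τ' (wordProd a' L) := by
  induction hn : L.length using Nat.strong_induction_on generalizing L with
  | _ n ih =>
  suffices H : ∀ C A : List (J × ℂ[X]), (A ++ C).length = n →
      (A.IsChain fun p q => p.1 ≠ q.1) → (∀ p ∈ A, τ (aeval (a p.1) p.2) = 0) →
      τ (wordProd a (A ++ C)) = τ' (wordProd a' (A ++ C)) from
    H L [] hn .nil (by simp)
  intro C
  induction C with
  | nil =>
    intro A _ hc h0
    rw [List.append_nil]
    by_cases hA : A = []
    · subst hA
      simp [wordProd, hτ.map_one, hτ'.map_one]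
    · rw [ha.free.map_wordProd_eq_zero hA hc h0, ha'.free.map_wordProd_eq_zero hA hc]
      intro p hp
      rw [← ha.map_aeval_eq ha', h0 p hp]
  | cons p C hC =>
    intro A hAC hc h0
    obtain ⟨j, q⟩ := p
    by_cases hlast : ∃ A' r, A = A' ++ [(j, r)]
    · obtain ⟨A', r, rfl⟩ := hlast
      rw [wordProd_concat_append_cons, wordProd_concat_append_cons]
      refine ih _ ?_ _ rfl
      rw [← hAC]
      simp
    · rw [wordProd_append_cons_sub a A C j q (τ (aeval (a j) q)),
        wordProd_append_cons_sub a' A C j q (τ (aeval (a j) q)), map_add, map_add, map_smul,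
        map_smul]
      congr 1
      · refine hC _ ?_ ?_ ?_
        · rw [← hAC]
          simp
        · rw [List.isChain_append]
          refine ⟨hc, .singleton _, ?_⟩
          rintro ⟨i, r⟩ hx y hy
          simp only [List.head?_cons, Option.mem_def, Option.some.injEq] at hy
          subst hy
          rintro rfl
          obtain ⟨A', hA'⟩ := List.getLast?_eq_some_iff.1 hx
          exact hlast ⟨A', r, hA'⟩
        · intro p hp
          rcases List.mem_append.1 hp with hp | hp
          · exact h0 p hp
          · rw [List.mem_singleton.1 hp]
            simp only [map_sub, aeval_C, Algebra.algebraMap_eq_smul_one, map_smul, hτ.map_one]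
            simp
      · congr 1
        refine ih _ ?_ _ rfl
        rw [← hAC]
        simp

lemma IsFreeSemicircular.map_list_prod_eq (hτ : IsState τ) (hτ' : IsState τ')
    (ha : IsFreeSemicircular τ v a) (ha' : IsFreeSemicircular τ' v a') (L : List J) :
    τ (L.map a).prod = τ' (L.map a').prod := by
  have := ha.map_wordProd_eq hτ hτ' ha' (L.map fun j => (j, X))
  simpa [wordProd, Function.comp_def] using this

lemma IsFreeSemicircular.map_lift_eq (hτ : IsState τ) (hτ' : IsState τ')
    (ha : IsFreeSemicircular τ v a) (ha' : IsFreeSemicircular τ' v a')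
    (x : MonoidAlgebra ℂ (FreeMonoid J)) :
    τ (MonoidAlgebra.lift ℂ 𝒜 (FreeMonoid J) (FreeMonoid.lift a) x)
      = τ' (MonoidAlgebra.lift ℂ 𝒜' (FreeMonoid J) (FreeMonoid.lift a') x) := by
  induction x using MonoidAlgebra.induction_on with
  | of w =>
    rw [MonoidAlgebra.lift_of, MonoidAlgebra.lift_of, FreeMonoid.lift_apply, FreeMonoid.lift_apply]
    exact ha.map_list_prod_eq hτ hτ' ha' _
  | add x y hx hy => rw [map_add, map_add, map_add, map_add, hx, hy]
  | smul c x hx => rw [map_smul, map_smul, map_smul, map_smul, hx]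

/-- The moments of a block matrix do not depend on the choice of the free family. -/
theorem IsFreeSemicircular.tensorTrace_pow_eq {k h : ℕ} {v : Fin h → ℝ≥0} {a : Fin h → 𝒜}
    {a' : Fin h → 𝒜'} (hτ : IsState τ) (hτ' : IsState τ') (ha : IsFreeSemicircular τ v a)
    (ha' : IsFreeSemicircular τ' v a') (B : Matrix (Fin k) (Fin k) (Fin h)) (s : ℕ) :
    tensorTrace τ (substitute B a ^ s) = tensorTrace τ' (substitute B a' ^ s) := by
  rw [tensorTrace, tensorTrace, substitute_pow_eq B a, substitute_pow_eq B a']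
  simp_rw [Matrix.map_apply, ha.map_lift_eq hτ hτ' ha']

end JointMoments

end

noncomputable section

/-! ### Spectral distributions of selfadjoint elements -/

section SpectralDistribution

open scoped CompactlySupported

variable {𝒞 : Type*} [CStarAlgebra 𝒞] {ψ : 𝒞 →ₗ[ℂ] ℂ}

lemma IsState.ofReal_re (hψ : IsState ψ) {x : 𝒞} (hx : IsSelfAdjoint x) :
    (((ψ x).re : ℝ) : ℂ) = ψ x := by
  have h1 := hψ.map_star x
  rw [hx.star_eq] at h1
  exact Complex.conj_eq_iff_re.1 h1.symm

/-- The state composed with the functional calculus is a positive functional on continuous functions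
on the compact spectrum; Riesz-Markov represents it by a measure, pushed forward to the real line.
-/
theorem IsState.exists_spectralDistribution (hψ : IsState ψ) {T : 𝒞} (hT : IsSelfAdjoint T) :
    ∃ μ : ProbabilityMeasure ℝ, IsCompact (μ : Measure ℝ).support ∧
      ∀ f : ℝ → ℝ, Continuous f → ψ (cfc f T) = ((∫ x, f x ∂(μ : Measure ℝ) : ℝ) : ℂ) := by
  let Λ₀ : C_c(spectrum ℝ T, ℝ) →ₗ[ℝ] ℝ :=
    { toFun := fun f => (ψ (cfcHom hT f.toContinuousMap)).re
      map_add' := fun f g => by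
        have : (f + g).toContinuousMap = f.toContinuousMap + g.toContinuousMap := rfl
        rw [this, map_add, map_add, Complex.add_re]
      map_smul' := fun c f => by
        have : (c • f).toContinuousMap = c • f.toContinuousMap := rfl
        rw [this, map_smul, ← Complex.coe_smul, map_smul, smul_eq_mul, Complex.re_ofReal_mul]
        rfl }
  have hΛ₀ : ∀ f, 0 ≤ f → 0 ≤ Λ₀ f := by
    intro f hf
    -- A nonnegative function is `star g * g` with `g` its square root, so positivity of the state
    -- applies.
    let g : C(spectrum ℝ T, ℝ) := ⟨fun x => √(f x), by fun_prop⟩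
    have hg : f.toContinuousMap = star g * g := by
      ext x
      exact (Real.mul_self_sqrt (hf x)).symm
    change 0 ≤ (ψ (cfcHom hT f.toContinuousMap)).re
    rw [hg, map_mul, StarHomClass.map_star (cfcHom hT) g]
    exact (Complex.le_def.1 (hψ.nonneg _)).1
  let Λ := PositiveLinearMap.mk₀ Λ₀ hΛ₀
  set μ₀ := RealRMK.rieszMeasure Λ with hμ₀
  have hint : ∀ f : C(spectrum ℝ T, ℝ), ∫ x, f x ∂μ₀ = (ψ (cfcHom hT f)).re := fun f =>
    RealRMK.integral_rieszMeasure Λ (CompactlySupportedContinuousMap.continuousMapEquiv f)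
  have hone : μ₀ Set.univ = 1 := by
    have h1 := hint 1
    rw [_root_.map_one (cfcHom hT), hψ.map_one] at h1
    simp only [ContinuousMap.one_apply, integral_const, smul_eq_mul, mul_one, Complex.one_re] at h1
    rwa [measureReal_def, ENNReal.toReal_eq_one_iff] at h1
  have : IsProbabilityMeasure μ₀ := ⟨hone⟩
  have hme : MeasurableEmbedding (Subtype.val : spectrum ℝ T → ℝ) :=
    MeasurableEmbedding.subtype_coe (spectrum.isClosed T).measurableSet
  refine ⟨⟨μ₀.map Subtype.val, Measure.isProbabilityMeasure_map hme.measurable.aemeasurable⟩,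
    ?_, ?_⟩
  · refine (spectrum.isCompact (𝕜 := ℝ) T).of_isClosed_subset Measure.isClosed_support
      (Measure.support_subset_of_isClosed (spectrum.isClosed T) ?_)
    rw [mem_ae_iff]
    change μ₀.map Subtype.val (spectrum ℝ T)ᶜ = 0
    rw [hme.map_apply]
    convert! measure_empty (μ := μ₀)
    ext x
    simp
  · intro f hf
    change _ = ((∫ x, f x ∂(μ₀.map Subtype.val) : ℝ) : ℂ)
    rw [hme.integral_map]
    have h1 := hint ⟨fun x => f x, by fun_prop⟩
    have h2 : cfc f T = cfcHom hT ⟨fun x => f x, by fun_prop⟩ := cfc_apply f T hT hf.continuousOn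
    simp only [ContinuousMap.coe_mk] at h1
    rw [h1, ← h2, hψ.ofReal_re]
    exact cfc_predicate f T

/-- The resolvent of a selfadjoint element on the imaginary axis. -/
theorem IsSelfAdjoint.exists_resolvent {T : 𝒞} (hT : IsSelfAdjoint T) {y : ℝ} (hy : y ≠ 0) :
    ∃ R : 𝒞, R * ((y * Complex.I) • 1 - T) = 1 ∧ ((y * Complex.I) • 1 - T) * R = 1 ∧
      ‖R‖ ≤ 2 * |y|⁻¹ ∧ ∀ {ψ : 𝒞 →ₗ[ℂ] ℂ} {μ : ProbabilityMeasure ℝ},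
        (∀ f : ℝ → ℝ, Continuous f → ψ (cfc f T) = ((∫ x, f x ∂(μ : Measure ℝ) : ℝ) : ℂ)) →
        ψ R = ∫ x : ℝ, (y * Complex.I - x)⁻¹ ∂(μ : Measure ℝ) := by
  have hd : ∀ x : ℝ, 0 < x ^ 2 + y ^ 2 := fun x => by positivity
  -- `u` and `w` are the real and imaginary parts of `(iy - x)⁻¹`, which permits the real functional
  -- calculus. Bounding them separately costs the factor `2` in the norm.
  set u : ℝ → ℝ := fun x => -x / (x ^ 2 + y ^ 2) with hu
  set w : ℝ → ℝ := fun x => -y / (x ^ 2 + y ^ 2) with hw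
  have huc : Continuous u := by
    rw [hu]
    exact continuous_id.neg.div (by fun_prop) fun x => (hd x).ne'
  have hwc : Continuous w := by
    rw [hw]
    exact continuous_const.div (by fun_prop) fun x => (hd x).ne'
  have hu1 : ∀ x, |u x| ≤ |y|⁻¹ := by
    intro x
    have h1 := abs_pos.2 hy
    rw [hu, abs_div, abs_neg, abs_of_pos (hd x), ← one_div, div_le_div_iff₀ (hd x) h1, one_mul,
      ← sq_abs x, ← sq_abs y]
    nlinarith [sq_nonneg (|x| - |y|), abs_nonneg x]
  have hw1 : ∀ x, |w x| ≤ |y|⁻¹ := by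
    intro x
    have h1 := abs_pos.2 hy
    rw [hw, abs_div, abs_neg, abs_of_pos (hd x), ← one_div, div_le_div_iff₀ (hd x) h1, one_mul,
      ← sq_abs x, ← sq_abs y]
    nlinarith [sq_nonneg |x|]
  have huw : cfc u T * T - T * cfc u T = 0 := by
    rw [sub_eq_zero]
    have h := (cfc_commute_cfc u (fun x => x) T).eq
    rwa [cfc_id' ℝ T] at h
  have hww : cfc w T * T - T * cfc w T = 0 := by
    rw [sub_eq_zero]
    have h := (cfc_commute_cfc w (fun x => x) T).eq
    rwa [cfc_id' ℝ T] at h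
  have e1 : y • cfc w T + T * cfc u T = -1 := by
    have h1 : cfc (fun x => y * w x + x * u x) T = cfc (fun _ => (-1 : ℝ)) T := by
      congr 1
      funext x
      have := (hd x).ne'
      simp only [hu, hw]
      field_simp
      ring
    rw [cfc_add (a := T) (fun x => y * w x) (fun x => x * u x) (by fun_prop) (by fun_prop),
      cfc_const_mul y w T (by fun_prop), cfc_mul (fun x => x) u T (by fun_prop) (by fun_prop),
      cfc_id' ℝ T, cfc_const (-1 : ℝ) T] at h1
    simpa using h1
  have e2 : y • cfc u T - T * cfc w T = 0 := by
    have h1 : cfc (fun x => y * u x - x * w x) T = cfc (fun _ => (0 : ℝ)) T := by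
      congr 1
      funext x
      have := (hd x).ne'
      simp only [hu, hw]
      field_simp
      ring
    rw [cfc_sub (a := T) (fun x => y * u x) (fun x => x * w x) (by fun_prop) (by fun_prop),
      cfc_const_mul y u T (by fun_prop), cfc_mul (fun x => x) w T (by fun_prop) (by fun_prop),
      cfc_id' ℝ T, cfc_const (0 : ℝ) T] at h1
    simpa using h1
  set R : 𝒞 := cfc u T + Complex.I • cfc w T with hR
  have hright : ((y * Complex.I) • 1 - T) * R = 1 := by
    have h1 : ((y * Complex.I) • 1 - T) * R
        = Complex.I • (y • cfc u T - T * cfc w T) - (y • cfc w T + T * cfc u T) := by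
      rw [hR, sub_mul, smul_mul_assoc, one_mul, mul_add, mul_smul_comm, smul_add, smul_smul,
        show (y : ℂ) * Complex.I * Complex.I = ((-y : ℝ) : ℂ) by
          rw [mul_assoc, Complex.I_mul_I]; push_cast; ring, Complex.coe_smul, mul_comm (y : ℂ),
        mul_smul, Complex.coe_smul, smul_sub, neg_smul]
      abel
    rw [h1, e1, e2]
    simp
  have hcomm : R * T = T * R := by
    rw [hR, add_mul, mul_add, smul_mul_assoc, mul_smul_comm, sub_eq_zero.1 huw, sub_eq_zero.1 hww]
  refine ⟨R, ?_, hright, ?_, ?_⟩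
  · rw [mul_sub, hcomm, mul_smul_comm, mul_one, ← one_mul R, ← smul_mul_assoc, one_mul, ← sub_mul]
    exact hright
  · have h1 : ‖cfc u T‖ ≤ |y|⁻¹ := norm_cfc_le (by positivity) fun x _ => hu1 x
    have h2 : ‖cfc w T‖ ≤ |y|⁻¹ := norm_cfc_le (by positivity) fun x _ => hw1 x
    refine (norm_add_le _ _).trans ?_
    rw [norm_smul, Complex.norm_I, one_mul]
    linarith
  · intro ψ μ hμ
    have i1 : ∀ f : ℝ → ℝ, Continuous f → (∀ x, |f x| ≤ |y|⁻¹) → Integrable f (μ : Measure ℝ) :=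
      fun f hf hb => Integrable.of_bound hf.aestronglyMeasurable _ (Eventually.of_forall hb)
    have h1 : ∀ x : ℝ, (y * Complex.I - x)⁻¹ = ((u x : ℝ) : ℂ) + Complex.I * ((w x : ℝ) : ℂ) := by
      intro x
      refine inv_eq_of_mul_eq_one_left ?_
      have h3 : ((x : ℂ) ^ 2 + (y : ℂ) ^ 2) ≠ 0 := by exact_mod_cast (hd x).ne'
      simp only [hu, hw]
      push_cast
      field_simp
      linear_combination (-(y : ℂ) ^ 2) * Complex.I_sq
    simp_rw [h1]
    rw [integral_add (i1 u huc hu1).ofReal ((i1 w hwc hw1).ofReal.const_mul _),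
      integral_const_mul, integral_complex_ofReal, integral_complex_ofReal, ← hμ u huc,
      ← hμ w hwc, hR, map_add, map_smul, smul_eq_mul]

end SpectralDistribution

end

noncomputable section

/-! ### The Dyson equation on the Fock space -/

section FockDyson

open Matrix

variable {k h : ℕ} {J : Type*}

/-- Since `z` is central, `R D - D R = R (D (z - T) - (z - T) D) R`, in which `z` cancels. -/
lemma commutator_resolvent {A : Type*} [Ring A] [Algebra ℂ A] {R T : A} {z : ℂ}
    (h1 : R * (z • 1 - T) = 1) (h2 : (z • 1 - T) * R = 1) (D : A) :
    R * D = D * R + R * (T * D - D * T) * R := by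
  have e1 : R * T = z • R - 1 := by
    rw [← h1, mul_sub, mul_smul_comm, mul_one]
    abel
  have e2 : T * R = z • R - 1 := by
    rw [← h2, sub_mul, smul_mul_assoc, one_mul]
    abel
  have e3 : R * (T * D - D * T) * R = R * T * (D * R) - R * D * (T * R) := by noncomm_ring
  rw [e3, e1, e2]
  simp only [sub_mul, mul_sub, smul_mul_assoc, mul_smul_comm, one_mul, mul_one, mul_assoc]
  abel

open scoped Classical in
lemma fockSemicircular_mul_rightCreation (v : J → ℝ≥0) (m l : J) :
    fockSemicircular v m * rightCreation l - rightCreation l * fockSemicircular v m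
      = if m = l then ((√(v l : ℝ) : ℝ) : ℂ) • vacuumProjection else 0 := by
  rw [fockSemicircular, smul_mul_assoc, mul_smul_comm, add_mul, mul_add,
    leftCreation_mul_rightCreation, star_leftCreation_mul_rightCreation, ← smul_sub]
  split_ifs with hml
  · subst hml
    congr 1
    abel
  · rw [add_zero, sub_self, smul_zero]

/-- On the vacuum annihilation vanishes, and left and right creation agree. -/
lemma vacuumState_mul_fockSemicircular (v : J → ℝ≥0) (l : J)
    (x : FockSpace J →L[ℂ] FockSpace J) : vacuumState (x * fockSemicircular v l)
      = ((√(v l : ℝ) : ℝ) : ℂ) * vacuumState (x * rightCreation l) := by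
  simp only [vacuumState_apply, mul_apply_eq_comp, fockSemicircular, _root_.smul_apply, _root_.add_apply,
    star_leftCreation_vacuum, add_zero, leftCreation_vacuum, map_smul, inner_smul_right]

lemma vacuumState_rightCreation_mul (l : J) (x : FockSpace J →L[ℂ] FockSpace J) :
    vacuumState (rightCreation l * x) = 0 := by
  rw [vacuumState_apply, mul_apply_eq_comp, ← ContinuousLinearMap.adjoint_inner_left,
    ← ContinuousLinearMap.star_eq_adjoint, star_rightCreation_vacuum, inner_zero_left]

lemma vacuumState_mul_vacuumProjection_mul (x y : FockSpace J →L[ℂ] FockSpace J) :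
    vacuumState (x * vacuumProjection * y) = vacuumState x * vacuumState y := by
  simp only [vacuumState_apply, mul_apply_eq_comp, vacuumProjection_apply, map_smul,
    inner_smul_right]
  ring

/-- From `z R = 1 + R T`, only vacuum expectations of `R_pc a_l` are needed. On the vacuum `a_l`
acts as `√v` times right creation, which is then commuted to the left of `R`, where it contributes
zero. The commutator with `T` is `√v b_l` tensored with the vacuum projection, and that projection
splits the expectation into `G b_l G`. Injectivity of `e` ensures that only the positions of the
letter `l` contribute to the commutator. -/
theorem fock_dyson (B : Matrix (Fin k) (Fin k) (Fin h)) (v : J → ℝ≥0) {e : Fin h → J}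
    (he : Function.Injective e) {R : Matrix (Fin k) (Fin k) (FockSpace J →L[ℂ] FockSpace J)} {z : ℂ}
    (h1 : R * (z • 1 - substitute B fun l => fockSemicircular v (e l)) = 1)
    (h2 : (z • 1 - substitute B fun l => fockSemicircular v (e l)) * R = 1) :
    z • R.map vacuumState
      = 1 + R.map vacuumState * covarianceMap B (fun l => v (e l)) (R.map vacuumState) := by
  classical
  set T := substitute B fun l => fockSemicircular v (e l) with hT
  set G : Matrix (Fin k) (Fin k) ℂ := R.map vacuumState with hG
  have hGapp : ∀ p q, vacuumState (R p q) = G p q := fun p q => rfl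
  have hRr : ∀ p c l, vacuumState (R p c * rightCreation (e l))
      = ((√(v (e l) : ℝ) : ℝ) : ℂ) * (G * letterMatrix B l * G) p c := by
    intro p c l
    have h3 := congrFun (congrFun (commutator_resolvent h1 h2
      (diagonal fun _ => rightCreation (e l))) p) c
    have h4 : T * (diagonal fun _ => rightCreation (e l))
        - (diagonal fun _ => rightCreation (e l)) * T
        = Matrix.of fun i j => if B i j = l then
          ((√(v (e l) : ℝ) : ℝ) : ℂ) • (vacuumProjection : FockSpace J →L[ℂ] FockSpace J)
          else 0 := by
      ext1 i j
      rw [Matrix.sub_apply, mul_diagonal, diagonal_mul, hT]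
      change fockSemicircular v (e (B i j)) * rightCreation (e l)
        - rightCreation (e l) * fockSemicircular v (e (B i j)) = _
      rw [fockSemicircular_mul_rightCreation, of_apply]
      simp only [he.eq_iff]
    rw [h4, mul_diagonal, Matrix.add_apply, diagonal_mul] at h3
    rw [h3, map_add, vacuumState_rightCreation_mul, zero_add]
    simp only [Matrix.mul_apply, of_apply, letterMatrix, Finset.sum_mul, map_sum, Finset.mul_sum]
    refine Finset.sum_congr rfl fun i _ => Finset.sum_congr rfl fun j _ => ?_
    split_ifs
    · rw [mul_smul_comm, smul_mul_assoc, map_smul, vacuumState_mul_vacuumProjection_mul, smul_eq_mul,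
        hGapp, hGapp]
      ring
    · simp
  have h5 : z • R = 1 + R * T := by
    rw [← h1, mul_sub, mul_smul_comm, mul_one, sub_add_cancel]
  ext p q
  have h6 := congrArg vacuumState (congrFun (congrFun h5 p) q)
  rw [Matrix.smul_apply, map_smul, Matrix.add_apply, map_add, Matrix.mul_apply, map_sum] at h6
  rw [Matrix.smul_apply, Matrix.add_apply]
  refine h6.trans ?_
  congr 1
  · by_cases hpq : p = q
    · subst hpq
      rw [one_apply_eq, one_apply_eq, isState_vacuumState.map_one]
    · rw [one_apply_ne hpq, one_apply_ne hpq, map_zero]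
  · have h7 : ∀ c, vacuumState (R p c * T c q) = (v (e (B c q)) : ℝ) *
        (G * letterMatrix B (B c q) * G) p c := by
      intro c
      change vacuumState (R p c * fockSemicircular v (e (B c q))) = _
      rw [vacuumState_mul_fockSemicircular, hRr, ← mul_assoc, ← Complex.ofReal_mul,
        Real.mul_self_sqrt (NNReal.coe_nonneg _)]
    simp_rw [h7]
    rw [covarianceMap_apply, Finset.mul_sum, Matrix.sum_apply]
    simp_rw [mul_smul_comm, Matrix.smul_apply, ← mul_assoc]
    have h8 : ∀ l, (G * letterMatrix B l * G * letterMatrix B l) p q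
        = ∑ c, if B c q = l then (G * letterMatrix B l * G) p c else 0 := by
      intro l
      rw [Matrix.mul_apply]
      simp [letterMatrix]
    simp_rw [h8, smul_eq_mul, Finset.mul_sum]
    rw [Finset.sum_comm]
    refine Finset.sum_congr rfl fun c _ => ?_
    rw [Finset.sum_eq_single (B c q)]
    · simp
    · intro l _ hl
      simp [hl.symm]
    · simp

end FockDyson

/-! ### The law of the free block matrix and its Cauchy transform -/

section BlockDistribution

open scoped Matrix.Norms.L2Operator

variable {k h : ℕ} {J : Type*}

/-- The state `τ ⊗ tr_k` on the C⋆-algebra of `k × k` matrices. -/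
def blockState {𝒜 : Type*} [CStarAlgebra 𝒜] (τ : 𝒜 →ₗ[ℂ] ℂ) (k : ℕ) :
    CStarMatrix (Fin k) (Fin k) 𝒜 →ₗ[ℂ] ℂ where
  toFun M := tensorTrace τ (CStarMatrix.ofMatrix.symm M)
  map_add' M N := by
    simp only [tensorTrace, CStarMatrix.ofMatrix_symm_apply, CStarMatrix.add_apply, map_add,
      Finset.sum_add_distrib, mul_add]
  map_smul' c M := by
    simp only [tensorTrace, CStarMatrix.ofMatrix_symm_apply, CStarMatrix.smul_apply, map_smul,
      ← Finset.smul_sum, mul_smul_comm, RingHom.id_apply]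

lemma blockState_apply {𝒜 : Type*} [CStarAlgebra 𝒜] (τ : 𝒜 →ₗ[ℂ] ℂ)
    (M : CStarMatrix (Fin k) (Fin k) 𝒜) : blockState τ k M = (k : ℂ)⁻¹ * ∑ i, τ (M i i) := rfl

lemma isState_blockState {𝒜 : Type*} [CStarAlgebra 𝒜] [PartialOrder 𝒜] [StarOrderedRing 𝒜]
    [NeZero k] {τ : 𝒜 →ₗ[ℂ] ℂ} (hτ : IsState τ) : IsState (blockState τ k) where
  map_one := by
    simp [blockState_apply, hτ.map_one, NeZero.ne k]
  map_star M := by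
    simp only [blockState_apply, CStarMatrix.star_apply, hτ.map_star, star_mul', star_sum]
    simp
  nonneg M := by
    rw [blockState_apply]
    refine mul_nonneg (by positivity) (Finset.sum_nonneg fun i _ => ?_)
    rw [CStarMatrix.mul_apply, map_sum]
    refine Finset.sum_nonneg fun j _ => ?_
    rw [CStarMatrix.star_apply]
    exact hτ.nonneg _

/-- Matrices over the operators on Fock space form a C⋆-algebra in which the block operator is
selfadjoint; its spectral distribution is `μ`, and `G` is the entrywise vacuum state of its
resolvent. The bound on `G` sums `k ^ 2` entries, each at most `2 |y|⁻¹`. -/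
theorem exists_blockDistribution [NeZero k] {B : Matrix (Fin k) (Fin k) (Fin h)} (hB : B.IsSymm)
    (v : J → ℝ≥0) {e : Fin h → J} (he : Function.Injective e) :
    ∃ (μ : ProbabilityMeasure ℝ) (G : ℝ → Matrix (Fin k) (Fin k) ℂ),
      IsCompact (μ : Measure ℝ).support ∧
      (∀ s : ℕ, tensorTrace vacuumState (substitute B (fun l => fockSemicircular v (e l)) ^ s)
        = ((∫ x, x ^ s ∂(μ : Measure ℝ) : ℝ) : ℂ)) ∧
      ∀ y : ℝ, y ≠ 0 → ‖G y‖ ≤ 2 * k ^ 2 * |y|⁻¹ ∧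
        (y * Complex.I) • G y = 1 + G y * covarianceMap B (fun l => v (e l)) (G y) ∧
        ∫ x : ℝ, ((y : ℂ) * Complex.I - x)⁻¹ ∂(μ : Measure ℝ) = (k : ℂ)⁻¹ * (G y).trace := by
  set T : CStarMatrix (Fin k) (Fin k) (FockSpace J →L[ℂ] FockSpace J) :=
    CStarMatrix.ofMatrix (substitute B fun l => fockSemicircular v (e l)) with hT
  have hTapp : ∀ p q, T p q = fockSemicircular v (e (B p q)) := fun p q => rfl
  have hsa : IsSelfAdjoint T := by
    rw [isSelfAdjoint_iff]
    ext1 p q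
    rw [CStarMatrix.star_apply, hTapp, hTapp, hB.apply,
      (isSelfAdjoint_fockSemicircular v _).star_eq]
  obtain ⟨μ, hμc, hμ⟩ := (isState_blockState (k := k)
    (isState_vacuumState (J := J))).exists_spectralDistribution hsa
  choose! R hR1 hR2 hR3 hR4 using fun (y : ℝ) (hy : y ≠ 0) => hsa.exists_resolvent hy
  refine ⟨μ, fun y => (CStarMatrix.ofMatrix.symm (R y)).map vacuumState, hμc, ?_, ?_⟩
  · intro s
    have h1 := hμ (fun x => x ^ s) (by fun_prop)
    rw [cfc_pow_id T s] at h1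
    rw [← h1]
    have h2 : T ^ s = CStarMatrix.ofMatrix (substitute B (fun l => fockSemicircular v (e l)) ^ s) :=
      (map_pow (CStarMatrix.ofMatrixRingEquiv (A := FockSpace J →L[ℂ] FockSpace J)
        (n := Fin k)) _ s).symm
    rw [h2]
    rfl
  · intro y hy
    refine ⟨?_, ?_, ?_⟩
    · refine (Matrix.norm_le_sum_norm_apply _).trans ?_
      calc _ ≤ ∑ _p : Fin k, ∑ _q : Fin k, 2 * |y|⁻¹ :=
            Finset.sum_le_sum fun p _ => Finset.sum_le_sum fun q _ =>
              (norm_vacuumState_le _).trans (CStarMatrix.norm_entry_le_norm.trans (hR3 y hy))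
        _ = 2 * k ^ 2 * |y|⁻¹ := by
            simp
            ring
    · exact fock_dyson B v he (hR1 y hy) (hR2 y hy)
    · rw [← hR4 y hy hμ]
      rfl

end BlockDistribution

end

noncomputable section

/-! ### Uniqueness and symmetry of the limit -/

section Symmetry

open scoped Matrix.Norms.L2Operator

variable {k h : ℕ}

lemma eq_of_dyson {B : Matrix (Fin k) (Fin k) (Fin h)} {v : Fin h → ℝ≥0} {z : ℂ}
    {D G : Matrix (Fin k) (Fin k) ℂ} {κ : ℝ} (hD : ‖D‖ ≤ κ) (hG : ‖G‖ ≤ κ)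
    (hDD : z • D = 1 + D * covarianceMap B v D) (hGD : z • G = 1 + G * covarianceMap B v G)
    (hlarge : 2 * κ * covarianceBound B v < ‖z‖) : D = G := by
  have h1 := norm_sub_le_of_dyson hD hG hGD
  rw [hDD, add_sub_cancel_left, sub_self, norm_zero] at h1
  have h2 : ‖D - G‖ ≤ 0 := by
    by_contra! h3
    exact absurd h1 (not_le.2 (mul_pos (sub_pos.2 hlarge) h3))
  exact sub_eq_zero.1 (norm_le_zero_iff.1 h2)

/-- The Dyson equation is invariant under changing the signs of `z` and `G` together, so uniqueness
gives `-G(-y) = G(y)` for large `y`. The reflected measure then has the same Cauchy transform at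
those points, and a constant sequence of measures has only one weak limit. -/
lemma map_neg_eq_of_stieltjes {B : Matrix (Fin k) (Fin k) (Fin h)} {v : Fin h → ℝ≥0}
    {μ : ProbabilityMeasure ℝ} {G : ℝ → Matrix (Fin k) (Fin k) ℂ} {K y₀ : ℝ} (hy₀ : 0 ≤ y₀)
    (hG : ∀ y : ℝ, y ≠ 0 → ‖G y‖ ≤ K * |y|⁻¹ ∧
        (y * Complex.I) • G y = 1 + G y * covarianceMap B v (G y) ∧
        ∫ x : ℝ, ((y : ℂ) * Complex.I - x)⁻¹ ∂(μ : Measure ℝ) = (k : ℂ)⁻¹ * (G y).trace)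
    (hlarge : ∀ y, y₀ < y → 2 * (K * |y|⁻¹) * covarianceBound B v < |y|) :
    (μ : Measure ℝ).map (fun x => -x) = (μ : Measure ℝ) := by
  have hsymm : ∀ y, y₀ < y → -G (-y) = G y := by
    intro y hy
    have hy0 : y ≠ 0 := (hy₀.trans_lt hy).ne'
    obtain ⟨h1, h2, -⟩ := hG (-y) (neg_ne_zero.2 hy0)
    obtain ⟨h3, h4, -⟩ := hG y hy0
    rw [abs_neg] at h1
    refine eq_of_dyson (z := y * Complex.I) (by rwa [norm_neg]) h3 ?_ h4 (by simpa using hlarge y hy)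
    rw [map_neg, neg_mul_neg, ← h2]
    push_cast
    rw [smul_neg, neg_mul, neg_smul]
  let ν : ProbabilityMeasure ℝ := ⟨(μ : Measure ℝ).map (fun x => -x),
    Measure.isProbabilityMeasure_map measurable_neg.aemeasurable⟩
  have hν : ∀ y : ℝ, y₀ < y → ∫ x : ℝ, ((y : ℂ) * Complex.I - x)⁻¹ ∂(ν : Measure ℝ)
      = ∫ x : ℝ, ((y : ℂ) * Complex.I - x)⁻¹ ∂(μ : Measure ℝ) := by
    intro y hy
    have hy0 : y ≠ 0 := (hy₀.trans_lt hy).ne'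
    change ∫ x : ℝ, ((y : ℂ) * Complex.I - x)⁻¹ ∂((μ : Measure ℝ).map (MeasurableEquiv.neg ℝ)) = _
    rw [(MeasurableEquiv.neg ℝ).measurableEmbedding.integral_map]
    have h1 : ∀ x : ℝ, ((y : ℂ) * Complex.I - ((-x : ℝ) : ℂ))⁻¹
        = -((((-y : ℝ) : ℂ)) * Complex.I - x)⁻¹ := by
      intro x
      rw [← inv_neg]
      congr 1
      push_cast
      ring
    change ∫ x : ℝ, ((y : ℂ) * Complex.I - ((-x : ℝ) : ℂ))⁻¹ ∂(μ : Measure ℝ) = _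
    simp_rw [h1]
    rw [integral_neg, (hG (-y) (neg_ne_zero.2 hy0)).2.2, (hG y hy0).2.2, ← hsymm y hy,
      Matrix.trace_neg, mul_neg]
  have h1 : Tendsto (fun _ : ℕ => ν) atTop (𝓝 μ) := by
    refine tendsto_of_tendsto_stieltjes (y₀ := y₀) fun q hq => ?_
    rw [hν q hq]
    exact tendsto_const_nhds
  exact congrArg ProbabilityMeasure.toMeasure (tendsto_nhds_unique tendsto_const_nhds h1)

lemma IsFreeSemicircular.comp {𝒜 : Type*} [Ring 𝒜] [StarRing 𝒜] [Algebra ℂ 𝒜] [StarModule ℂ 𝒜]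
    {I J : Type*} {τ : 𝒜 →ₗ[ℂ] ℂ} {v : J → ℝ≥0} {a : J → 𝒜} (ha : IsFreeSemicircular τ v a)
    {e : I → J} (he : Function.Injective e) : IsFreeSemicircular τ (v ∘ e) (a ∘ e) where
  selfAdjoint l := ha.selfAdjoint (e l)
  law l := ha.law (e l)
  free m j x hj hx hx0 := ha.free m (e ∘ j) x (fun i => he.ne (hj i)) hx hx0

end Symmetry

end

/-! ### The existence theorem -/

theorem theorem1 {k h : ℕ} [NeZero k] (B : Matrix (Fin k) (Fin k) (Fin h)) (hB : B.IsSymm)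
    (v : Fin h → ℝ≥0) :
    ∃ μ : ProbabilityMeasure ℝ,
      -- `μ` has compact support and is symmetric
      IsCompact (μ : Measure ℝ).support ∧
      (μ : Measure ℝ).map (fun x => -x) = (μ : Measure ℝ) ∧
      -- free semicircular families exist
      (∃ (𝒜 : Type w) (_ : Ring 𝒜) (_ : StarRing 𝒜) (_ : Algebra ℂ 𝒜) (_ : StarModule ℂ 𝒜)
        (τ : 𝒜 →ₗ[ℂ] ℂ) (a : Fin h → 𝒜), IsState τ ∧ IsFreeSemicircular τ v a) ∧
      -- for each of them, the moments of `μ` are those of `B(a 1, …, a h)`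
      (∀ (𝒜 : Type w) [Ring 𝒜] [StarRing 𝒜] [Algebra ℂ 𝒜] [StarModule ℂ 𝒜]
        (τ : 𝒜 →ₗ[ℂ] ℂ) (a : Fin h → 𝒜), IsState τ → IsFreeSemicircular τ v a →
        ∀ s : ℕ, tensorTrace τ (substitute B a ^ s) =
          ((∫ x, x ^ s ∂(μ : Measure ℝ) : ℝ) : ℂ)) ∧
      -- almost sure weak convergence of the spectral measures
      (∀ (Ω : Type u) [MeasurableSpace Ω] (P : Measure Ω) [IsProbabilityMeasure P]
        (X : Fin h → ℕ → ℕ → Ω → ℂ) (hX : ∀ l, IsWignerArray (X l) (v l) P),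
        iIndepFun (fun l ω (p : ℕ × ℕ) => X l p.1 p.2 ω) P →
        (∀ l, MemLp (X l 0 1) 4 P) → (∀ l, MemLp (X l 0 0) 2 P) →
        ∀ᵐ ω ∂P, Tendsto
          (fun n : ℕ => spectralMeasure
            (blockMatrix B fun l => wignerMatrix (X l) (n + 1) ω)
            (blockMatrix_isHermitian hB fun l => (hX l).isHermitian (n + 1) ω))
          atTop (𝓝 μ)) := by
  -- The alphabet is lifted so that the operators on the Fock space live in the universe `w` of the
  -- statement.
  set J := ULift.{w} (Fin h)
  set v' : J → ℝ≥0 := v ∘ ULift.down with hv'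
  have he : Function.Injective (ULift.up : Fin h → J) := ULift.up_injective
  have hfree : IsFreeSemicircular vacuumState v (fockSemicircular v' ∘ ULift.up) :=
    (isFreeSemicircular_fockSemicircular v').comp he
  obtain ⟨μ, G, hμ, hmom, hG⟩ := exists_blockDistribution hB v' he
  set K : ℝ := 2 * k ^ 2 with hK
  -- For `y > y₀` both `y > 1` and `y > 2 K c` hold, with `c` the covariance bound; hence `2 K c / y
  -- < y`, the condition for stability.
  set y₀ : ℝ := 1 + 2 * K * covarianceBound B v with hy₀
  have hc := covarianceBound_nonneg B v
  have hK0 : 0 ≤ 2 * K * covarianceBound B v := by positivity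
  have hy₀1 : 1 ≤ y₀ := by linarith
  have hlarge : ∀ y, y₀ < y → 2 * (K * |y|⁻¹) * covarianceBound B v < |y| := by
    intro y hy
    have hy1 : 1 < y := hy₀1.trans_lt hy
    have hy0 : 0 < y := by linarith
    rw [abs_of_pos hy0, show 2 * (K * y⁻¹) * covarianceBound B v
      = (2 * K * covarianceBound B v) / y by ring, div_lt_iff₀ hy0]
    nlinarith
  have hne : ∀ y, y₀ < y → y ≠ 0 := fun y hy => by
    rintro rfl
    linarith
  refine ⟨μ, hμ, map_neg_eq_of_stieltjes (zero_le_one.trans hy₀1) hG hlarge,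
    ⟨FockSpace J →L[ℂ] FockSpace J, inferInstance, inferInstance, inferInstance, inferInstance,
      vacuumState, _, isState_vacuumState, hfree⟩, ?_, ?_⟩
  · intro 𝒜 _ _ _ _ τ a hτ ha s
    rw [ha.tensorTrace_pow_eq hτ isState_vacuumState hfree B s]
    exact hmom s
  · intro Ω _ P _ X hX hind h4 h2
    exact ae_tendsto_spectralMeasure hB hX hind h4 h2 (K := K) (by
        rw [hK]
        nlinarith [sq_nonneg (k : ℝ)]) (zero_le_one.trans hy₀1)
      (fun y hy => (hG y (hne y hy)).1) (fun y hy => (hG y (hne y hy)).2.1) hlarge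
      fun y hy => (hG y (hne y hy)).2.2
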